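/- Let $n\ge 1$, let $q\in\mathbb C^\times$ not be a root of unity, and fix a square root $q^{1/2}$ of $q$. Put $\theta=q^{1/2}-q^{-1/2}$, $[m]_q=\frac{q^m-q^{-m}}{q-q^{-1}}$, $[m]_q!=[1]_q\cdots[m]_q$ and $[x,y]_a=xy-a\,yx$. **The quantum group.** Let $\varepsilon_1,\dots,\varepsilon_n$ be orthonormal, $\alpha_1=\varepsilon_1$, $\alpha_i=\varepsilon_i-\varepsilon_{i-1}$ for $2\le i\le n$. $U=U_q(\mathfrak g)$, $\mathfrak g=\mathfrak{so}(2n+1)$, is the associative unital $\mathbb C$-algebra generated by $e_\alpha$, $f_\alpha=e_{-\alpha}$, $q^{\pm h_\alpha}$ ($\alpha\in\Pi=\{\alpha_1,\dots,\alpha_n\}$), where the $q^{h_\alpha}$ commute with each other and have inverses $q^{-h_\alpha}$, with the relations, for $\alpha,\beta\in\Pi$: $$q^{h_\alpha}e_{\pm\beta}q^{-h_\alpha}=q^{\pm(\alpha,\beta)}e_{\pm\beta},\qquad e_\alpha f_\beta-f_\beta e_\alpha=\delta_{\alpha\beta}\frac{q^{h_\alpha}-q^{-h_\alpha}}{q-q^{-1}},$$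 $[e_{\pm\alpha},[e_{\pm\alpha},e_{\pm\beta}]_q]_{q^{-1}}=0$ if $2(\alpha,\beta)=-(\alpha,\alpha)$; $e_{\pm\alpha}e_{\pm\beta}=e_{\pm\beta}e_{\pm\alpha}$ if $(\alpha,\beta)=0$; and, for $n\ge2$, $e_{\pm\alpha_1}$ commutes with $e_{\pm\delta}=[e_{\pm\alpha_1},[e_{\pm\alpha_1},e_{\pm\alpha_2}]_q]_{q^{-1}}$. Write $f_\delta=e_{-\delta}$. Let $U_q(\mathfrak g_+)$, $U_q(\mathfrak g_-)$, $U_q(\mathfrak h)$ be the subalgebras generated by the $e_\alpha$, by the $f_\alpha$ and by the $q^{\pm h_\alpha}$. Let $\omega$ be the anti-automorphism $e_\alpha\leftrightarrow f_\alpha$, $q^{h_\alpha}\mapsto q^{h_\alpha}$. The coproduct is $\Delta(e_\alpha)=e_\alpha\otimes q^{h_\alpha}+1\otimes e_\alpha$, $\Delta(f_\alpha)=f_\alpha\otimes1+q^{-h_\alpha}\otimes f_\alpha$, $\Delta(q^{h_\alpha})=q^{h_\alpha}\otimes q^{h_\alpha}$; its inverse antipode is the anti-automorphism $\gamma^{-1}$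 with $\gamma^{-1}(e_\alpha)=-q^{-h_\alpha}e_\alpha$, $\gamma^{-1}(f_\alpha)=-f_\alpha q^{h_\alpha}$, $\gamma^{-1}(q^{h_\alpha})=q^{-h_\alpha}$. **The modules.** Let $\lambda$ be a weight with $q^{2(\lambda,\varepsilon_i)}=-q^{-1}$ for all $i$ and $(\lambda,\alpha_i)=0$ for $i>1$. (Only the common value $s=q^{(\lambda,\varepsilon_i)}$ is used; it may be any complex number with $s^2=-q^{-1}$, and then $q^{(\lambda,\alpha_1)}=s$, $q^{(\lambda,\alpha_i)}=1$ for $i>1$.) Let $\hat M_\lambda$ be the $U$-module generated by a vector $1_\lambda$ subject to $q^{h_\alpha}1_\lambda=q^{(\lambda,\alpha)}1_\lambda$ and $e_\alpha1_\lambda=0$ for $\alpha\in\Pi$, and $f_{\alpha_i}1_\lambda=0$ for $i>1$; and let $\hat N_\lambda$ be the $U$-module generated by $1^*_\lambda$ subject to $q^{h_\alpha}1^*_\lambda=q^{-(\lambda,\alpha)}1^*_\lambda$ and $f_\alpha1^*_\lambda=0$ for $\alpha\in\Pi$, and $e_{\alpha_i}1^*_\lambda=0$ for $i>1$. (These are the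 modules induced from one-dimensional representations $\mathbb C_{\pm\lambda}$ of $U_q(\mathfrak p_\pm)$.) Put $M_\lambda=\hat M_\lambda/Uf_\delta1_\lambda$ and $N_\lambda=\hat N_\lambda/Ue_\delta1^*_\lambda$ (with $M_\lambda=\hat M_\lambda$, $N_\lambda=\hat N_\lambda$ if $n=1$). **Root vectors.** For $1\le i\le n$ let $f_{\varepsilon_i}=[\dots[f_{\alpha_1},f_{\alpha_2}]_{q^{-1}},\dots,f_{\alpha_i}]_{q^{-1}}$, and let $\tilde e_{\varepsilon_1}=e_{\alpha_1}$, $\tilde e_{\varepsilon_{i+1}}=[e_{\alpha_{i+1}},\tilde e_{\varepsilon_i}]_{q^{-1}}$. **Forms.** There is a unique linear functional $x\mapsto\langle x\rangle$ on $U$ that vanishes on $f_\alpha U$ and $Ue_\alpha$ for all $\alpha\in\Pi$ and restricts to $U_q(\mathfrak h)$ as the unital algebra character $q^{h_\alpha}\mapsto q^{(\lambda,\alpha)}$. The Shapovalov form is the bilinear form on $M_\lambda$ given by $(x1_\lambda,y1_\lambda)\mapsto\langle\omega(x)y\rangle$, and the invariant pairing is the bilinear form $(\cdot,\cdot)\colon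 M_\lambda\otimes N_\lambda\to\mathbb C$ given by $(x1_\lambda,y1^*_\lambda)=\langle\gamma^{-1}(y)x\rangle$, $x,y\in U$. **Proposition.** Both forms are well defined, the second is $U$-invariant with respect to $\Delta$ and satisfies $(1_\lambda,1_\lambda^*)=1$, and: 1. The vectors $f_{\varepsilon_1}^{m_1}\cdots f_{\varepsilon_n}^{m_n}1_\lambda$, $m_1,\dots,m_n\in\mathbb Z_{\ge0}$, form a basis of $M_\lambda$, which is orthogonal with respect to the Shapovalov form; the value of the form on each basis vector paired with itself is non-zero. 2. The $U$-modules $M_\lambda$ and $N_\lambda$ are irreducible. 3. The formal sum of elements of $U_q(\mathfrak g_+)\otimes U_q(\mathfrak g_-)$ $$\mathcal F=\sum_{m_1,\dots,m_n=0}^\infty(-\theta)^{\sum_i m_i}\,\frac{\prod_{i=1}^nq^{-\frac{m_i^2}2+2m_i(i-1)}}{\prod_{i=1}^n[m_i]_q!}\;\tilde e_{\varepsilon_1}^{m_1}\cdots\tilde e_{\varepsilon_n}^{m_n}\otimes f_{\varepsilon_1}^{m_1}\cdots f_{\varepsilon_n}^{m_n}$$ is a lift of the inverse of the invariant pairing: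 let $\mathcal F_m$ ($m\in\mathbb Z_{\ge0}^n$) be its terms and let $\sum_k w_{m,k}\otimes v_{m,k}\in N_\lambda\otimes M_\lambda$ be the image of $\mathcal F_m$ under $x\otimes y\mapsto x1^*_\lambda\otimes y1_\lambda$. Then for every $v\in M_\lambda$ and every $w\in N_\lambda$, only finitely many of the vectors $\sum_k(v,w_{m,k})\,v_{m,k}$ and of the vectors $\sum_k(v_{m,k},w)\,w_{m,k}$ are non-zero, and $$\sum_m\sum_k(v,w_{m,k})\,v_{m,k}=v,\qquad\sum_m\sum_k(v_{m,k},w)\,w_{m,k}=w.$$ -/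

import Mathlib

open scoped TensorProduct

namespace QSphere

noncomputable section

/-! ### Roots, q-numbers, q-commutators -/

/-- Coordinates, in the orthonormal basis `ε_1, …, ε_n` of short roots, of the simple roots
`α_1 = ε_1` and `α_i = ε_i - ε_{i-1}` (`i > 1`) of type `B_n`.  All indices start from `0` here,
so `simpleRoot i` is `α_{i+1}`, and its `k`-th coordinate is that along `ε_{k+1}`. -/
def simpleRoot {n : ℕ} (i k : Fin n) : ℤ :=
  (if k = i then 1 else 0) - (if (k : ℕ) + 1 = (i : ℕ) then 1 else 0)

/-- The inner product `(α_i, α_j)`. -/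
def pairing {n : ℕ} (i j : Fin n) : ℤ := ∑ k, simpleRoot i k * simpleRoot j k

/-- `[m]_q = (q^m - q^{-m}) / (q - q^{-1})`. -/
def qNumber (q : ℂˣ) (m : ℕ) : ℂ :=
  ((q : ℂ) ^ m - ((q⁻¹ : ℂˣ) : ℂ) ^ m) / ((q : ℂ) - ((q⁻¹ : ℂˣ) : ℂ))

/-- `[m]_q! = [1]_q [2]_q ⋯ [m]_q`. -/
def qFactorial (q : ℂˣ) (m : ℕ) : ℂ := ∏ k ∈ Finset.range m, qNumber q (k + 1)

section Commutators

variable {A : Type*} [Ring A] [Algebra ℂ A]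

/-- `[x, y]_a = x y - a y x`. -/
def qComm (a : ℂ) (x y : A) : A := x * y - a • (y * x)

/-- Extension by zero of a family indexed by the simple roots to all natural indices. -/
def extZero {n : ℕ} (g : Fin n → A) (k : ℕ) : A := if h : k < n then g ⟨k, h⟩ else 0

/-- `x_δ = [x_{α_1}, [x_{α_1}, x_{α_2}]_q]_{q⁻¹}`, of weight `δ = ε_1 + ε_2`.
For `n = 1` there is no root `δ`, and the value is `0`. -/
def deltaVec (q : ℂˣ) {n : ℕ} (g : Fin n → A) : A :=
  qComm ((q⁻¹ : ℂˣ) : ℂ) (extZero g 0) (qComm (q : ℂ) (extZero g 0) (extZero g 1))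

/-- The negative composite root vectors
`[… [x_{α_1}, x_{α_2}]_{q⁻¹}, … x_{α_i}]_{q⁻¹}`, at the (zero based) index. -/
def rootVecF (q : ℂˣ) {n : ℕ} (f : Fin n → A) : ℕ → A
  | 0 => extZero f 0
  | k + 1 => qComm ((q⁻¹ : ℂˣ) : ℂ) (rootVecF q f k) (extZero f (k + 1))

/-- The positive composite root vectors `ẽ_{ε_1} = e_{α_1}`,
`ẽ_{ε_{i+1}} = [e_{α_{i+1}}, ẽ_{ε_i}]_{q⁻¹}`, at the (zero based) index. -/
def rootVecE (q : ℂˣ) {n : ℕ} (e : Fin n → A) : ℕ → A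
  | 0 => extZero e 0
  | k + 1 => qComm ((q⁻¹ : ℂˣ) : ℂ) (extZero e (k + 1)) (rootVecE q e k)

/-- The ordered monomial `x_1^{m_1} x_2^{m_2} ⋯ x_n^{m_n}`. -/
def monomial {n : ℕ} (x : ℕ → A) (m : Fin n → ℕ) : A :=
  (List.ofFn fun i : Fin n => x i ^ m i).prod

end Commutators

/-! ### The quantum group `U_q(so(2n+1))` -/

/-- Names of the generators `e_{α_i}`, `f_{α_i} = e_{-α_i}`, `q^{h_{α_i}}`, `q^{-h_{α_i}}`. -/
inductive Gen (n : ℕ) : Type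
  | e (i : Fin n)
  | f (i : Fin n)
  | k (i : Fin n)
  | kInv (i : Fin n)

/-- Shorthands for the free generators. -/
abbrev freeE {n : ℕ} (i : Fin n) : FreeAlgebra ℂ (Gen n) := FreeAlgebra.ι ℂ (Gen.e i)
abbrev freeF {n : ℕ} (i : Fin n) : FreeAlgebra ℂ (Gen n) := FreeAlgebra.ι ℂ (Gen.f i)
abbrev freeK {n : ℕ} (i : Fin n) : FreeAlgebra ℂ (Gen n) := FreeAlgebra.ι ℂ (Gen.k i)
abbrev freeKInv {n : ℕ} (i : Fin n) : FreeAlgebra ℂ (Gen n) := FreeAlgebra.ι ℂ (Gen.kInv i)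

/-- The defining relations of the quantum group. -/
inductive Rel (n : ℕ) (q : ℂˣ) : FreeAlgebra ℂ (Gen n) → FreeAlgebra ℂ (Gen n) → Prop
  | k_kInv (i) : Rel n q (freeK i * freeKInv i) 1
  | kInv_k (i) : Rel n q (freeKInv i * freeK i) 1
  | k_comm (i j) : Rel n q (freeK i * freeK j) (freeK j * freeK i)
  | k_e (i j) : Rel n q (freeK i * freeE j * freeKInv i)
      (((q ^ pairing i j : ℂˣ) : ℂ) • freeE j)
  | k_f (i j) : Rel n q (freeK i * freeF j * freeKInv i)
      (((q ^ (-pairing i j) : ℂˣ) : ℂ) • freeF j)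
  | e_f_same (i) : Rel n q (freeE i * freeF i - freeF i * freeE i)
      (((q : ℂ) - ((q⁻¹ : ℂˣ) : ℂ))⁻¹ • (freeK i - freeKInv i))
  | e_f_diff (i j) (h : i ≠ j) : Rel n q (freeE i * freeF j - freeF j * freeE i) 0
  | serre_e (i j) (h : 2 * pairing i j = -pairing i i) :
      Rel n q (qComm ((q⁻¹ : ℂˣ) : ℂ) (freeE i) (qComm (q : ℂ) (freeE i) (freeE j))) 0
  | serre_f (i j) (h : 2 * pairing i j = -pairing i i) :
      Rel n q (qComm ((q⁻¹ : ℂˣ) : ℂ) (freeF i) (qComm (q : ℂ) (freeF i) (freeF j))) 0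
  | delta_e : Rel n q (extZero freeE 0 * deltaVec q freeE - deltaVec q freeE * extZero freeE 0) 0
  | delta_f : Rel n q (extZero freeF 0 * deltaVec q freeF - deltaVec q freeF * extZero freeF 0) 0
  | e_comm (i j) (h : pairing i j = 0) : Rel n q (freeE i * freeE j) (freeE j * freeE i)
  | f_comm (i j) (h : pairing i j = 0) : Rel n q (freeF i * freeF j) (freeF j * freeF i)

/-- The quantum group `U_q(g)`, `g = so(2n+1)`. -/
def Uq (n : ℕ) (q : ℂˣ) : Type := RingQuot (Rel n q)

instance (n : ℕ) (q : ℂˣ) : Ring (Uq n q) := inferInstanceAs (Ring (RingQuot (Rel n q)))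

instance (n : ℕ) (q : ℂˣ) : Algebra ℂ (Uq n q) :=
  inferInstanceAs (Algebra ℂ (RingQuot (Rel n q)))

/-- The quotient map from the free algebra. -/
def Uq.mk (n : ℕ) (q : ℂˣ) : FreeAlgebra ℂ (Gen n) →ₐ[ℂ] Uq n q := RingQuot.mkAlgHom ℂ (Rel n q)

/-- `e_{α_i}` -/
def E {n : ℕ} (q : ℂˣ) (i : Fin n) : Uq n q := Uq.mk n q (freeE i)
/-- `f_{α_i} = e_{-α_i}` -/
def F {n : ℕ} (q : ℂˣ) (i : Fin n) : Uq n q := Uq.mk n q (freeF i)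
/-- `q^{h_{α_i}}` -/
def K {n : ℕ} (q : ℂˣ) (i : Fin n) : Uq n q := Uq.mk n q (freeK i)
/-- `q^{-h_{α_i}}` -/
def KInv {n : ℕ} (q : ℂˣ) (i : Fin n) : Uq n q := Uq.mk n q (freeKInv i)

theorem Uq.mk_rel {n : ℕ} {q : ℂˣ} {x y : FreeAlgebra ℂ (Gen n)} (h : Rel n q x y) :
    Uq.mk n q x = Uq.mk n q y := RingQuot.mkAlgHom_rel ℂ h

/-- The homomorphism from the quantum group determined by images of the generators. -/
def Uq.lift {n : ℕ} {q : ℂˣ} {A : Type*} [Ring A] [Algebra ℂ A] (g : Gen n → A)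
    (h : ∀ ⦃x y⦄, Rel n q x y → FreeAlgebra.lift ℂ g x = FreeAlgebra.lift ℂ g y) :
    Uq n q →ₐ[ℂ] A := RingQuot.liftAlgHom ℂ ⟨FreeAlgebra.lift ℂ g, h⟩

theorem Uq.lift_mk {n : ℕ} {q : ℂˣ} {A : Type*} [Ring A] [Algebra ℂ A] (g : Gen n → A)
    (h : ∀ ⦃x y⦄, Rel n q x y → FreeAlgebra.lift ℂ g x = FreeAlgebra.lift ℂ g y)
    (x : FreeAlgebra ℂ (Gen n)) :
    Uq.lift g h (Uq.mk n q x) = FreeAlgebra.lift ℂ g x :=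
  RingQuot.liftAlgHom_mkAlgHom_apply ℂ (FreeAlgebra.lift ℂ g) h x

section Relations

variable {A B : Type*} [Ring A] [Algebra ℂ A] [Ring B] [Algebra ℂ B]

theorem map_qComm (φ : A →ₐ[ℂ] B) (a : ℂ) (x y : A) :
    φ (qComm a x y) = qComm a (φ x) (φ y) := by
  simp [qComm]

theorem map_extZero (φ : A →ₐ[ℂ] B) {n : ℕ} (g : Fin n → A) (k : ℕ) :
    φ (extZero g k) = extZero (fun i => φ (g i)) k := by
  unfold extZero
  split_ifs <;> simp

theorem map_deltaVec (φ : A →ₐ[ℂ] B) (q : ℂˣ) {n : ℕ} (g : Fin n → A) :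
    φ (deltaVec q g) = deltaVec q (fun i => φ (g i)) := by
  simp [deltaVec, map_qComm, map_extZero]

/-- A family of elements of an algebra satisfies the relations of the quantum group. -/
structure Satisfies (n : ℕ) (q : ℂˣ) (e f k k' : Fin n → A) : Prop where
  k_kInv : ∀ i, k i * k' i = 1
  kInv_k : ∀ i, k' i * k i = 1
  k_comm : ∀ i j, k i * k j = k j * k i
  k_e : ∀ i j, k i * e j * k' i = ((q ^ pairing i j : ℂˣ) : ℂ) • e j
  k_f : ∀ i j, k i * f j * k' i = ((q ^ (-pairing i j) : ℂˣ) : ℂ) • f j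
  e_f_same : ∀ i, e i * f i - f i * e i = ((q : ℂ) - ((q⁻¹ : ℂˣ) : ℂ))⁻¹ • (k i - k' i)
  e_f_diff : ∀ i j, i ≠ j → e i * f j - f j * e i = 0
  serre_e : ∀ i j, 2 * pairing i j = -pairing i i →
    qComm ((q⁻¹ : ℂˣ) : ℂ) (e i) (qComm (q : ℂ) (e i) (e j)) = 0
  serre_f : ∀ i j, 2 * pairing i j = -pairing i i →
    qComm ((q⁻¹ : ℂˣ) : ℂ) (f i) (qComm (q : ℂ) (f i) (f j)) = 0
  delta_e : extZero e 0 * deltaVec q e - deltaVec q e * extZero e 0 = 0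
  delta_f : extZero f 0 * deltaVec q f - deltaVec q f * extZero f 0 = 0
  e_comm : ∀ i j, pairing i j = 0 → e i * e j = e j * e i
  f_comm : ∀ i j, pairing i j = 0 → f i * f j = f j * f i

/-- Images of the generators, as one function. -/
def genImage {n : ℕ} (e f k k' : Fin n → A) : Gen n → A
  | .e i => e i
  | .f i => f i
  | .k i => k i
  | .kInv i => k' i

theorem Satisfies.lift_eq {n : ℕ} {q : ℂˣ} {e f k k' : Fin n → A}
    (H : Satisfies n q e f k k') ⦃x y : FreeAlgebra ℂ (Gen n)⦄ (h : Rel n q x y) :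
    FreeAlgebra.lift ℂ (genImage e f k k') x = FreeAlgebra.lift ℂ (genImage e f k k') y := by
  cases h with
  | k_kInv i => simpa [genImage] using H.k_kInv i
  | kInv_k i => simpa [genImage] using H.kInv_k i
  | k_comm i j => simpa [genImage] using H.k_comm i j
  | k_e i j => simpa [genImage] using H.k_e i j
  | k_f i j => simpa [genImage] using H.k_f i j
  | e_f_same i => simpa [genImage] using H.e_f_same i
  | e_f_diff i j h => simpa [genImage] using H.e_f_diff i j h
  | serre_e i j h => simpa [genImage, map_qComm] using H.serre_e i j h
  | serre_f i j h => simpa [genImage, map_qComm] using H.serre_f i j h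
  | delta_e => simpa [genImage, map_deltaVec, map_extZero] using H.delta_e
  | delta_f => simpa [genImage, map_deltaVec, map_extZero] using H.delta_f
  | e_comm i j h => simpa [genImage] using H.e_comm i j h
  | f_comm i j h => simpa [genImage] using H.f_comm i j h

theorem satisfies_Uq (n : ℕ) (q : ℂˣ) : Satisfies n q (E (n := n) q) (F q) (K q) (KInv q) where
  k_kInv i := by simpa [K, KInv] using Uq.mk_rel (Rel.k_kInv (q := q) i)
  kInv_k i := by simpa [K, KInv] using Uq.mk_rel (Rel.kInv_k (q := q) i)
  k_comm i j := by simpa [K] using Uq.mk_rel (Rel.k_comm (q := q) i j)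
  k_e i j := by simpa [K, KInv, E] using Uq.mk_rel (Rel.k_e (q := q) i j)
  k_f i j := by simpa [K, KInv, F] using Uq.mk_rel (Rel.k_f (q := q) i j)
  e_f_same i := by simpa [K, KInv, E, F] using Uq.mk_rel (Rel.e_f_same (q := q) i)
  e_f_diff i j h := by simpa [E, F] using Uq.mk_rel (Rel.e_f_diff (q := q) i j h)
  serre_e i j h := by simpa [E, map_qComm] using Uq.mk_rel (Rel.serre_e (q := q) i j h)
  serre_f i j h := by simpa [F, map_qComm] using Uq.mk_rel (Rel.serre_f (q := q) i j h)
  delta_e := by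
    have h := Uq.mk_rel (Rel.delta_e (n := n) (q := q))
    simp only [map_sub, map_mul, map_zero, map_deltaVec, map_extZero] at h
    exact h
  delta_f := by
    have h := Uq.mk_rel (Rel.delta_f (n := n) (q := q))
    simp only [map_sub, map_mul, map_zero, map_deltaVec, map_extZero] at h
    exact h
  e_comm i j h := by simpa [E] using Uq.mk_rel (Rel.e_comm (q := q) i j h)
  f_comm i j h := by simpa [F] using Uq.mk_rel (Rel.f_comm (q := q) i j h)

end Relations

section Twist

variable {A : Type*} [Ring A] [Algebra ℂ A]

theorem op_serre_twist (q : ℂˣ) {x y k l : A} {a b u v : ℂ}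
    (hxk : x * k = a • (k * x)) (hxl : x * l = b • (l * x))
    (hyk : y * k = b • (k * y)) (hlk : l * k = k * l)
    (h : qComm ((q⁻¹ : ℂˣ) : ℂ) x (qComm (q : ℂ) x y) = 0) :
    qComm ((q⁻¹ : ℂˣ) : ℂ) (MulOpposite.op (u • (k * x)))
      (qComm (q : ℂ) (MulOpposite.op (u • (k * x))) (MulOpposite.op (v • (l * y)))) = 0 := by
  have hxk' (z : A) : x * (k * z) = a • (k * (x * z)) := by
    rw [← mul_assoc, hxk, smul_mul_assoc, mul_assoc]
  have hxl' (z : A) : x * (l * z) = b • (l * (x * z)) := by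
    rw [← mul_assoc, hxl, smul_mul_assoc, mul_assoc]
  have hyk' (z : A) : y * (k * z) = b • (k * (y * z)) := by
    rw [← mul_assoc, hyk, smul_mul_assoc, mul_assoc]
  have hlk' (z : A) : l * (k * z) = k * (l * z) := by
    rw [← mul_assoc, hlk, mul_assoc]
  have hq : (q : ℂ) * ((q⁻¹ : ℂˣ) : ℂ) = 1 := by simp
  have e1 : qComm ((q⁻¹ : ℂˣ) : ℂ) x (qComm (q : ℂ) x y) =
      x * (x * y) - (q : ℂ) • (x * (y * x)) - ((q⁻¹ : ℂˣ) : ℂ) • (x * (y * x)) + y * (x * x) := by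
    simp only [qComm, mul_sub, sub_mul, smul_sub, mul_smul_comm, smul_mul_assoc, smul_smul,
      mul_assoc]
    rw [mul_comm ((q⁻¹ : ℂˣ) : ℂ), hq]
    module
  have e2 : k * (k * (l * (x * (x * y) - (q : ℂ) • (x * (y * x)) -
      ((q⁻¹ : ℂˣ) : ℂ) • (x * (y * x)) + y * (x * x)))) = 0 := by
    rw [← e1, h]; simp
  have e3 : k * (k * (l * (x * (x * y)))) = (q : ℂ) • (k * (k * (l * (x * (y * x)))))
      + ((q⁻¹ : ℂˣ) : ℂ) • (k * (k * (l * (x * (y * x))))) - k * (k * (l * (y * (x * x)))) := by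
    simp only [mul_add, mul_sub, mul_smul_comm] at e2
    rw [← sub_eq_zero, ← e2]
    abel
  apply MulOpposite.unop_injective
  simp only [qComm, MulOpposite.unop_sub, MulOpposite.unop_mul, MulOpposite.unop_smul,
    MulOpposite.unop_op, MulOpposite.unop_zero, mul_sub, sub_mul, smul_sub, mul_smul_comm,
    smul_mul_assoc, smul_smul, mul_assoc, hxk', hxl', hyk', hlk']
  rw [e3]
  have hq2 : ((q⁻¹ : ℂˣ) : ℂ) = (q : ℂ)⁻¹ := by simp
  have hq0 : (q : ℂ) ≠ 0 := q.ne_zero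
  rw [hq2]
  match_scalars <;> field_simp <;> ring

theorem op_delta_core (q : ℂˣ) {x y k l : A} {a b u v : ℂ}
    (hxk : x * k = a • (k * x)) (hxl : x * l = b • (l * x))
    (hyk : y * k = b • (k * y)) (hlk : l * k = k * l)
    (h : x * qComm ((q⁻¹ : ℂˣ) : ℂ) x (qComm (q : ℂ) x y) -
      qComm ((q⁻¹ : ℂˣ) : ℂ) x (qComm (q : ℂ) x y) * x = 0) :
    MulOpposite.op (u • (k * x)) * qComm ((q⁻¹ : ℂˣ) : ℂ) (MulOpposite.op (u • (k * x)))
      (qComm (q : ℂ) (MulOpposite.op (u • (k * x))) (MulOpposite.op (v • (l * y)))) -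
    qComm ((q⁻¹ : ℂˣ) : ℂ) (MulOpposite.op (u • (k * x)))
      (qComm (q : ℂ) (MulOpposite.op (u • (k * x))) (MulOpposite.op (v • (l * y)))) *
      MulOpposite.op (u • (k * x)) = 0 := by
  have hxk' (z : A) : x * (k * z) = a • (k * (x * z)) := by
    rw [← mul_assoc, hxk, smul_mul_assoc, mul_assoc]
  have hxl' (z : A) : x * (l * z) = b • (l * (x * z)) := by
    rw [← mul_assoc, hxl, smul_mul_assoc, mul_assoc]
  have hyk' (z : A) : y * (k * z) = b • (k * (y * z)) := by
    rw [← mul_assoc, hyk, smul_mul_assoc, mul_assoc]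
  have hlk' (z : A) : l * (k * z) = k * (l * z) := by
    rw [← mul_assoc, hlk, mul_assoc]
  have hq2 : ((q⁻¹ : ℂˣ) : ℂ) = (q : ℂ)⁻¹ := by simp
  have hq0 : (q : ℂ) ≠ 0 := q.ne_zero
  rw [hq2] at h ⊢
  have e2 : k * (k * (k * (l * (x * qComm ((q : ℂ)⁻¹) x (qComm (q : ℂ) x y) -
      qComm ((q : ℂ)⁻¹) x (qComm (q : ℂ) x y) * x)))) = 0 := by
    rw [h]; simp
  have e3 : k * (k * (k * (l * (x * (x * (x * y)))))) =
      k * (k * (k * (l * (x * (x * (x * y)))))) -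
      k * (k * (k * (l * (x * qComm ((q : ℂ)⁻¹) x (qComm (q : ℂ) x y) -
      qComm ((q : ℂ)⁻¹) x (qComm (q : ℂ) x y) * x)))) := by
    rw [e2, sub_zero]
  have e4 : k * (k * (k * (l * (x * (x * (x * y)))))) =
      ((q : ℂ) + (q : ℂ)⁻¹ + 1) • (k * (k * (k * (l * (x * (x * (y * x)))))))
      - ((q : ℂ) + (q : ℂ)⁻¹ + 1) • (k * (k * (k * (l * (x * (y * (x * x)))))))
      + k * (k * (k * (l * (y * (x * (x * x)))))) := by
    refine e3.trans ?_
    simp only [qComm, mul_sub, sub_mul, smul_sub, mul_smul_comm, smul_mul_assoc, smul_smul,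
      mul_assoc]
    match_scalars <;> field_simp <;> ring
  apply MulOpposite.unop_injective
  simp only [qComm, MulOpposite.unop_sub, MulOpposite.unop_mul, MulOpposite.unop_smul,
    MulOpposite.unop_op, MulOpposite.unop_zero, mul_sub, sub_mul, smul_sub, mul_smul_comm,
    smul_mul_assoc, smul_smul, mul_assoc, hxk', hxl', hyk', hlk']
  rw [e4]
  match_scalars <;> field_simp <;> ring

theorem op_delta_twist (q : ℂˣ) {n : ℕ} {g G : Fin n → A} {k : Fin n → A} {u : Fin n → ℂ}
    {a : Fin n → Fin n → ℂ} (ha : ∀ i j, a i j = a j i)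
    (hgk : ∀ i j, g i * k j = a i j • (k j * g i)) (hk : ∀ i j, k i * k j = k j * k i)
    (hG : ∀ i, G i = u i • (k i * g i))
    (h : extZero g 0 * deltaVec q g - deltaVec q g * extZero g 0 = 0) :
    extZero (fun i => MulOpposite.op (G i)) 0 * deltaVec q (fun i => MulOpposite.op (G i)) -
      deltaVec q (fun i => MulOpposite.op (G i)) * extZero (fun i => MulOpposite.op (G i)) 0
      = 0 := by
  by_cases hn : 1 < n
  swap
  · simp [deltaVec, extZero, hn, qComm]
  have hn0 : 0 < n := by omega
  simp only [deltaVec, extZero, hn, hn0, dif_pos, hG] at h ⊢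
  have hxk := hgk ⟨0, hn0⟩ ⟨0, hn0⟩
  have hxl := hgk ⟨0, hn0⟩ ⟨1, hn⟩
  have hyk := hgk ⟨1, hn⟩ ⟨0, hn0⟩
  rw [ha] at hyk
  have hlk := hk ⟨1, hn⟩ ⟨0, hn0⟩
  exact op_delta_core q hxk hxl hyk hlk h

end Twist

section Involutions

variable (n : ℕ) (q : ℂˣ)

theorem pairing_comm {n : ℕ} (i j : Fin n) : pairing i j = pairing j i := by
  simp [pairing, mul_comm]

section Commute

variable {n : ℕ} {q : ℂˣ}

theorem E_mul_KInv (i j : Fin n) :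
    E q i * KInv q j = ((q ^ pairing i j : ℂˣ) : ℂ) • (KInv q j * E q i) := by
  have H := satisfies_Uq n q
  have h := congrArg (fun z => KInv q j * z) (H.k_e j i)
  simp only [mul_smul_comm] at h
  rw [pairing_comm, ← h, ← mul_assoc, ← mul_assoc, H.kInv_k, one_mul]

theorem F_mul_K (i j : Fin n) :
    F q i * K q j = ((q ^ pairing i j : ℂˣ) : ℂ) • (K q j * F q i) := by
  have H := satisfies_Uq n q
  have h := congrArg (fun z => z * K q j) (H.k_f j i)
  simp only [smul_mul_assoc, mul_assoc, H.kInv_k, mul_one] at h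
  rw [h, smul_smul, ← Units.val_mul, ← zpow_add, pairing_comm, add_neg_cancel, zpow_zero,
    Units.val_one, one_smul]

theorem KInv_comm (i j : Fin n) : KInv q i * KInv q j = KInv q j * KInv q i := by
  have H := satisfies_Uq n q
  have h : KInv q j * KInv q i * (K q i * K q j) = 1 := by
    rw [mul_assoc, ← mul_assoc (KInv q i), H.kInv_k, one_mul, H.kInv_k]
  have h2 : K q i * K q j * (KInv q i * KInv q j) = 1 := by
    rw [H.k_comm, mul_assoc, ← mul_assoc (K q i), H.k_kInv, one_mul, H.k_kInv]
  exact (left_inv_eq_right_inv h h2).symm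

theorem K_comm_KInv (i j : Fin n) : K q i * KInv q j = KInv q j * K q i := by
  have H := satisfies_Uq n q
  have h := congrArg (fun z => KInv q j * z * KInv q j) (H.k_comm j i)
  simp only [← mul_assoc, H.kInv_k, one_mul] at h
  rw [h, mul_assoc, H.k_kInv, mul_one]

theorem antipode_exchange (i j : Fin n) :
    F q j * K q j * (KInv q i * E q i) = KInv q i * (F q j * E q i) * K q j := by
  have H := satisfies_Uq n q
  have h1 : K q j * E q i = ((q ^ pairing j i : ℂˣ) : ℂ) • (E q i * K q j) := by
    rw [← smul_mul_assoc, ← H.k_e, mul_assoc, H.kInv_k, mul_one]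
  have h2 : ((q ^ pairing j i : ℂˣ) : ℂ) • (F q j * KInv q i) = KInv q i * F q j := by
    have h := congrArg (fun z => KInv q i * z * KInv q i) (F_mul_K (q := q) j i)
    simp only [mul_smul_comm, smul_mul_assoc, ← mul_assoc, H.kInv_k, one_mul] at h
    rw [← h, mul_assoc, H.k_kInv, mul_one]
  calc F q j * K q j * (KInv q i * E q i)
      = F q j * KInv q i * (K q j * E q i) := by
        rw [mul_assoc, ← mul_assoc (K q j), K_comm_KInv]; simp only [mul_assoc]
    _ = (((q ^ pairing j i : ℂˣ) : ℂ) • (F q j * KInv q i)) * (E q i * K q j) := by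
        rw [h1, mul_smul_comm, smul_mul_assoc]
    _ = KInv q i * (F q j * E q i) * K q j := by rw [h2]; simp only [mul_assoc]

theorem antipode_bracket (i j : Fin n) :
    -(F q j * K q j) * -(KInv q i * E q i) - -(KInv q i * E q i) * -(F q j * K q j) =
      -(KInv q i * (E q i * F q j - F q j * E q i) * K q j) := by
  rw [neg_mul_neg, neg_mul_neg, antipode_exchange]
  noncomm_ring

end Commute

/-- The images of the generators under the Chevalley involution satisfy the relations in the
opposite algebra. -/
theorem chevalley_satisfies : Satisfies n q
    (fun i => MulOpposite.op (F (n := n) q i)) (fun i => MulOpposite.op (E q i))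
    (fun i => MulOpposite.op (K q i)) (fun i => MulOpposite.op (KInv q i)) := by
  have H := satisfies_Uq n q
  have hs {x y : Uq n q} (h : qComm ((q⁻¹ : ℂˣ) : ℂ) x (qComm (q : ℂ) x y) = 0) :=
    op_serre_twist (x := x) (y := y) (k := 1) (l := 1) (a := 1) (b := 1) (u := 1) (v := 1) q
      (by simp) (by simp) (by simp) (by simp) h
  have hd {g : Fin n → Uq n q} (h : extZero g 0 * deltaVec q g - deltaVec q g * extZero g 0 = 0) :=
    op_delta_twist (g := g) (G := g) (k := fun _ => 1) (a := fun _ _ => 1) (u := fun _ => 1) q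
      (by simp) (by simp) (by simp) (by simp) h
  refine ⟨fun i => ?_, fun i => ?_, fun i j => ?_, fun i j => ?_, fun i j => ?_, fun i => ?_,
    fun i j h => ?_, fun i j h => ?_, fun i j h => ?_, hd H.delta_f, hd H.delta_e,
    fun i j h => ?_, fun i j h => ?_⟩
  · rw [← MulOpposite.op_mul, H.kInv_k]; rfl
  · rw [← MulOpposite.op_mul, H.k_kInv]; rfl
  · rw [← MulOpposite.op_mul, ← MulOpposite.op_mul, H.k_comm]
  · rw [← MulOpposite.op_mul, ← MulOpposite.op_mul, ← MulOpposite.op_smul, F_mul_K,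
      pairing_comm, mul_smul_comm, ← mul_assoc, H.kInv_k, one_mul]
  · rw [← MulOpposite.op_mul, ← MulOpposite.op_mul, ← MulOpposite.op_smul, ← mul_assoc]
    have h := E_mul_KInv (q := q) j i
    have h2 : KInv q i * E q j = ((q ^ (-pairing i j) : ℂˣ) : ℂ) • (E q j * KInv q i) := by
      rw [h, smul_smul, ← Units.val_mul, ← zpow_add, pairing_comm j i, neg_add_cancel, zpow_zero,
        Units.val_one, one_smul]
    rw [h2, smul_mul_assoc, mul_assoc, H.kInv_k, mul_one]
  · rw [← MulOpposite.op_mul, ← MulOpposite.op_mul, ← MulOpposite.op_sub, H.e_f_same]; rfl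
  · rw [← MulOpposite.op_mul, ← MulOpposite.op_mul, ← MulOpposite.op_sub,
      H.e_f_diff _ _ h.symm]; rfl
  · simpa using hs (H.serre_f i j h)
  · simpa using hs (H.serre_e i j h)
  · rw [← MulOpposite.op_mul, ← MulOpposite.op_mul, H.f_comm i j h]
  · rw [← MulOpposite.op_mul, ← MulOpposite.op_mul, H.e_comm i j h]

/-- The Chevalley anti-automorphism `ω`, as a homomorphism to the opposite algebra:
`e_α ↦ f_α`, `f_α ↦ e_α`, `q^{h_α} ↦ q^{h_α}`. -/
def chevalley : Uq n q →ₐ[ℂ] (Uq n q)ᵐᵒᵖ :=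
  Uq.lift (genImage (fun i => MulOpposite.op (F q i)) (fun i => MulOpposite.op (E q i))
    (fun i => MulOpposite.op (K q i)) (fun i => MulOpposite.op (KInv q i)))
    (chevalley_satisfies n q).lift_eq

/-- The images of the generators under the inverse antipode satisfy the relations in the
opposite algebra. -/
theorem antipodeInv_satisfies : Satisfies n q
    (fun i => MulOpposite.op (-(KInv q i * E (n := n) q i)))
    (fun i => MulOpposite.op (-(F q i * K q i)))
    (fun i => MulOpposite.op (KInv q i)) (fun i => MulOpposite.op (K q i)) := by
  have H := satisfies_Uq n q
  have hE (i : Fin n) : -(KInv q i * E q i) = (-1 : ℂ) • (KInv q i * E q i) := by simp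
  have hF (i : Fin n) : -(F q i * K q i) =
      (-((q ^ pairing i i : ℂˣ) : ℂ)) • (K q i * F q i) := by rw [F_mul_K, neg_smul]
  refine ⟨fun i => ?_, fun i => ?_, fun i j => ?_, fun i j => ?_, fun i j => ?_, fun i => ?_,
    fun i j h => ?_, fun i j h => ?_, fun i j h => ?_, ?_, ?_, fun i j h => ?_, fun i j h => ?_⟩
  · rw [← MulOpposite.op_mul, H.k_kInv]; rfl
  · rw [← MulOpposite.op_mul, H.kInv_k]; rfl
  · rw [← MulOpposite.op_mul, ← MulOpposite.op_mul, KInv_comm]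
  · rw [← MulOpposite.op_mul, ← MulOpposite.op_mul, ← MulOpposite.op_smul]
    congr 1
    rw [neg_mul, mul_neg, mul_assoc, E_mul_KInv, mul_smul_comm, mul_smul_comm, ← mul_assoc,
      ← mul_assoc, K_comm_KInv, mul_assoc (KInv q j), H.k_kInv, mul_one, smul_neg, pairing_comm]
  · rw [← MulOpposite.op_mul, ← MulOpposite.op_mul, ← MulOpposite.op_smul]
    congr 1
    rw [neg_mul, mul_neg, mul_assoc, K_comm_KInv, ← mul_assoc, ← mul_assoc, H.k_f, smul_mul_assoc,
      smul_neg]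
  · rw [← MulOpposite.op_mul, ← MulOpposite.op_mul, ← MulOpposite.op_sub, ← MulOpposite.op_sub,
      ← MulOpposite.op_smul]
    congr 1
    rw [antipode_bracket, H.e_f_same, mul_smul_comm, smul_mul_assoc, mul_sub, sub_mul, H.kInv_k,
      one_mul, mul_assoc, H.kInv_k, mul_one, ← smul_neg, neg_sub]
  · rw [← MulOpposite.op_mul, ← MulOpposite.op_mul, ← MulOpposite.op_sub, antipode_bracket,
      H.e_f_diff i j h]
    simp
  · rw [hE, hE]
    exact op_serre_twist q (E_mul_KInv i i) (E_mul_KInv i j)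
      (by rw [E_mul_KInv, pairing_comm]) (KInv_comm _ _) (H.serre_e i j h)
  · rw [hF, hF]
    exact op_serre_twist q (F_mul_K i i) (F_mul_K i j)
      (by rw [F_mul_K, pairing_comm]) (H.k_comm _ _) (H.serre_f i j h)
  · exact op_delta_twist (k := fun i => KInv q i) q (fun i j => by rw [pairing_comm])
      E_mul_KInv KInv_comm hE H.delta_e
  · exact op_delta_twist (k := fun i => K q i) q (fun i j => by rw [pairing_comm])
      F_mul_K H.k_comm hF H.delta_f
  · rw [← MulOpposite.op_mul, ← MulOpposite.op_mul]
    congr 1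
    have h1 := E_mul_KInv (q := q) i j
    have h2 := E_mul_KInv (q := q) j i
    rw [pairing_comm] at h2
    rw [h, zpow_zero, Units.val_one, one_smul] at h1 h2
    rw [neg_mul_neg, neg_mul_neg, Commute.mul_mul_mul_comm h2, Commute.mul_mul_mul_comm h1,
      KInv_comm, H.e_comm i j h]
  · rw [← MulOpposite.op_mul, ← MulOpposite.op_mul]
    congr 1
    have h1 := F_mul_K (q := q) i j
    have h2 := F_mul_K (q := q) j i
    rw [pairing_comm] at h2
    rw [h, zpow_zero, Units.val_one, one_smul] at h1 h2
    rw [neg_mul_neg, neg_mul_neg, Commute.mul_mul_mul_comm h1.symm,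
      Commute.mul_mul_mul_comm h2.symm, H.k_comm, H.f_comm i j h]

/-- The inverse antipode `γ⁻¹`, as a homomorphism to the opposite algebra:
`e_α ↦ -q^{-h_α} e_α`, `f_α ↦ -f_α q^{h_α}`, `q^{h_α} ↦ q^{-h_α}`.  It belongs to the coproduct
`Δ(e_α) = e_α ⊗ q^{h_α} + 1 ⊗ e_α`, `Δ(f_α) = f_α ⊗ 1 + q^{-h_α} ⊗ f_α`,
`Δ(q^{h_α}) = q^{h_α} ⊗ q^{h_α}`. -/
def antipodeInv : Uq n q →ₐ[ℂ] (Uq n q)ᵐᵒᵖ :=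
  Uq.lift (genImage (fun i => MulOpposite.op (-(KInv q i * E q i)))
    (fun i => MulOpposite.op (-(F q i * K q i)))
    (fun i => MulOpposite.op (KInv q i)) (fun i => MulOpposite.op (K q i)))
    (antipodeInv_satisfies n q).lift_eq

end Involutions

/-! ### The modules `M_λ` and `N_λ`

The weight `λ` is given by `q^{(λ, ε_i)} = s` for all `i`, where `s ^ 2 = -q⁻¹`, hence
`q^{(λ, α_1)} = s` and `q^{(λ, α_i)} = 1` for `i > 1`. -/

section Modules

variable (n : ℕ) (q s : ℂˣ)

/-- `q^{(λ, α_i)}` -/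
def weightVal {n : ℕ} (s : ℂˣ) (i : Fin n) : ℂˣ := if (i : ℕ) = 0 then s else 1

/-- Generators of the annihilator of the one-dimensional representation `ℂ_λ` of `U_q(p_+)`,
the subalgebra generated by `U_q(h)`, all `e_α` and the `f_{α_i}` with `i > 1`. -/
def parabolicPlus : Set (Uq n q) :=
  {x | (∃ i, x = K q i - algebraMap ℂ _ (weightVal s i : ℂ)) ∨ (∃ i, x = E q i) ∨
    ∃ i : Fin n, 0 < (i : ℕ) ∧ x = F q i}

/-- Generators of the annihilator of the one-dimensional representation `ℂ_{-λ}` of `U_q(p_-)`,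
the subalgebra generated by `U_q(h)`, all `f_α` and the `e_{α_i}` with `i > 1`. -/
def parabolicMinus : Set (Uq n q) :=
  {x | (∃ i, x = K q i - algebraMap ℂ _ (((weightVal s i)⁻¹ : ℂˣ) : ℂ)) ∨ (∃ i, x = F q i) ∨
    ∃ i : Fin n, 0 < (i : ℕ) ∧ x = E q i}

/-- The parabolic Verma module `U_q(g) ⊗_{U_q(p_+)} ℂ_λ`, i.e. the quotient of `U_q(g)` by the left
ideal generated by the annihilator of `ℂ_λ` in `U_q(p_+)`. -/
abbrev MHat : Type := Uq n q ⧸ Submodule.span (Uq n q) (parabolicPlus n q s)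

/-- The module `U_q(g) ⊗_{U_q(p_-)} ℂ_{-λ}`. -/
abbrev NHat : Type := Uq n q ⧸ Submodule.span (Uq n q) (parabolicMinus n q s)

/-- The highest weight generator of `MHat`. -/
def mHatGen : MHat n q s := Submodule.Quotient.mk 1

/-- The lowest weight generator of `NHat`. -/
def nHatGen : NHat n q s := Submodule.Quotient.mk 1

/-- `M_λ`, the quotient of `MHat` by the submodule generated by `f_δ 1_λ`. -/
abbrev M : Type :=
  MHat n q s ⧸ Submodule.span (Uq n q) {deltaVec q (F (n := n) q) • mHatGen n q s}

/-- `N_λ`, the quotient of `NHat` by the submodule generated by `e_δ 1*_λ`. -/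
abbrev N : Type :=
  NHat n q s ⧸ Submodule.span (Uq n q) {deltaVec q (E (n := n) q) • nHatGen n q s}

/-- The generator `1_λ` of `M_λ`. -/
def mGen : M n q s := Submodule.Quotient.mk (mHatGen n q s)

/-- The generator `1*_λ` of `N_λ`. -/
def nGen : N n q s := Submodule.Quotient.mk (nHatGen n q s)

/-- The vectors `f_{ε_1}^{m_1} ⋯ f_{ε_n}^{m_n} 1_λ`. -/
def basisVec (m : Fin n → ℕ) : M n q s :=
  monomial (rootVecF q (F (n := n) q)) m • mGen n q s

end Modules

/-! ### Vacuum expectation, invariance, and the tensor `𝓕` -/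

section Forms

variable {n : ℕ} {q : ℂˣ}

/-- `U_q(h)` -/
def cartan (n : ℕ) (q : ℂˣ) : Subalgebra ℂ (Uq n q) :=
  Algebra.adjoin ℂ (Set.range (K q) ∪ Set.range (KInv q))

/-- `U_q(g_+)` -/
def nPlus (n : ℕ) (q : ℂˣ) : Subalgebra ℂ (Uq n q) := Algebra.adjoin ℂ (Set.range (E q))

/-- `U_q(g_-)` -/
def nMinus (n : ℕ) (q : ℂˣ) : Subalgebra ℂ (Uq n q) := Algebra.adjoin ℂ (Set.range (F q))

/-- `φ` is the functional `x ↦ ⟨x⟩`: the projection of `U_q(g)` to `U_q(h)` modulo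
`g_- U_q(g) + U_q(g) g_+`, followed by evaluation at `λ`, which is the algebra character
of `U_q(h)` sending `q^{h_α}` to `q^{(λ, α)}`. -/
structure IsVacuumExpectation (s : ℂˣ) (φ : Uq n q →ₗ[ℂ] ℂ) : Prop where
  f_mul : ∀ i x, φ (F q i * x) = 0
  mul_e : ∀ i x, φ (x * E q i) = 0
  one : φ 1 = 1
  mul : ∀ x ∈ cartan n q, ∀ y ∈ cartan n q, φ (x * y) = φ x * φ y
  k : ∀ i, φ (K q i) = weightVal s i

/-- Invariance of a bilinear form with respect to the coproduct
`Δ(e_α) = e_α ⊗ q^{h_α} + 1 ⊗ e_α`, `Δ(f_α) = f_α ⊗ 1 + q^{-h_α} ⊗ f_α`,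
`Δ(q^{h_α}) = q^{h_α} ⊗ q^{h_α}`. -/
structure IsInvariantForm (n : ℕ) (q : ℂˣ) {V W : Type*} [AddCommGroup V] [Module ℂ V] [Module (Uq n q) V]
    [AddCommGroup W] [Module ℂ W] [Module (Uq n q) W] (B : V →ₗ[ℂ] W →ₗ[ℂ] ℂ) : Prop where
  e : ∀ (i : Fin n) v w, B (E q i • v) (K q i • w) + B v (E q i • w) = 0
  f : ∀ (i : Fin n) v w, B (F q i • v) w + B (KInv q i • v) (F q i • w) = 0
  k : ∀ (i : Fin n) v w, B (K q i • v) (K q i • w) = B v w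

/-- `e_{α_i}` as an element of `U_q(g_+)` -/
def ePlus (q : ℂˣ) (i : Fin n) : nPlus n q := ⟨E q i, Algebra.subset_adjoin ⟨i, rfl⟩⟩

/-- `f_{α_i}` as an element of `U_q(g_-)` -/
def fMinus (q : ℂˣ) (i : Fin n) : nMinus n q := ⟨F q i, Algebra.subset_adjoin ⟨i, rfl⟩⟩

/-- The coefficient of `𝓕` at the multi-index `m`, where `p = q^{1/2}`, `θ = p - p⁻¹`:
`(-θ)^{∑ m_i} ∏ q^{-m_i^2/2 + 2 m_i (i-1)} / ∏ [m_i]_q!`. -/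
def coeffF (p q : ℂˣ) (m : Fin n → ℕ) : ℂ :=
  (-((p : ℂ) - ((p⁻¹ : ℂˣ) : ℂ))) ^ (∑ i, m i) *
    ((∏ i : Fin n, ((p ^ (-(m i : ℤ) ^ 2) * q ^ (2 * (m i : ℤ) * (i : ℕ)) : ℂˣ) : ℂ)) /
      ∏ i : Fin n, qFactorial q (m i))

/-- The tensor `𝓕`, an infinite formal sum, given by its terms in `U_q(g_+) ⊗ U_q(g_-)`. -/
def tensorF (n : ℕ) (p q : ℂˣ) (m : Fin n → ℕ) : nPlus n q ⊗[ℂ] nMinus n q :=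
  coeffF p q m • (monomial (rootVecE q (ePlus (n := n) q)) m ⊗ₜ[ℂ]
    monomial (rootVecF q (fMinus (n := n) q)) m)

/-- `U_q(g_+) ⊗ U_q(g_-) → N_λ ⊗ M_λ`, `x ⊗ y ↦ x 1*_λ ⊗ y 1_λ`. -/
def act (n : ℕ) (q s : ℂˣ) : nPlus n q ⊗[ℂ] nMinus n q →ₗ[ℂ] N n q s ⊗[ℂ] M n q s :=
  TensorProduct.map
    (((LinearMap.toSpanSingleton (Uq n q) (N n q s) (nGen n q s)).restrictScalars ℂ).comp
      (nPlus n q).val.toLinearMap)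
    (((LinearMap.toSpanSingleton (Uq n q) (M n q s) (mGen n q s)).restrictScalars ℂ).comp
      (nMinus n q).val.toLinearMap)

/-- Contraction `w ⊗ v ↦ B(v₀, w) v` of a tensor in `W ⊗ V` with a vector `v₀` of `V`. -/
def contractV {V W : Type*} [AddCommGroup V] [Module ℂ V] [AddCommGroup W] [Module ℂ W]
    (B : V →ₗ[ℂ] W →ₗ[ℂ] ℂ) (v₀ : V) : W ⊗[ℂ] V →ₗ[ℂ] V :=
  (TensorProduct.lid ℂ V).toLinearMap.comp (TensorProduct.map (B v₀) LinearMap.id)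

/-- Contraction `w ⊗ v ↦ B(v, w₀) w` of a tensor in `W ⊗ V` with a vector `w₀` of `W`. -/
def contractW {V W : Type*} [AddCommGroup V] [Module ℂ V] [AddCommGroup W] [Module ℂ W]
    (B : V →ₗ[ℂ] W →ₗ[ℂ] ℂ) (w₀ : W) : W ⊗[ℂ] V →ₗ[ℂ] W :=
  (TensorProduct.rid ℂ W).toLinearMap.comp (TensorProduct.map LinearMap.id (B.flip w₀))

/-- A formal sum `∑_a T_a` of tensors in `W ⊗ V` is inverse to the pairing `B : V ⊗ W → ℂ`: both
compositions `V → V ⊗ W ⊗ V → V` and `W → W ⊗ V ⊗ W → W` are defined by finite sums, and are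
the identity maps. -/
def IsInverseForm {V W ι : Type*} [AddCommGroup V] [Module ℂ V] [AddCommGroup W] [Module ℂ W]
    (B : V →ₗ[ℂ] W →ₗ[ℂ] ℂ) (T : ι → W ⊗[ℂ] V) : Prop :=
  (∀ v, {a | contractV B v (T a) ≠ 0}.Finite ∧ ∑ᶠ a, contractV B v (T a) = v) ∧
  (∀ w, {a | contractW B w (T a) ≠ 0}.Finite ∧ ∑ᶠ a, contractW B w (T a) = w)

end Forms

end

end QSphere

open QSphere

namespace QSphere

noncomputable section

/-! ### The nilpotent part -/

section Nilpotent

variable {A : Type*} [Ring A] [Algebra ℂ A]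

/-! Everything is compared with an explicit Fock representation on Laurent monomials `x^m`. There
`f_{α_1}` multiplies by `x_1`, `f_{α_{i+1}}` sends `x^m` to `[m_i] x^{m + ε_{i+1} - ε_i}`, `e_{α_i}`
sends `x^m` to a multiple of `[m_i] x^{m - α_i}`, and the Cartan part acts diagonally. The quadratic
Serre relations are the three-term recurrence for `[m]_q`. The commutator of `e_{α_1}` and `f_{α_1}`
comes out right exactly because `s² = -q⁻¹`, with the constant `κ = s q^{1/2} / (q^{1/2} -
q^{-1/2})` in `e_{α_1}` (`fockConst_spec`). In this representation `f_δ` and `e_δ` act by zero, so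
there is an equivariant map from `M_λ` sending `1_λ` to `x^0`, and after interchanging the roles of
`e` and `f` one from `N_λ`.

The images of the ordered monomials in the `f_{ε_i}` are non-zero multiples of distinct `x^m`, so
the monomials are independent. The upper bound is the hard half (`Satisfies.span_monomial`): they
span as soon as the `f_{ε_i}` commute up to `q` on the module. The defects `f_{ε_i} f_{ε_j} - q
f_{ε_j} f_{ε_i}` are all obtained from `f_δ` by `q⁻¹`-brackets with simple generators. They kill
`1_λ`, and the set of vectors killed by all of them is stable under every `f_α`. Stability under
`f_{α_1}` is the delicate case (`NilpotentRel.rootDefect_one_two_smul`) and needs `q⁴ + q² + 1 ≠ 0`.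

Hence both modules have bases `u`, `u'` corresponding to the `x^m` with `m ∈ ℕ^n`, and all claims
become statements about coefficients. A vector killed by all `e_α` is a multiple of `x^0` because
`[m]_q ≠ 0` for `m ≠ 0`, which gives irreducibility. The functional `⟨x⟩` is the coefficient of
`x^0` in `x · x^0`. The Shapovalov form and the invariant pairing are diagonal in these bases, and
their coefficients are forced by comparing `m` with `m + α_i`. Finally the monomials in `ẽ_{ε_i}`
and `f_{ε_i}` are explicit multiples of `u'` and `u`, and the coefficients of `𝓕` are the
reciprocals that turn it into the inverse of the diagonal pairing (`coeffF_mul_pairingCoeff`). -/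

/-- Composite root vectors `[… [g_0, g_1]_{a⁻¹}, … g_k]_{a⁻¹}` of a sequence. -/
def seqRoot (a : ℂ) (g : ℕ → A) : ℕ → A
  | 0 => g 0
  | k + 1 => qComm a⁻¹ (seqRoot a g k) (g (k + 1))

/-- The relations of the nilpotent part, for a sequence of generators. -/
structure NilpotentRel (a : ℂ) (g : ℕ → A) : Prop where
  comm : ∀ i j, i + 2 ≤ j → g i * g j = g j * g i
  serre_down : ∀ i, qComm a⁻¹ (g (i + 1)) (qComm a (g (i + 1)) (g i)) = 0
  serre_up : ∀ i, qComm a⁻¹ (g (i + 1)) (qComm a (g (i + 1)) (g (i + 2))) = 0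
  delta : g 0 * qComm a⁻¹ (g 0) (qComm a (g 0) (g 1)) =
    qComm a⁻¹ (g 0) (qComm a (g 0) (g 1)) * g 0

theorem qComm_mul_right_comm (a : ℂ) {x y z : A} (hx : x * z = z * x) (hy : y * z = z * y) :
    qComm a x y * z = z * qComm a x y := by
  simp only [qComm, sub_mul, mul_sub, smul_mul_assoc, mul_smul_comm, mul_assoc, hy]
  rw [hx, ← mul_assoc, hx, mul_assoc, ← mul_assoc y, hy, mul_assoc]

theorem serre_expand {a : ℂ} (ha : a ≠ 0) (y x : A) :
    qComm a⁻¹ y (qComm a y x) = y * (y * x) - (a + a⁻¹) • (y * (x * y)) + x * (y * y) := by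
  simp only [qComm, sub_mul, mul_sub, smul_mul_assoc, mul_smul_comm, mul_assoc]
  match_scalars <;> field_simp <;> ring

theorem qComm_mul_self {a : ℂ} (ha : a ≠ 0) {x y : A} (h : qComm a⁻¹ y (qComm a y x) = 0) :
    qComm a⁻¹ x y * y = a • (y * qComm a⁻¹ x y) := by
  rw [serre_expand ha] at h
  rw [← sub_eq_zero, ← h]
  simp only [qComm, sub_mul, mul_sub, smul_mul_assoc, mul_smul_comm, mul_assoc]
  match_scalars <;> field_simp <;> ring

/-- The two Serre relations, each multiplied on either side by the remaining variable, combine to `a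
+ a⁻¹` times the commutator to be killed. This is where `a² + 1 ≠ 0` enters. -/
theorem qComm_qComm_mul_middle {a : ℂ} (ha : a ≠ 0) (ha2 : a ^ 2 + 1 ≠ 0) {x y z : A}
    (hxz : x * z = z * x) (h1 : qComm a⁻¹ y (qComm a y x) = 0)
    (h2 : qComm a⁻¹ y (qComm a y z) = 0) :
    qComm a⁻¹ (qComm a⁻¹ x y) z * y = y * qComm a⁻¹ (qComm a⁻¹ x y) z := by
  rw [serre_expand ha] at h1 h2
  have hxz' (w : A) : x * (z * w) = z * (x * w) := by rw [← mul_assoc, hxz, mul_assoc]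
  have e1 := congrArg (fun w => x * w) h2
  have e2 := congrArg (fun w => z * w) h1
  have e3 := congrArg (fun w => w * z) h1
  have e4 := congrArg (fun w => w * x) h2
  simp only [mul_add, add_mul, sub_mul, mul_sub, smul_mul_assoc, mul_smul_comm, mul_assoc,
    mul_zero, zero_mul, hxz, hxz'] at e1 e2 e3 e4
  simp only [qComm, sub_mul, mul_sub, smul_mul_assoc, mul_smul_comm, mul_assoc, smul_sub,
    hxz]
  -- The factor `a / (a² + 1)` is the inverse of `a + a⁻¹`.
  linear_combination (norm := skip) (a / (a ^ 2 + 1)) • (- e1 - (a⁻¹ ^ 2) • e2 + e3 +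
    (a⁻¹ ^ 2) • e4)
  match_scalars <;> field_simp <;> ring

namespace NilpotentRel

variable {a : ℂ} {g : ℕ → A}

theorem root_comm_of_lt (H : NilpotentRel a g) {i k : ℕ} (h : i + 2 ≤ k) :
    seqRoot a g i * g k = g k * seqRoot a g i := by
  induction i with
  | zero => exact H.comm 0 k h
  | succ i ih =>
    exact qComm_mul_right_comm _ (ih (by omega)) (H.comm (i + 1) k (by omega))

/-- The composite vector is the `a⁻¹`-bracket of a shorter one with `g k`, and the shorter one
commutes with `g (k + 1)`. The Serre expression is therefore the `a⁻¹`-bracket of the shorter vector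
with a Serre relation between neighbours. -/
theorem serre_root (H : NilpotentRel a g) (ha : a ≠ 0) (k : ℕ) :
    qComm a⁻¹ (g (k + 1)) (qComm a (g (k + 1)) (seqRoot a g k)) = 0 := by
  cases k with
  | zero => exact H.serre_down 0
  | succ k =>
    have hc := H.root_comm_of_lt (i := k) (k := k + 2) le_rfl
    have hs := H.serre_down (k + 1)
    rw [serre_expand ha] at hs ⊢
    have hc' (w : A) : seqRoot a g k * (g (k + 2) * w) = g (k + 2) * (seqRoot a g k * w) := by
      rw [← mul_assoc, hc, mul_assoc]
    have e1 := congrArg (fun w => seqRoot a g k * w) hs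
    have e2 := congrArg (fun w => w * seqRoot a g k) hs
    simp only [seqRoot, qComm, mul_add, add_mul, sub_mul, mul_sub, smul_mul_assoc, mul_smul_comm,
      mul_assoc, mul_zero, zero_mul, hc, hc', add_assoc, Nat.reduceAdd] at e1 e2 ⊢
    linear_combination (norm := skip) e1 - a⁻¹ • e2
    match_scalars <;> ring

theorem root_mul_self (H : NilpotentRel a g) (ha : a ≠ 0) (k : ℕ) :
    seqRoot a g (k + 1) * g (k + 1) = a • (g (k + 1) * seqRoot a g (k + 1)) :=
  qComm_mul_self ha (H.serre_root ha k)

/-- The case `i = k + 2` is the middle-variable lemma applied to `[[x_k, g_{k+1}], g_{k+2}]`; each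
further bracket is with a generator that commutes with `g (k + 1)`. -/
theorem root_comm_of_gt (H : NilpotentRel a g) (ha : a ≠ 0) (ha2 : a ^ 2 + 1 ≠ 0) {i k : ℕ}
    (h : k + 1 < i) : seqRoot a g i * g (k + 1) = g (k + 1) * seqRoot a g i := by
  obtain ⟨j, rfl⟩ := Nat.exists_eq_add_of_lt h
  induction j with
  | zero =>
    exact qComm_qComm_mul_middle ha ha2 (H.root_comm_of_lt (by omega)) (H.serre_root ha k)
      (H.serre_up k)
  | succ j ih =>
    exact qComm_mul_right_comm _ (ih (by omega)) (H.comm (k + 1) _ (by omega)).symm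

theorem root_comm (H : NilpotentRel a g) (ha : a ≠ 0) (ha2 : a ^ 2 + 1 ≠ 0) {i k : ℕ}
    (h0 : 0 < k) (h1 : i ≠ k) (h2 : i + 1 ≠ k) :
    seqRoot a g i * g k = g k * seqRoot a g i := by
  rcases lt_or_gt_of_ne h1 with h | h
  · exact H.root_comm_of_lt (by omega)
  · obtain ⟨k, rfl⟩ := Nat.exists_eq_succ_of_ne_zero h0.ne'
    exact H.root_comm_of_gt ha ha2 h

end NilpotentRel

/-- The defect `x_i x_j - a x_j x_i` of the `a`-commutation of the composite root vectors. -/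
def rootDefect (a : ℂ) (g : ℕ → A) (i j : ℕ) : A := qComm a (seqRoot a g i) (seqRoot a g j)

/-- When `x` and `z` commute, bracketing by `x` on the left and by `z` on the right are independent
operations. With its mirror image below, it moves a defect from one pair of indices to the next. -/
theorem qComm_jacobi_right {a b : ℂ} {x y z : A} (h : x * z = z * x) :
    qComm a x (qComm b y z) = qComm b (qComm a x y) z := by
  have h' (w : A) : x * (z * w) = z * (x * w) := by rw [← mul_assoc, h, mul_assoc]
  simp only [qComm, sub_mul, mul_sub, smul_mul_assoc, mul_smul_comm, mul_assoc, h, h', smul_sub]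
  match_scalars <;> ring

theorem qComm_jacobi_left {a b : ℂ} {x y z : A} (h : y * z = z * y) :
    qComm a (qComm b x z) y = qComm b (qComm a x y) z := by
  have h' (w : A) : y * (z * w) = z * (y * w) := by rw [← mul_assoc, h, mul_assoc]
  simp only [qComm, sub_mul, mul_sub, smul_mul_assoc, mul_smul_comm, mul_assoc, h, h', smul_sub]
  match_scalars <;> ring

namespace NilpotentRel

variable {a : ℂ} {g : ℕ → A}

theorem rootDefect_succ_right (H : NilpotentRel a g) {i j : ℕ} (h : i < j) :
    rootDefect a g i (j + 1) = qComm a⁻¹ (rootDefect a g i j) (g (j + 1)) :=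
  qComm_jacobi_right (H.root_comm_of_lt (by omega))

theorem rootDefect_succ_left (H : NilpotentRel a g) (ha : a ≠ 0) (ha2 : a ^ 2 + 1 ≠ 0) {i j : ℕ}
    (h : i + 1 < j) :
    rootDefect a g (i + 1) j = qComm a⁻¹ (rootDefect a g i j) (g (i + 1)) :=
  qComm_jacobi_left (H.root_comm_of_gt ha ha2 h)

/-- The first defect is the vector of weight `δ`. All other defects arise from it by
`rootDefect_succ_right` and `rootDefect_succ_left`, so killing this one on a generator is enough to
start. -/
theorem rootDefect_zero_one (ha : a ≠ 0) :
    rootDefect a g 0 1 = qComm a⁻¹ (g 0) (qComm a (g 0) (g 1)) := by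
  simp only [rootDefect, seqRoot, qComm, sub_mul, mul_sub, smul_mul_assoc, mul_smul_comm,
    mul_assoc, smul_sub, zero_add]
  match_scalars <;> field_simp <;> ring

theorem rootDefect_succ_comm (H : NilpotentRel a g) (ha : a ≠ 0) (i : ℕ) :
    rootDefect a g i (i + 1) * g (i + 1) = g (i + 1) * rootDefect a g i (i + 1) := by
  have h := H.root_mul_self ha i
  have hd : seqRoot a g i * g (i + 1) = seqRoot a g (i + 1) + a⁻¹ • (g (i + 1) * seqRoot a g i) := by
    rw [seqRoot, qComm]; abel
  have hd' (w : A) : seqRoot a g i * (g (i + 1) * w) =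
      seqRoot a g (i + 1) * w + a⁻¹ • (g (i + 1) * (seqRoot a g i * w)) := by
    rw [← mul_assoc, hd, add_mul, smul_mul_assoc, mul_assoc]
  have h' (w : A) : seqRoot a g (i + 1) * (g (i + 1) * w) =
      a • (g (i + 1) * (seqRoot a g (i + 1) * w)) := by
    rw [← mul_assoc, h, smul_mul_assoc, mul_assoc]
  simp only [rootDefect, qComm, sub_mul, mul_sub, smul_mul_assoc, mul_smul_comm, mul_assoc, h, hd,
    h', hd', mul_add, smul_add]
  match_scalars <;> field_simp <;> ring

theorem rootDefect_zero_comm (H : NilpotentRel a g) (ha : a ≠ 0) {j : ℕ} (hj : 0 < j) :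
    rootDefect a g 0 j * g 0 = g 0 * rootDefect a g 0 j := by
  induction j, hj using Nat.le_induction with
  | base => exact (rootDefect_zero_one (g := g) ha).symm ▸ H.delta.symm
  | succ j hj ih =>
    rw [H.rootDefect_succ_right hj]
    exact qComm_mul_right_comm _ ih (H.comm 0 _ (by omega)).symm

end NilpotentRel

end Nilpotent

/-! ### Vectors on which the composite root vectors commute up to a scalar. -/

section Annihilated

variable {A : Type*} [Ring A] [Algebra ℂ A] {W : Type*} [AddCommGroup W] [Module ℂ W] [Module A W]
  [IsScalarTower ℂ A W]

/-- The vectors on which the composite root vectors `a`-commute. -/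
def IsRootCommuting (a : ℂ) (g : ℕ → A) (w : W) : Prop :=
  ∀ i j, i < j → rootDefect a g i j • w = 0

theorem qComm_smul (a : ℂ) (x y : A) (w : W) :
    qComm a x y • w = x • y • w - a • (y • x • w) := by
  simp [qComm, sub_smul, mul_smul, smul_assoc]

namespace NilpotentRel

variable {a : ℂ} {g : ℕ → A}

theorem qComm_mul_of_smul {x y z : A} {b c : ℂ} (hx : x * z = b • (z * x))
    (hy : y * z = c • (z * y)) : qComm a x y * z = (b * c) • (z * qComm a x y) := by
  have hx' (w : A) : x * (z * w) = b • (z * (x * w)) := by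
    rw [← mul_assoc, hx, smul_mul_assoc, mul_assoc]
  have hy' (w : A) : y * (z * w) = c • (z * (y * w)) := by
    rw [← mul_assoc, hy, smul_mul_assoc, mul_assoc]
  simp only [qComm, sub_mul, mul_sub, smul_mul_assoc, mul_smul_comm, mul_assoc, hx, hy, hx', hy']
  match_scalars <;> ring

/-- Moving a defect past `g k` with `k > 0` either rescales it or, when `k = j + 1` or `k = i + 1 <
j`, produces the neighbouring defect as a bracket. In both cases only defects applied to `w` itself
remain. -/
theorem isRootCommuting_smul (H : NilpotentRel a g) (ha : a ≠ 0) (ha2 : a ^ 2 + 1 ≠ 0) {w : W}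
    (hw : IsRootCommuting a g w) {k : ℕ} (hk : 0 < k) : IsRootCommuting a g (g k • w) := by
  intro i j hij
  have key {b : ℂ} (h : rootDefect a g i j * g k = b • (g k * rootDefect a g i j)) :
      rootDefect a g i j • g k • w = 0 := by
    rw [← mul_smul, h, smul_assoc, mul_smul, hw i j hij, smul_zero, smul_zero]
  have key2 {X : A} (h : X = qComm a⁻¹ (rootDefect a g i j) (g k)) (hX : X • w = 0) :
      rootDefect a g i j • g k • w = 0 := by
    rw [h, qComm_smul, hw i j hij, smul_zero, smul_zero, sub_zero] at hX
    exact hX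
  have hself {i : ℕ} (h : i = k) : seqRoot a g i * g k = a • (g k * seqRoot a g i) := by
    obtain ⟨k, rfl⟩ := Nat.exists_eq_succ_of_ne_zero hk.ne'
    subst h
    exact H.root_mul_self ha k
  have hc {i : ℕ} (h1 : i ≠ k) (h2 : i + 1 ≠ k) :
      seqRoot a g i * g k = (1 : ℂ) • (g k * seqRoot a g i) := by
    rw [one_smul, H.root_comm ha ha2 hk h1 h2]
  by_cases h1 : k = j + 1
  · subst h1
    exact key2 (H.rootDefect_succ_right hij) (hw i (j + 1) (by omega))
  by_cases h2 : k = i + 1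
  · subst h2
    by_cases h3 : j = i + 1
    · subst h3
      exact key (b := 1) (by rw [one_smul, H.rootDefect_succ_comm ha])
    · exact key2 (H.rootDefect_succ_left ha ha2 (by omega)) (hw (i + 1) j (by omega))
  by_cases h3 : k = i
  · exact key (qComm_mul_of_smul (hself h3.symm) (hc (by omega) (by omega)))
  by_cases h4 : k = j
  · exact key (qComm_mul_of_smul (hc (by omega) (by omega)) (hself h4.symm))
  · exact key (qComm_mul_of_smul (hc (by omega) (by omega)) (hc (by omega) (by omega)))

/-- Write `D i j` for the defects and `x_i` for the root vectors. Three relations link `D 1 2 g_0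
w`, `D 0 2 x_1 w` and `D 0 1 x_2 w`: `r1` unfolds `D 1 2` as a bracket of `D 0 2`, `r3` unfolds
`x_2`, and `r2` compares the reorderings of a product of `x_0`, `x_1`, `x_2`. Together they give
`(a² + 1 + a⁻²) D 0 2 x_1 w = 0`. -/
theorem rootDefect_one_two_smul (H : NilpotentRel a g) (ha : a ≠ 0) (ha2 : a ^ 2 + 1 ≠ 0)
    (ha3 : a ^ 4 + a ^ 2 + 1 ≠ 0) {w : W} (hw : IsRootCommuting a g w) :
    rootDefect a g 1 2 • g 0 • w = 0 := by
  have h01 := hw 0 1 (by omega)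
  have h02 := hw 0 2 (by omega)
  have h12 := hw 1 2 (by omega)
  have hw1 := H.isRootCommuting_smul ha ha2 hw (k := 1) one_pos
  have hw2 := H.isRootCommuting_smul ha ha2 hw (k := 2) two_pos
  have c0 := H.rootDefect_zero_comm ha (j := 1) one_pos
  have c0' := H.rootDefect_zero_comm ha (j := 2) two_pos
  have c1 := H.rootDefect_succ_comm ha 0
  have c2 : rootDefect a g 0 1 * seqRoot a g 1 = seqRoot a g 1 * rootDefect a g 0 1 :=
    (qComm_mul_right_comm _ c0.symm c1.symm).symm
  have r1 : rootDefect a g 1 2 • g 0 • w = -(a • rootDefect a g 0 2 • seqRoot a g 1 • w) := by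
    have e : g 1 • g 0 • w = a • (g 0 • g 1 • w) - a • (seqRoot a g 1 • w) := by
      simp only [seqRoot, qComm_smul, smul_sub, smul_smul, mul_inv_cancel₀ ha, one_smul, zero_add]
      abel
    have e2 : rootDefect a g 0 2 • g 0 • g 1 • w = 0 := by
      rw [← mul_smul, c0', mul_smul, hw1 0 2 (by omega), smul_zero]
    have e3 : rootDefect a g 0 2 • g 0 • w = 0 := by
      rw [← mul_smul, c0', mul_smul, h02, smul_zero]
    rw [H.rootDefect_succ_left ha ha2 (i := 0) (j := 2) (by omega), qComm_smul, zero_add, e,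
      smul_sub, smul_comm _ a, smul_comm _ a, e2, e3]
    simp
  have r2 : rootDefect a g 0 2 • seqRoot a g 1 • w =
      a⁻¹ • rootDefect a g 0 1 • seqRoot a g 2 • w + a • rootDefect a g 1 2 • g 0 • w := by
    -- Since the defects kill `w`, every product of two root vectors next to `w` can be reordered;
    -- what survives is the failure of reordering one step further from `w`.
    rw [rootDefect, qComm_smul, sub_eq_zero] at h01 h02 h12
    simp only [rootDefect, qComm_smul]
    rw [h01, h12, show g 0 = seqRoot a g 0 from rfl, h02]
    simp only [smul_comm (seqRoot a g _) a]
    generalize seqRoot a g 0 • seqRoot a g 2 • seqRoot a g 1 • w = u₁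
    generalize seqRoot a g 2 • seqRoot a g 1 • seqRoot a g 0 • w = u₂
    generalize seqRoot a g 1 • seqRoot a g 2 • seqRoot a g 0 • w = u₃
    match_scalars <;> field_simp
    ring
  have r3 : rootDefect a g 0 1 • seqRoot a g 2 • w =
      -(a⁻¹ • rootDefect a g 0 2 • seqRoot a g 1 • w) := by
    have e : rootDefect a g 0 1 • g 2 • seqRoot a g 1 • w =
        rootDefect a g 0 2 • seqRoot a g 1 • w := by
      rw [H.rootDefect_succ_right (i := 0) (j := 1) (by omega), qComm_smul,
        ← mul_smul (rootDefect a g 0 1) (seqRoot a g 1), c2, mul_smul, h01]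
      simp
    have e2 : rootDefect a g 0 1 • seqRoot a g 1 • g 2 • w = 0 := by
      rw [← mul_smul, c2, mul_smul, hw2 0 1 (by omega), smul_zero]
    rw [show seqRoot a g 2 = qComm a⁻¹ (seqRoot a g 1) (g 2) from rfl, qComm_smul, smul_sub, e2,
      smul_comm _ a⁻¹, e, zero_sub]
  have r4 : (a ^ 4 + a ^ 2 + 1) • (rootDefect a g 0 2 • seqRoot a g 1 • w) = 0 := by
    rw [r1, r3] at r2
    generalize rootDefect a g 0 2 • seqRoot a g 1 • w = u at r2
    linear_combination (norm := skip) a ^ 2 • r2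
    match_scalars
    field_simp
    ring
  rw [r1, (smul_eq_zero.mp r4).resolve_left ha3, smul_zero, neg_zero]

/-- Defects with `i = 0` commute with `g 0`. The others are reached from `D 1 2` by brackets with
generators `g k`, `k ≥ 2`, which commute with `g 0`. -/
theorem isRootCommuting_smul_zero (H : NilpotentRel a g) (ha : a ≠ 0) (ha2 : a ^ 2 + 1 ≠ 0)
    (ha3 : a ^ 4 + a ^ 2 + 1 ≠ 0) {w : W} (hw : IsRootCommuting a g w) :
    IsRootCommuting a g (g 0 • w) := by
  -- The vector is quantified inside the induction, because the step applies the hypothesis to `g (j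
  -- + 1) • w` as well as to `w`.
  have h1 : ∀ j, 1 < j → ∀ w : W, IsRootCommuting a g w → rootDefect a g 1 j • g 0 • w = 0 := by
    intro j hj
    induction j, hj using Nat.le_induction with
    | base => exact fun w hw => H.rootDefect_one_two_smul ha ha2 ha3 hw
    | succ j hj ih =>
      intro w hw
      have e : g (j + 1) • g 0 • w = g 0 • g (j + 1) • w := by
        rw [← mul_smul, ← H.comm 0 (j + 1) (by omega), mul_smul]
      rw [H.rootDefect_succ_right (by omega), qComm_smul, ih w hw, e,
        ih _ (H.isRootCommuting_smul ha ha2 hw (by omega))]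
      simp
  have h2 : ∀ i, 0 < i → ∀ j, i < j → ∀ w : W, IsRootCommuting a g w →
      rootDefect a g i j • g 0 • w = 0 := by
    intro i hi
    induction i, hi using Nat.le_induction with
    | base => exact h1
    | succ i hi ih =>
      intro j hj w hw
      have e : g (i + 1) • g 0 • w = g 0 • g (i + 1) • w := by
        rw [← mul_smul, ← H.comm 0 (i + 1) (by omega), mul_smul]
      rw [H.rootDefect_succ_left ha ha2 (by omega), qComm_smul, ih j (by omega) w hw, e,
        ih j (by omega) _ (H.isRootCommuting_smul ha ha2 hw (by omega))]
      simp
  intro i j hij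
  rcases Nat.eq_zero_or_pos i with rfl | hi
  · rw [← mul_smul, H.rootDefect_zero_comm ha hij, mul_smul, hw 0 j hij, smul_zero]
  · exact h2 i hi j hij w hw

theorem isRootCommuting_gen (H : NilpotentRel a g) (ha : a ≠ 0) (ha2 : a ^ 2 + 1 ≠ 0) {w : W}
    (h : ∀ k, 0 < k → g k • w = 0)
    (hd : qComm a⁻¹ (g 0) (qComm a (g 0) (g 1)) • w = 0) : IsRootCommuting a g w := by
  have h0 : ∀ j, 0 < j → rootDefect a g 0 j • w = 0 := by
    intro j hj
    induction j, hj using Nat.le_induction with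
    | base => exact (rootDefect_zero_one (g := g) ha).symm ▸ hd
    | succ j hj ih =>
      rw [H.rootDefect_succ_right hj, qComm_smul, ih, h (j + 1) (by omega)]
      simp
  intro i
  induction i with
  | zero => exact h0
  | succ i ih =>
    intro j hij
    rw [H.rootDefect_succ_left ha ha2 hij, qComm_smul, ih j (by omega), h (i + 1) (by omega)]
    simp

end NilpotentRel

end Annihilated

/-! ### The Cartan matrix -/

/-- The simple root `α_{i+1}`, as a sequence of coordinates. -/
def rootSeq (i k : ℕ) : ℤ := (if k = i then 1 else 0) - (if k + 1 = i then 1 else 0)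

/-- The inner product of a sequence of coordinates with a simple root. -/
def rootInner : ℕ → (ℕ → ℤ) → ℤ
  | 0, m => m 0
  | i + 1, m => m (i + 1) - m i

theorem rootInner_add (i : ℕ) (m m' : ℕ → ℤ) :
    rootInner i (m + m') = rootInner i m + rootInner i m' := by
  cases i <;> simp only [rootInner, Pi.add_apply]
  ring

theorem rootInner_sub (i : ℕ) (m m' : ℕ → ℤ) :
    rootInner i (m - m') = rootInner i m - rootInner i m' := by
  cases i <;> simp only [rootInner, Pi.sub_apply]
  ring

theorem pairing_eq {n : ℕ} (i j : Fin n) : pairing i j = rootInner i (rootSeq j) := by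
  have h (y : ℕ → ℤ) : ∑ k : Fin n, simpleRoot i k * y k = rootInner i y := by
    obtain ⟨i, hi⟩ := i
    simp only [simpleRoot, sub_mul, Finset.sum_sub_distrib, ite_mul, one_mul, zero_mul]
    rw [Finset.sum_ite_eq' Finset.univ]
    cases i with
    | zero => simp [rootInner]
    | succ i =>
      have : ∀ k : Fin n, (if (k : ℕ) + 1 = i + 1 then y k else 0) =
          if k = ⟨i, by omega⟩ then y k else 0 := by
        intro k
        simp [Fin.ext_iff]
      simp only [this]
      rw [Finset.sum_ite_eq' Finset.univ]
      simp [rootInner]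
  rw [← h]
  refine Finset.sum_congr rfl fun k _ => ?_
  simp [simpleRoot, rootSeq, Fin.ext_iff]

theorem pairing_eq_zero {n : ℕ} {i j : Fin n} (h : (i : ℕ) + 2 ≤ j) : pairing i j = 0 := by
  obtain ⟨i, hi⟩ := i
  obtain ⟨j, hj⟩ := j
  dsimp only at h
  rw [pairing_eq]
  cases i <;> simp only [rootInner, rootSeq] <;> split_ifs <;> omega

theorem serre_pairing {n : ℕ} {i j : Fin n} (hi : 0 < (i : ℕ))
    (h : (i : ℕ) = j + 1 ∨ (j : ℕ) = i + 1) : 2 * pairing i j = -pairing i i := by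
  obtain ⟨i, hi'⟩ := i
  obtain ⟨j, hj⟩ := j
  dsimp only at h hi
  rw [pairing_eq, pairing_eq]
  obtain ⟨i, rfl⟩ := Nat.exists_eq_succ_of_ne_zero hi.ne'
  simp only [rootInner, rootSeq]
  split_ifs <;> omega

/-! ### Quantum group relations as nilpotent relations, and triangular generation. -/

section Modules

variable {A : Type*} [Ring A] [Algebra ℂ A] {n : ℕ} {q : ℂˣ} {e f k k' : Fin n → A}

theorem extZero_of_lt (g : Fin n → A) {i : ℕ} (h : i < n) : extZero g i = g ⟨i, h⟩ := dif_pos h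

theorem extZero_of_le (g : Fin n → A) {i : ℕ} (h : n ≤ i) : extZero g i = 0 :=
  dif_neg (not_lt.mpr h)

theorem qComm_zero_left (a : ℂ) (x : A) : qComm a 0 x = 0 := by simp [qComm]

theorem qComm_zero_right (a : ℂ) (x : A) : qComm a x 0 = 0 := by simp [qComm]

namespace Satisfies

/-- This symmetry lets `N_λ` be treated as a copy of `M_λ` with raising and lowering generators
interchanged. -/
theorem swap (H : Satisfies n q e f k k') : Satisfies n q f e k' k where
  k_kInv := H.kInv_k
  kInv_k := H.k_kInv
  k_comm i j := by
    have h : k' j * k' i * (k i * k j) = 1 := by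
      rw [mul_assoc, ← mul_assoc (k' i), H.kInv_k, one_mul, H.kInv_k]
    have h2 : k i * k j * (k' i * k' j) = 1 := by
      rw [H.k_comm, mul_assoc, ← mul_assoc (k i), H.k_kInv, one_mul, H.k_kInv]
    exact (left_inv_eq_right_inv h h2).symm
  k_e i j := by
    have h := congrArg (fun z => k' i * z * k i) (H.k_f i j)
    simp only [mul_smul_comm, smul_mul_assoc, ← mul_assoc, H.kInv_k, one_mul] at h
    rw [mul_assoc, H.kInv_k, mul_one] at h
    conv_rhs => rw [h, smul_smul, ← Units.val_mul, ← zpow_add, add_neg_cancel, zpow_zero, Units.val_one,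
      one_smul]
  k_f i j := by
    have h := congrArg (fun z => k' i * z * k i) (H.k_e i j)
    simp only [mul_smul_comm, smul_mul_assoc, ← mul_assoc, H.kInv_k, one_mul] at h
    rw [mul_assoc, H.kInv_k, mul_one] at h
    conv_rhs => rw [h, smul_smul, ← Units.val_mul, ← zpow_add, neg_add_cancel, zpow_zero, Units.val_one,
      one_smul]
  e_f_same i := by rw [← neg_sub, H.e_f_same, ← smul_neg, neg_sub]
  e_f_diff i j h := by rw [← neg_sub, H.e_f_diff j i h.symm, neg_zero]
  serre_e := H.serre_f
  serre_f := H.serre_e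
  delta_e := H.delta_f
  delta_f := H.delta_e
  e_comm := H.f_comm
  f_comm := H.e_comm

theorem k_mul_f (H : Satisfies n q e f k k') (i j : Fin n) :
    k i * f j = ((q ^ (-pairing i j) : ℂˣ) : ℂ) • (f j * k i) := by
  rw [← smul_mul_assoc, ← H.k_f, mul_assoc, H.kInv_k, mul_one]

theorem kInv_mul_f (H : Satisfies n q e f k k') (i j : Fin n) :
    k' i * f j = ((q ^ (pairing i j) : ℂˣ) : ℂ) • (f j * k' i) := by
  rw [← smul_mul_assoc, ← H.swap.k_e, mul_assoc, H.k_kInv, mul_one]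

theorem e_mul_f (H : Satisfies n q e f k k') (i j : Fin n) : ∃ c : ℂ,
    e i * f j = f j * e i + c • (k i - k' i) := by
  by_cases h : i = j
  · subst h
    exact ⟨_, by rw [← H.e_f_same]; abel⟩
  · exact ⟨0, by rw [zero_smul, add_zero, ← sub_eq_zero, H.e_f_diff i j h]⟩

/-- Extending by zero makes the relations hold at all natural indices: beyond the rank one of the
entries vanishes. Thus the rank disappears from the nilpotent computations. -/
theorem nilpotentRel (H : Satisfies n q e f k k') : NilpotentRel (q : ℂ) (extZero f) where
  comm i j h := by
    by_cases hj : j < n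
    · rw [extZero_of_lt _ hj, extZero_of_lt _ (by omega : i < n)]
      exact H.f_comm _ _ (pairing_eq_zero h)
    · simp [extZero_of_le _ (not_lt.mp hj)]
  serre_down i := by
    by_cases hi : i + 1 < n
    · rw [extZero_of_lt _ hi, extZero_of_lt _ (by omega : i < n), ← Units.val_inv_eq_inv_val]
      exact H.serre_f _ _ (serre_pairing (Nat.succ_pos i) (Or.inl rfl))
    · rw [extZero_of_le _ (not_lt.mp hi), qComm_zero_left]
  serre_up i := by
    by_cases hi : i + 2 < n
    · rw [extZero_of_lt _ hi, extZero_of_lt _ (by omega : i + 1 < n), ← Units.val_inv_eq_inv_val]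
      exact H.serre_f _ _ (serre_pairing (Nat.succ_pos i) (Or.inr rfl))
    · rw [extZero_of_le _ (not_lt.mp hi), qComm_zero_right, qComm_zero_right]
  delta := by
    rw [← sub_eq_zero, ← Units.val_inv_eq_inv_val]
    exact H.delta_f

variable {W : Type*} [AddCommGroup W] [Module ℂ W] [Module A W] [IsScalarTower ℂ A W]

/-- A subspace which contains a generating subspace stable under the positive part and is stable
under the negative part is the whole space. -/
theorem eq_top_of_stable (H : Satisfies n q e f k k') {C p : Submodule ℂ W}
    (hCe : ∀ i, ∀ w ∈ C, e i • w ∈ C) (hCk : ∀ i, ∀ w ∈ C, k i • w ∈ C)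
    (hCk' : ∀ i, ∀ w ∈ C, k' i • w ∈ C)
    (hgen : ∀ Q : Submodule ℂ W, C ≤ Q → (∀ i, ∀ w ∈ Q, e i • w ∈ Q) →
      (∀ i, ∀ w ∈ Q, f i • w ∈ Q) → (∀ i, ∀ w ∈ Q, k i • w ∈ Q) →
      (∀ i, ∀ w ∈ Q, k' i • w ∈ Q) → Q = ⊤)
    (hCp : C ≤ p) (hp : ∀ i, ∀ w ∈ p, f i • w ∈ p) : p = ⊤ := by
  set Q : Submodule ℂ W := sInf {p | C ≤ p ∧ ∀ i, ∀ w ∈ p, f i • w ∈ p} with hQ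
  have hQp {p : Submodule ℂ W} (h1 : C ≤ p) (h2 : ∀ i, ∀ w ∈ p, f i • w ∈ p) : Q ≤ p :=
    sInf_le ⟨h1, h2⟩
  have hCQ : C ≤ Q := le_sInf fun p hp => hp.1
  have hQf : ∀ i, ∀ w ∈ Q, f i • w ∈ Q := by
    intro i w hw
    rw [hQ, Submodule.mem_sInf] at hw ⊢
    exact fun p hp => hp.2 i w (hw p hp)
  -- By minimality of `Q`, stability under `x` may be checked on `C` and then propagated along
  -- applications of the `f j`.
  have stable {x : A} (hx : ∀ w ∈ C, x • w ∈ C)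
      (hxf : ∀ j, ∀ w ∈ Q, x • w ∈ Q → x • f j • w ∈ Q) : ∀ w ∈ Q, x • w ∈ Q := by
    have : Q ≤ Q ⊓ Q.comap (Module.toModuleEnd ℂ (S := A) W x) := by
      refine hQp (le_inf hCQ fun w hw => hCQ (hx w hw)) fun j w hw => ?_
      exact ⟨hQf j w hw.1, hxf j w hw.1 hw.2⟩
    exact fun w hw => (this hw).2
  have hQk : ∀ i, ∀ w ∈ Q, k i • w ∈ Q := by
    refine fun i => stable (hCk i) fun j w _ hw => ?_
    rw [← mul_smul, H.k_mul_f, smul_assoc, mul_smul]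
    exact Q.smul_mem _ (hQf j _ hw)
  have hQk' : ∀ i, ∀ w ∈ Q, k' i • w ∈ Q := by
    refine fun i => stable (hCk' i) fun j w _ hw => ?_
    rw [← mul_smul, H.kInv_mul_f, smul_assoc, mul_smul]
    exact Q.smul_mem _ (hQf j _ hw)
  have hQe : ∀ i, ∀ w ∈ Q, e i • w ∈ Q := by
    refine fun i => stable (hCe i) fun j w hw hw' => ?_
    obtain ⟨c, hc⟩ := H.e_mul_f i j
    rw [← mul_smul, hc, add_smul, mul_smul, smul_assoc, sub_smul]
    exact Q.add_mem (hQf j _ hw') (Q.smul_mem _ (Q.sub_mem (hQk i w hw) (hQk' i w hw)))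
  rw [← top_le_iff, ← hgen Q hCQ hQe hQf hQk hQk']
  exact hQp hCp hp

end Satisfies

/-! ### Spanning by ordered monomials -/

theorem monomial_succ (x : ℕ → A) (m : Fin (n + 1) → ℕ) :
    monomial x m = x 0 ^ m 0 * monomial (fun i => x (i + 1)) (fun i => m i.succ) := by
  simp [monomial, List.ofFn_succ]

theorem monomial_zero (x : ℕ → A) : monomial x (0 : Fin n → ℕ) = 1 := by
  simp [monomial]

variable {W : Type*} [AddCommGroup W] [Module ℂ W] [Module A W] [IsScalarTower ℂ A W]

theorem pow_smul_mem {p : Submodule ℂ W} {x : A} (h : ∀ w ∈ p, x • w ∈ p) (m : ℕ) {w : W}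
    (hw : w ∈ p) : x ^ m • w ∈ p := by
  induction m with
  | zero => simpa using hw
  | succ m ih => rw [pow_succ', mul_smul]; exact h _ ih

theorem monomial_smul_mem {p : Submodule ℂ W} {x : ℕ → A} (h : ∀ i, ∀ w ∈ p, x i • w ∈ p)
    (m : Fin n → ℕ) {w : W} (hw : w ∈ p) : monomial x m • w ∈ p := by
  induction n generalizing x with
  | zero => simpa [monomial] using hw
  | succ n ih =>
    rw [monomial_succ, mul_smul]
    exact pow_smul_mem (h 0) _ (ih (fun i => h (i + 1)) _)

/-- Commuting `x i` to its place past the powers of smaller index only costs powers of `a⁻¹`. -/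
theorem smul_monomial {x : ℕ → A} {a : ℂ} (ha : a ≠ 0)
    (h : ∀ i j, i < j → ∀ w : W, x i • x j • w = a • x j • x i • w) (i : Fin n) (m : Fin n → ℕ)
    (w : W) : ∃ c : ℂ, x i • monomial x m • w = c • monomial x (m + Pi.single i 1) • w := by
  induction n generalizing x with
  | zero => exact i.elim0
  | succ n ih =>
    rw [monomial_succ, mul_smul]
    induction i using Fin.cases with
    | zero =>
      refine ⟨1, ?_⟩
      rw [one_smul, monomial_succ, mul_smul]
      simp [pow_succ', mul_smul]
    | succ i =>
      have hpow (r : ℕ) (v : W) : x (i + 1) • x 0 ^ r • v = (a⁻¹ ^ r) • x 0 ^ r • x (i + 1) • v := by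
        induction r generalizing v with
        | zero => simp
        | succ r ihr =>
          have h1 : x (i + 1) • x 0 • v = a⁻¹ • x 0 • x (i + 1) • v := by
            rw [h 0 (i + 1) (by omega), inv_smul_smul₀ ha]
          rw [pow_succ, mul_smul, ihr, h1, smul_comm _ a⁻¹, smul_smul, ← mul_smul (x 0 ^ r), pow_succ]
      obtain ⟨c, hc⟩ := ih (x := fun i => x (i + 1)) (fun i j hij => h _ _ (by omega)) i
        (fun i => m i.succ)
      refine ⟨a⁻¹ ^ m 0 * c, ?_⟩
      have hm : (fun j : Fin n => (m + Pi.single i.succ 1 : Fin (n + 1) → ℕ) j.succ) =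
          (fun j => m j.succ) + Pi.single i 1 := by
        funext j
        simp [Pi.single_apply]
      have hm0 : (m + Pi.single i.succ 1 : Fin (n + 1) → ℕ) 0 = m 0 := by simp
      rw [monomial_succ x (m + _), hm, hm0, mul_smul (x 0 ^ m 0), Fin.val_succ, hpow, hc,
        smul_comm _ c, smul_smul]

theorem seqRoot_extZero (q : ℂˣ) (f : Fin n → A) (i : ℕ) :
    rootVecF q f i = seqRoot (q : ℂ) (extZero f) i := by
  induction i with
  | zero => rfl
  | succ i ih => rw [rootVecF, seqRoot, ih, Units.val_inv_eq_inv_val]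

/-- Root commutation propagates from `w₀` to the whole module, so the span of ordered monomials is
stable under the root vectors. It is also stable under the simple generators: moving one past a root
vector yields at worst the next root vector. -/
theorem Satisfies.span_monomial (H : Satisfies n q e f k k') (hq2 : (q : ℂ) ^ 2 + 1 ≠ 0)
    (hq3 : (q : ℂ) ^ 4 + (q : ℂ) ^ 2 + 1 ≠ 0) {w₀ : W}
    (hgen : ∀ p : Submodule ℂ W, w₀ ∈ p → (∀ i, ∀ w ∈ p, f i • w ∈ p) → p = ⊤)
    (hf : ∀ i : Fin n, 0 < (i : ℕ) → f i • w₀ = 0) (hd : deltaVec q f • w₀ = 0) :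
    Submodule.span ℂ (Set.range fun m : Fin n → ℕ => monomial (rootVecF q f) m • w₀) = ⊤ := by
  set g := extZero f with hg
  have Hn := H.nilpotentRel
  have hq0 : (q : ℂ) ≠ 0 := q.ne_zero
  have hgf (i : Fin n) : f i = g i := (extZero_of_lt f i.2).symm
  have hg0 (j : ℕ) (hj : 0 < j) : g j • w₀ = 0 := by
    by_cases h : j < n
    · rw [hg, extZero_of_lt _ h]; exact hf _ hj
    · rw [hg, extZero_of_le _ (not_lt.mp h), zero_smul]
  -- The vectors killed by all defects form a subspace containing `w₀` and stable under every `f i`,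
  -- hence everything.
  have hcomm : ∀ w : W, IsRootCommuting (q : ℂ) g w := by
    let p : Submodule ℂ W :=
      { carrier := {w | IsRootCommuting (q : ℂ) g w}
        add_mem' := fun hx hy i j hij => by rw [smul_add, hx i j hij, hy i j hij, add_zero]
        zero_mem' := fun i j _ => smul_zero _
        smul_mem' := fun c x hx i j hij => by rw [smul_comm, hx i j hij, smul_zero] }
    have hp : p = ⊤ := by
      refine hgen p ?_ fun i w hw => ?_
      · refine Hn.isRootCommuting_gen hq0 hq2 hg0 ?_
        rw [← Units.val_inv_eq_inv_val]
        exact hd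
      · rw [hgf]
        rcases Nat.eq_zero_or_pos i with h | h
        · rw [h]
          exact Hn.isRootCommuting_smul_zero hq0 hq2 hq3 hw
        · exact Hn.isRootCommuting_smul hq0 hq2 hw h
    intro w
    have : w ∈ p := hp ▸ Submodule.mem_top
    exact this
  have hx : rootVecF q f = seqRoot (q : ℂ) g := funext (seqRoot_extZero q f)
  rw [hx]
  set x := seqRoot (q : ℂ) g
  set p := Submodule.span ℂ (Set.range fun m : Fin n → ℕ => monomial x m • w₀) with hpdef
  have hmem (m : Fin n → ℕ) : monomial x m • w₀ ∈ p := Submodule.subset_span ⟨m, rfl⟩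
  have hw₀ : w₀ ∈ p := by simpa [monomial_zero] using hmem 0
  have hxcomm : ∀ i j, i < j → ∀ w : W, x i • x j • w = (q : ℂ) • x j • x i • w := by
    intro i j hij w
    have h := hcomm w i j hij
    rwa [rootDefect, qComm_smul, sub_eq_zero] at h
  have hxp : ∀ i, ∀ w ∈ p, x i • w ∈ p := by
    intro i w hw
    by_cases hi : i < n
    · induction hw using Submodule.span_induction with
      | mem w hw =>
        obtain ⟨m, rfl⟩ := hw
        obtain ⟨c, hc⟩ := smul_monomial hq0 hxcomm ⟨i, hi⟩ m w₀
        exact hc ▸ p.smul_mem c (hmem _)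
      | zero => rw [smul_zero]; exact p.zero_mem
      | add v w _ _ h1 h2 => rw [smul_add]; exact p.add_mem h1 h2
      | smul c v _ h => rw [smul_comm]; exact p.smul_mem c h
    · have : x i = 0 := by
        cases i with
        | zero => exact extZero_of_le _ (not_lt.mp hi)
        | succ i =>
          change qComm _ _ (extZero f (i + 1)) = 0
          rw [extZero_of_le _ (not_lt.mp hi), qComm_zero_right]
      rw [this, zero_smul]
      exact p.zero_mem
  -- The part of `p` that the simple generators map back into `p`. It contains `w₀` and is stable
  -- under the root vectors, so it contains every monomial and equals `p`.
  let p' : Submodule ℂ W :=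
    { carrier := {w | w ∈ p ∧ ∀ j, g j • w ∈ p}
      add_mem' := fun hx hy => ⟨p.add_mem hx.1 hy.1, fun j => by
        rw [smul_add]; exact p.add_mem (hx.2 j) (hy.2 j)⟩
      zero_mem' := ⟨p.zero_mem, fun j => by rw [smul_zero]; exact p.zero_mem⟩
      smul_mem' := fun c w hw => ⟨p.smul_mem c hw.1, fun j => by
        rw [smul_comm]; exact p.smul_mem c (hw.2 j)⟩ }
  have hw₀' : w₀ ∈ p' := by
    refine ⟨hw₀, fun j => ?_⟩
    rcases Nat.eq_zero_or_pos j with rfl | h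
    · exact hxp 0 _ hw₀
    · rw [hg0 j h]; exact p.zero_mem
  have hxp' : ∀ i, ∀ w ∈ p', x i • w ∈ p' := by
    intro i w hw
    refine ⟨hxp i w hw.1, fun j => ?_⟩
    rcases Nat.eq_zero_or_pos j with rfl | h
    · exact hxp 0 _ (hxp i w hw.1)
    · by_cases h1 : i = j
      · obtain ⟨j, rfl⟩ := Nat.exists_eq_succ_of_ne_zero h.ne'
        subst h1
        have hs := congrArg (fun z => (q : ℂ)⁻¹ • z • w) (Hn.root_mul_self hq0 j)
        simp only [smul_assoc, mul_smul, inv_smul_smul₀ hq0] at hs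
        exact hs ▸ p.smul_mem _ (hxp _ _ (hw.2 _))
      by_cases h2 : i + 1 = j
      · subst h2
        have hs : g (i + 1) • x i • w = (q : ℂ) • (x i • g (i + 1) • w - x (i + 1) • w) := by
          simp only [x]
          rw [seqRoot, qComm_smul, sub_sub_cancel, smul_inv_smul₀ hq0]
        exact hs ▸ p.smul_mem _ (p.sub_mem (hxp _ _ (hw.2 _)) (hxp _ _ hw.1))
      · rw [← mul_smul, ← Hn.root_comm hq0 hq2 h h1 h2, mul_smul]
        exact hxp _ _ (hw.2 _)
  refine hgen p hw₀ fun i w hw => ?_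
  have hle : p ≤ p' := by
    rw [hpdef, Submodule.span_le]
    rintro _ ⟨m, rfl⟩
    exact monomial_smul_mem hxp' m hw₀'
  rw [hgf]
  exact (hle hw).2 i

end Modules

/-! ### Quantum integers -/

/-- The quantum integer `[m]_q` for an integer `m`. -/
def qInt (q : ℂˣ) (m : ℤ) : ℂ := ((q : ℂ) ^ m - (q : ℂ) ^ (-m)) / ((q : ℂ) - (q : ℂ)⁻¹)

theorem qInt_zero (q : ℂˣ) : qInt q 0 = 0 := by simp [qInt]

theorem qInt_natCast (q : ℂˣ) (m : ℕ) : qInt q m = qNumber q m := by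
  simp [qInt, qNumber]

/-- This three-term recurrence is the Serre relation in the Fock representation. -/
theorem qInt_recurrence (q : ℂˣ) (m : ℤ) :
    qInt q (m + 2) - ((q : ℂ) + (q : ℂ)⁻¹) * qInt q (m + 1) + qInt q m = 0 := by
  have hq : (q : ℂ) ≠ 0 := q.ne_zero
  have h : ∀ k : ℤ, (q : ℂ) ^ (-(m + k)) = (q : ℂ) ^ (-m) * (q : ℂ) ^ (-k) := fun k => by
    rw [← zpow_add₀ hq]; ring_nf
  rw [qInt, qInt, qInt, h, h, zpow_add₀ hq, zpow_add₀ hq]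
  have h2 : (q : ℂ) ^ (-2 : ℤ) = ((q : ℂ) ^ 2)⁻¹ := by simp [zpow_neg]
  have h3 : (q : ℂ) ^ (-1 : ℤ) = (q : ℂ)⁻¹ := by simp
  have h4 : (q : ℂ) ^ (2 : ℤ) = (q : ℂ) ^ 2 := rfl
  rw [h2, h3, h4, zpow_one, ← mul_div_assoc, ← sub_div, ← add_div]
  refine div_eq_zero_iff.mpr (Or.inl ?_)
  field_simp
  ring

/-- This gives the commutator of `e_α` and `f_α` in the Fock representation for the long simple
roots. -/
theorem qInt_mul_sub (q : ℂˣ) (hd : (q : ℂ) - (q : ℂ)⁻¹ ≠ 0) (a b : ℤ) :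
    qInt q a * qInt q (b + 1) - qInt q b * qInt q (a + 1) = qInt q (a - b) := by
  have hq : (q : ℂ) ≠ 0 := q.ne_zero
  simp only [qInt, neg_add, sub_eq_add_neg, neg_neg, zpow_add₀ hq, zpow_one] at hd ⊢
  simp only [zpow_neg, zpow_one]
  have ha := zpow_ne_zero a hq
  have hb := zpow_ne_zero b hq
  generalize (q : ℂ) ^ a = x at *
  generalize (q : ℂ) ^ b = y at *
  rw [div_mul_div_comm, div_mul_div_comm, ← sub_eq_add_neg, ← sub_div, div_eq_div_iff (by positivity) hd]
  field_simp
  ring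

theorem qInt_ne_zero {q : ℂˣ} (hq : ∀ k : ℕ, 0 < k → q ^ k ≠ 1) {m : ℤ} (hm : m ≠ 0) :
    qInt q m ≠ 0 := by
  have h1 (m : ℤ) (hm : m ≠ 0) : (q : ℂ) ^ m - (q : ℂ) ^ (-m) ≠ 0 := by
    intro h
    rw [sub_eq_zero, ← Units.val_zpow_eq_zpow_val, ← Units.val_zpow_eq_zpow_val] at h
    have h2 : q ^ (2 * m) = 1 := by
      rw [two_mul, zpow_add]
      nth_rw 1 [Units.ext h]
      rw [← zpow_add, neg_add_cancel, zpow_zero]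
    have h3 : q ^ (2 * m).natAbs = 1 := by
      rcases Int.natAbs_eq (2 * m) with h | h
      · rw [h, zpow_natCast] at h2
        exact h2
      · rw [h, zpow_neg, zpow_natCast, inv_eq_one] at h2
        exact h2
    exact hq _ (by omega) h3
  refine div_ne_zero (h1 m hm) ?_
  simpa using h1 1 one_ne_zero

/-! ### Weighted shifts -/

/-- The vector space spanned by the monomials with integral exponents. -/
abbrev Fock : Type := (ℕ → ℤ) →₀ ℂ

/-- The operator `x^m ↦ c(m) x^{m+v}`. -/
def shift (v : ℕ → ℤ) (c : (ℕ → ℤ) → ℂ) : Module.End ℂ Fock :=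
  Finsupp.linearCombination ℂ fun m => Finsupp.single (m + v) (c m)

theorem shift_single (v : ℕ → ℤ) (c : (ℕ → ℤ) → ℂ) (m : ℕ → ℤ) (b : ℂ) :
    shift v c (Finsupp.single m b) = Finsupp.single (m + v) (b * c m) := by
  simp [shift, Finsupp.smul_single]

theorem shift_apply_add (v : ℕ → ℤ) (c : (ℕ → ℤ) → ℂ) (x : Fock) (m : ℕ → ℤ) :
    shift v c x (m + v) = x m * c m := by
  classical
  induction x using Finsupp.induction_linear with
  | zero => simp
  | add x y hx hy => simp [hx, hy, add_mul]
  | single k b =>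
    rw [shift_single, Finsupp.single_apply, Finsupp.single_apply]
    by_cases h : k = m
    · simp [h]
    · simp [h]

theorem shift_ext {v w : ℕ → ℤ} {c d : (ℕ → ℤ) → ℂ} (h : v = w) (hc : ∀ m, c m = d m) :
    shift v c = shift w d := by
  rw [h, funext hc]

theorem shift_mul (v w : ℕ → ℤ) (c d : (ℕ → ℤ) → ℂ) :
    shift v c * shift w d = shift (w + v) fun m => d m * c (m + w) := by
  refine Finsupp.lhom_ext fun m b => ?_
  rw [Module.End.mul_apply, shift_single, shift_single, shift_single, add_assoc, mul_assoc]

theorem smul_shift (b : ℂ) (v : ℕ → ℤ) (c : (ℕ → ℤ) → ℂ) :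
    b • shift v c = shift v fun m => b * c m := by
  refine Finsupp.lhom_ext fun m b => ?_
  rw [LinearMap.smul_apply, shift_single, shift_single, Finsupp.smul_single, smul_eq_mul]
  ring_nf

theorem shift_sub_shift (v : ℕ → ℤ) (c d : (ℕ → ℤ) → ℂ) :
    shift v c - shift v d = shift v fun m => c m - d m := by
  refine Finsupp.lhom_ext fun m b => ?_
  rw [LinearMap.sub_apply, shift_single, shift_single, shift_single, mul_sub, Finsupp.single_sub]

theorem shift_eq_zero {v : ℕ → ℤ} {c : (ℕ → ℤ) → ℂ} (h : ∀ m, c m = 0) : shift v c = 0 := by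
  refine Finsupp.lhom_ext fun m b => ?_
  rw [shift_single, h, mul_zero, Finsupp.single_zero, LinearMap.zero_apply]

theorem shift_zero_one : shift 0 (fun _ => 1) = 1 := by
  refine Finsupp.lhom_ext fun m b => ?_
  rw [shift_single, add_zero, mul_one, Module.End.one_apply]

theorem shift_qComm (b : ℂ) (v w : ℕ → ℤ) (c d : (ℕ → ℤ) → ℂ) :
    qComm b (shift v c) (shift w d) =
      shift (v + w) fun m => d m * c (m + w) - b * (c m * d (m + v)) := by
  rw [qComm, shift_mul, shift_mul, add_comm w v, smul_shift, shift_sub_shift]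

/-- The hypothesis is the coefficient of the expanded Serre expression on `x^m`. With integral
exponents there are no boundary cases, so a Serre relation is one identity of coefficients. -/
theorem shift_serre {b : ℂ} (hb : b ≠ 0) {v w : ℕ → ℤ} {c d : (ℕ → ℤ) → ℂ}
    (h : ∀ m, d m * c (m + w) * c (m + w + v) - (b + b⁻¹) * (c m * d (m + v) * c (m + w + v)) +
      c m * c (m + v) * d (m + v + v) = 0) :
    qComm b⁻¹ (shift v c) (qComm b (shift v c) (shift w d)) = 0 := by
  rw [shift_qComm, shift_qComm]
  refine shift_eq_zero fun m => ?_
  rw [← h m, ← add_assoc m v w, add_right_comm m v w]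
  field_simp
  ring

/-! ### The Fock representation -/

section Fock

variable (q s : ℂˣ) (κ : ℂ)

/-- The coefficients of the operators representing the `f_α`. -/
def fockCoeffF : ℕ → (ℕ → ℤ) → ℂ
  | 0, _ => 1
  | i + 1, m => qInt q (m i)

/-- The operators representing the `f_α`. -/
def fockF (i : ℕ) : Module.End ℂ Fock := shift (rootSeq i) (fockCoeffF q i)

/-- The normalization of the operators representing the `e_α`. -/
def fockScale (i : ℕ) : ℂ := if i = 0 then κ else 1

/-- The coefficients of the operators representing the `e_α`. -/
def fockCoeffE (i : ℕ) (m : ℕ → ℤ) : ℂ := fockScale κ i * qInt q (m i)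

/-- The operators representing the `e_α`. -/
def fockE (i : ℕ) : Module.End ℂ Fock := shift (-rootSeq i) (fockCoeffE q κ i)

/-- The eigenvalues of the operators representing the `q^{h_α}`. -/
def fockWeight (i : ℕ) (m : ℕ → ℤ) : ℂˣ := (if i = 0 then s else 1) * q ^ (-rootInner i m)

/-- The operators representing the `q^{h_α}`. -/
def fockK (i : ℕ) : Module.End ℂ Fock := shift 0 fun m => (fockWeight q s i m : ℂ)

/-- The operators representing the `q^{-h_α}`. -/
def fockKInv (i : ℕ) : Module.End ℂ Fock := shift 0 fun m => ((fockWeight q s i m)⁻¹ : ℂˣ)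

variable {q s κ}

/-- At `i = 0` this is more than the quantum group demands: it says that `f_δ` acts by zero, which
is why the map from `M_λ` is well defined. -/
theorem fockF_serre_up (i : ℕ) :
    qComm (q : ℂ)⁻¹ (fockF q i) (qComm (q : ℂ) (fockF q i) (fockF q (i + 1))) = 0 := by
  refine shift_serre q.ne_zero fun m => ?_
  have h := qInt_recurrence q (m i)
  cases i with
  | zero =>
    simp [fockCoeffF, rootSeq, add_assoc]
    linear_combination h
  | succ i =>
    simp [fockCoeffF, rootSeq, add_assoc, sub_eq_add_neg] at h ⊢
    linear_combination (qInt q (m i) * qInt q (m i + -1)) * h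

theorem fockF_serre_down (i : ℕ) :
    qComm (q : ℂ)⁻¹ (fockF q (i + 1)) (qComm (q : ℂ) (fockF q (i + 1)) (fockF q i)) = 0 := by
  refine shift_serre q.ne_zero fun m => ?_
  have h := qInt_recurrence q (m i - 1)
  cases i with
  | zero =>
    simp [fockCoeffF, rootSeq, add_assoc, sub_eq_add_neg] at h ⊢
    linear_combination qInt q (m 0) * h
  | succ i =>
    simp [fockCoeffF, rootSeq, add_assoc, sub_eq_add_neg] at h ⊢
    linear_combination (qInt q (m i) * qInt q (m (i + 1))) * h

theorem fockE_serre_up (i : ℕ) :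
    qComm (q : ℂ)⁻¹ (fockE q κ i) (qComm (q : ℂ) (fockE q κ i) (fockE q κ (i + 1))) = 0 := by
  refine shift_serre q.ne_zero fun m => ?_
  have h := qInt_recurrence q (m i - 1)
  simp [fockCoeffE, rootSeq, add_assoc, sub_eq_add_neg] at h ⊢
  linear_combination (fockScale κ i ^ 2 * fockScale κ (i + 1) * qInt q (m i) * qInt q (m (i + 1))) * h

theorem fockE_serre_down (i : ℕ) :
    qComm (q : ℂ)⁻¹ (fockE q κ (i + 1)) (qComm (q : ℂ) (fockE q κ (i + 1)) (fockE q κ i)) = 0 := by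
  refine shift_serre q.ne_zero fun m => ?_
  have h := qInt_recurrence q (m i)
  simp [fockCoeffE, rootSeq, add_assoc, sub_eq_add_neg] at h ⊢
  linear_combination (fockScale κ (i + 1) ^ 2 * fockScale κ i * qInt q (m (i + 1)) * qInt q (m (i + 1) + -1)) * h

theorem fockF_comm {i j : ℕ} (h : i + 2 ≤ j ∨ j + 2 ≤ i) :
    fockF q i * fockF q j = fockF q j * fockF q i := by
  rw [fockF, fockF, shift_mul, shift_mul]
  refine shift_ext (add_comm _ _) fun m => ?_
  have h1 : fockCoeffF q i (m + rootSeq j) = fockCoeffF q i m := by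
    cases i with
    | zero => rfl
    | succ i =>
      simp only [fockCoeffF, Pi.add_apply, rootSeq]
      rw [if_neg (by omega), if_neg (by omega), sub_zero, add_zero]
  have h2 : fockCoeffF q j (m + rootSeq i) = fockCoeffF q j m := by
    cases j with
    | zero => rfl
    | succ j =>
      simp only [fockCoeffF, Pi.add_apply, rootSeq]
      rw [if_neg (by omega), if_neg (by omega), sub_zero, add_zero]
  rw [h1, h2, mul_comm]

theorem fockE_comm {i j : ℕ} (h : i + 2 ≤ j ∨ j + 2 ≤ i) :
    fockE q κ i * fockE q κ j = fockE q κ j * fockE q κ i := by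
  rw [fockE, fockE, shift_mul, shift_mul]
  refine shift_ext (add_comm _ _) fun m => ?_
  have h1 {i j : ℕ} (h : i + 2 ≤ j ∨ j + 2 ≤ i) :
      fockCoeffE q κ i (m + -rootSeq j) = fockCoeffE q κ i m := by
    simp only [fockCoeffE, Pi.add_apply, Pi.neg_apply, rootSeq]
    rw [if_neg (by omega : ¬ i = j), if_neg (by omega : ¬ i + 1 = j), sub_zero, neg_zero, add_zero]
  rw [h1 h, h1 h.symm, mul_comm]

theorem fockE_fockF_comm {i j : ℕ} (h : i ≠ j) :
    fockE q κ i * fockF q j - fockF q j * fockE q κ i = 0 := by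
  rw [fockE, fockF, shift_mul, shift_mul, add_comm (rootSeq j), shift_sub_shift]
  refine shift_eq_zero fun m => sub_eq_zero.mpr ?_
  cases j with
  | zero =>
    simp only [fockCoeffE, fockCoeffF, Pi.add_apply, Pi.neg_apply, rootSeq]
    rw [if_neg h, if_neg (by omega)]
    simp
  | succ j =>
    simp only [fockCoeffE, fockCoeffF, Pi.add_apply, Pi.neg_apply, rootSeq]
    by_cases h2 : i = j
    · subst h2
      simp
      ring_nf
    · rw [if_neg h, if_neg (by omega : ¬ i + 1 = j + 1), if_neg (by omega : ¬ j = i),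
        if_neg (by omega : ¬ j + 1 = i)]
      simp
      ring

/-- Only the short simple root sees `s` and `κ`; the hypothesis on `κ` is its commutation relation
on `x^m`. -/
theorem fockE_fockF_self (hd : (q : ℂ) - (q : ℂ)⁻¹ ≠ 0)
    (hκ : ∀ m : ℤ, κ * qInt q (m + 1) - κ * qInt q m =
      ((q : ℂ) - (q : ℂ)⁻¹)⁻¹ * (s * (q : ℂ) ^ (-m) - (s : ℂ)⁻¹ * (q : ℂ) ^ m)) (i : ℕ) :
    fockE q κ i * fockF q i - fockF q i * fockE q κ i =
      ((q : ℂ) - (q : ℂ)⁻¹)⁻¹ • (fockK q s i - fockKInv q s i) := by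
  rw [fockE, fockF, shift_mul, shift_mul, fockK, fockKInv, shift_sub_shift, smul_shift,
    add_neg_cancel, neg_add_cancel, shift_sub_shift]
  refine shift_ext rfl fun m => ?_
  cases i with
  | zero =>
    simp [fockCoeffE, fockScale, fockCoeffF, rootSeq, fockWeight, rootInner]
    rw [hκ]
    simp [mul_comm]
  | succ i =>
    have h := qInt_mul_sub q hd (m i) (m (i + 1))
    simp [fockCoeffE, fockScale, fockCoeffF, rootSeq, fockWeight, rootInner]
    rw [h, qInt]
    rw [div_eq_inv_mul, zpow_neg]

theorem fockK_conj {v : ℕ → ℤ} {c : (ℕ → ℤ) → ℂ} (i : ℕ) :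
    fockK q s i * shift v c * fockKInv q s i = ((q ^ (-rootInner i v) : ℂˣ) : ℂ) • shift v c := by
  rw [fockK, fockKInv, shift_mul, shift_mul, smul_shift]
  refine shift_ext (by simp) fun m => ?_
  have h : fockWeight q s i (m + v) = q ^ (-rootInner i v) * fockWeight q s i m := by
    rw [fockWeight, fockWeight, rootInner_add, neg_add, zpow_add, mul_comm (q ^ _) (q ^ _)]
    exact mul_left_comm _ _ _
  simp only [add_zero, h, Units.val_mul]
  have := Units.inv_mul (fockWeight q s i m)
  linear_combination (c m * ((q ^ (-rootInner i v) : ℂˣ) : ℂ)) * this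

end Fock

/-! ### The Fock operators satisfy the relations of the quantum group. -/

section FockSatisfies

variable {n : ℕ} {q p s : ℂˣ}

theorem adjacent_of_serre_pairing {i j : Fin n} (h : 2 * pairing i j = -pairing i i) :
    (∃ k, (i : ℕ) = k + 1 ∧ (j : ℕ) = k) ∨ (j : ℕ) = i + 1 := by
  rw [pairing_eq, pairing_eq] at h
  rcases i with ⟨_ | i, hi⟩
  · have e : rootInner 0 (rootSeq 0) = 1 := by decide
    change 2 * rootInner 0 (rootSeq j) = -rootInner 0 (rootSeq 0) at h
    omega
  · by_cases h1 : (j : ℕ) = i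
    · exact Or.inl ⟨i, rfl, h1⟩
    · right
      simp only [rootInner, rootSeq] at h ⊢
      split_ifs at h <;> omega

theorem distant_of_pairing_eq_zero {i j : Fin n} (h : pairing i j = 0) :
    (i : ℕ) + 2 ≤ j ∨ (j : ℕ) + 2 ≤ i := by
  rw [pairing_eq] at h
  rcases i with ⟨_ | i, hi⟩ <;> simp only [rootInner, rootSeq] at h ⊢ <;>
    split_ifs at h <;> omega

theorem deltaVec_eq_zero {A : Type*} [Ring A] [Algebra ℂ A] (g : ℕ → A)
    (h : qComm (q : ℂ)⁻¹ (g 0) (qComm (q : ℂ) (g 0) (g 1)) = 0) :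
    deltaVec q (fun i : Fin n => g i) = 0 := by
  rw [deltaVec, Units.val_inv_eq_inv_val]
  by_cases hn : 1 < n
  · rwa [extZero_of_lt _ hn, extZero_of_lt _ (by omega : 0 < n)]
  · rw [extZero_of_le _ (not_lt.mp hn), qComm_zero_right, qComm_zero_right]

/-- The normalization constant of the Fock representation. -/
def fockConst (p s : ℂˣ) : ℂ := s * p / ((p : ℂ) - (p : ℂ)⁻¹)

theorem sub_inv_ne_zero (hq : ∀ k : ℕ, 0 < k → q ^ k ≠ 1) : (q : ℂ) - (q : ℂ)⁻¹ ≠ 0 := by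
  intro h
  rw [sub_eq_zero, ← Units.val_inv_eq_inv_val] at h
  refine hq 2 two_pos ?_
  rw [pow_two]
  nth_rw 1 [Units.ext h]
  rw [inv_mul_cancel]

theorem not_root_of_unity_sqrt (hq : ∀ k : ℕ, 0 < k → q ^ k ≠ 1) (hp : p ^ 2 = q) (k : ℕ)
    (hk : 0 < k) : p ^ k ≠ 1 := by
  intro h
  refine hq k hk ?_
  rw [← hp, ← pow_mul, mul_comm, pow_mul, h, one_pow]

theorem fockConst_ne_zero (hq : ∀ k : ℕ, 0 < k → q ^ k ≠ 1) (hp : p ^ 2 = q) :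
    fockConst p s ≠ 0 :=
  div_ne_zero (mul_ne_zero s.ne_zero p.ne_zero) (sub_inv_ne_zero (not_root_of_unity_sqrt hq hp))

/-- From `s⁻¹ = -q s` the right side is proportional to `q^{-m} + q^{m+1}`, and so is `[m+1] - [m]`.
The ratio is independent of `m` and equals `s p / (p - p⁻¹)`. -/
theorem fockConst_spec (hq : ∀ k : ℕ, 0 < k → q ^ k ≠ 1) (hp : p ^ 2 = q) (hs : s ^ 2 = -q⁻¹)
    (m : ℤ) : fockConst p s * qInt q (m + 1) - fockConst p s * qInt q m =
      ((q : ℂ) - (q : ℂ)⁻¹)⁻¹ * (s * (q : ℂ) ^ (-m) - (s : ℂ)⁻¹ * (q : ℂ) ^ m) := by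
  have hd := sub_inv_ne_zero hq
  have hd' := sub_inv_ne_zero (not_root_of_unity_sqrt hq hp)
  have hq0 : (q : ℂ) ≠ 0 := q.ne_zero
  have hp0 : (p : ℂ) ≠ 0 := p.ne_zero
  have hs0 : (s : ℂ) ≠ 0 := s.ne_zero
  have hpq : (q : ℂ) = (p : ℂ) ^ 2 := by rw [← hp]; rfl
  have hsq : (s : ℂ)⁻¹ = -(q * s) := by
    have : (s : ℂ) ^ 2 = -(q : ℂ)⁻¹ := by
      have := congrArg Units.val hs
      simpa using this
    field_simp at this ⊢
    linear_combination this
  rw [hsq, fockConst]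
  simp only [qInt, neg_add, zpow_add₀ hq0, zpow_neg, zpow_one]
  have hm := zpow_ne_zero m hq0
  generalize (q : ℂ) ^ m = x at *
  rw [hpq] at hd ⊢
  have h1 : (p : ℂ) ^ 2 - 1 ≠ 0 := by
    intro h; apply hd'; field_simp; linear_combination h
  have h2 : ((p : ℂ) ^ 2) ^ 2 - 1 ≠ 0 := by
    intro h; apply hd; field_simp; linear_combination h
  have e1 : (p : ℂ) - (p : ℂ)⁻¹ = (p ^ 2 - 1) / p := by field_simp
  have e2 : (p : ℂ) ^ 2 - ((p : ℂ) ^ 2)⁻¹ = ((p ^ 2) ^ 2 - 1) / p ^ 2 := by field_simp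
  rw [e1, e2]
  field_simp
  ring

theorem fock_satisfies (hq : ∀ k : ℕ, 0 < k → q ^ k ≠ 1) (hp : p ^ 2 = q) (hs : s ^ 2 = -q⁻¹) :
    Satisfies n q (fun i => fockE q (fockConst p s) i) (fun i => fockF q i)
      (fun i => fockK q s i) (fun i => fockKInv q s i) where
  k_kInv i := by
    rw [fockK, fockKInv, shift_mul, ← shift_zero_one]
    exact shift_ext (add_zero _) fun m => by simp
  kInv_k i := by
    rw [fockK, fockKInv, shift_mul, ← shift_zero_one]
    exact shift_ext (add_zero _) fun m => by simp
  k_comm i j := by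
    rw [fockK, fockK, shift_mul, shift_mul]
    exact shift_ext rfl fun m => by simp [mul_comm]
  k_e i j := by
    have h : rootInner i (-rootSeq j) = -rootInner i (rootSeq j) := by
      rw [← zero_sub (rootSeq j), rootInner_sub]
      cases (i : ℕ) <;> simp [rootInner]
    rw [fockE, fockK_conj, pairing_eq, h, neg_neg]
  k_f i j := by rw [fockF, fockK_conj, pairing_eq]
  e_f_same i := by
    rw [Units.val_inv_eq_inv_val]
    exact fockE_fockF_self (sub_inv_ne_zero hq) (fockConst_spec hq hp hs) i
  e_f_diff i j h := fockE_fockF_comm fun h' => h (Fin.ext h')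
  serre_e i j h := by
    rw [Units.val_inv_eq_inv_val]
    rcases adjacent_of_serre_pairing h with ⟨k, h1, h2⟩ | h
    · rw [h1, h2]; exact fockE_serre_down k
    · rw [h]; exact fockE_serre_up i
  serre_f i j h := by
    rw [Units.val_inv_eq_inv_val]
    rcases adjacent_of_serre_pairing h with ⟨k, h1, h2⟩ | h
    · rw [h1, h2]; exact fockF_serre_down k
    · rw [h]; exact fockF_serre_up i
  delta_e := by
    rw [deltaVec_eq_zero _ (fockE_serre_up 0), mul_zero, zero_mul]
    exact sub_self _
  delta_f := by
    rw [deltaVec_eq_zero _ (fockF_serre_up 0), mul_zero, zero_mul]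
    exact sub_self _
  e_comm i j h := fockE_comm (distant_of_pairing_eq_zero h)
  f_comm i j h := fockF_comm (distant_of_pairing_eq_zero h)

end FockSatisfies

/-! ### Composite root vectors in the Fock representation -/

section FockRoots

variable {n : ℕ} {q : ℂˣ}

/-- `m_0 + ⋯ + m_{k-1}` -/
def partialSum (k : ℕ) (m : ℕ → ℤ) : ℤ := ∑ j ∈ Finset.range k, m j

theorem partialSum_add_rootSeq (k : ℕ) (m : ℕ → ℤ) :
    partialSum k (m + rootSeq (k + 1)) = partialSum k m := by
  refine Finset.sum_congr rfl fun j hj => ?_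
  rw [Finset.mem_range] at hj
  simp only [Pi.add_apply, rootSeq]
  rw [if_neg (by omega), if_neg (by omega), sub_zero, add_zero]

theorem single_add_rootSeq (k : ℕ) :
    (Pi.single k 1 : ℕ → ℤ) + rootSeq (k + 1) = Pi.single (k + 1) 1 := by
  funext j
  simp only [Pi.add_apply, rootSeq, Pi.single_apply, Nat.succ_inj]
  ring

theorem qInt_succ_sub (hd : (q : ℂ) - (q : ℂ)⁻¹ ≠ 0) (m : ℤ) :
    qInt q (m + 1) - (q : ℂ)⁻¹ * qInt q m = (q : ℂ) ^ m := by
  have hq0 : (q : ℂ) ≠ 0 := q.ne_zero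
  simp only [qInt, neg_add, zpow_add₀ hq0, zpow_neg, zpow_one]
  have hm := zpow_ne_zero m hq0
  generalize (q : ℂ) ^ m = x at *
  rw [← mul_div_assoc, ← sub_div, div_eq_iff hd]
  field_simp
  ring

theorem qInt_sub_succ (hd : (q : ℂ) - (q : ℂ)⁻¹ ≠ 0) (m : ℤ) :
    qInt q m - (q : ℂ)⁻¹ * qInt q (m + 1) = -(q : ℂ)⁻¹ * (q : ℂ) ^ (-m) := by
  have hq0 : (q : ℂ) ≠ 0 := q.ne_zero
  simp only [qInt, neg_add, zpow_add₀ hq0, zpow_neg, zpow_one]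
  have hm := zpow_ne_zero m hq0
  generalize (q : ℂ) ^ m = x at *
  rw [← mul_div_assoc, ← sub_div, div_eq_iff hd]
  field_simp
  ring

/-- Each bracket with `f_{α_{k+2}}` contributes the factor `[m_k] - q⁻¹ [m_k + 1] = -q⁻¹ q^{-m_k}`,
with zero-based `k`. -/
theorem rootVecF_fock (hd : (q : ℂ) - (q : ℂ)⁻¹ ≠ 0) {k : ℕ} (hk : k < n) :
    rootVecF q (fun i : Fin n => fockF q i) k =
      shift (Pi.single k 1) fun m => (-(q : ℂ)⁻¹) ^ k * (q : ℂ) ^ (-partialSum k m) := by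
  induction k with
  | zero =>
    rw [rootVecF, extZero_of_lt _ hk, fockF]
    refine shift_ext ?_ fun m => by simp [fockCoeffF, partialSum]
    funext j
    simp [rootSeq, Pi.single_apply]
  | succ k ih =>
    rw [rootVecF, ih (by omega), extZero_of_lt _ hk, fockF, shift_qComm]
    refine shift_ext (single_add_rootSeq k) fun m => ?_
    have h := qInt_sub_succ hd (m k)
    rw [partialSum_add_rootSeq]
    simp only [fockCoeffF, Pi.add_apply, Pi.single_eq_same, Units.val_inv_eq_inv_val]
    have e : (q : ℂ) ^ (-partialSum (k + 1) m) =
        (q : ℂ) ^ (-partialSum k m) * (q : ℂ) ^ (-m k) := by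
      rw [← zpow_add₀ q.ne_zero, partialSum, Finset.sum_range_succ, neg_add]
      rfl
    rw [e]
    linear_combination ((-(q : ℂ)⁻¹) ^ k * (q : ℂ) ^ (-partialSum k m)) * h

/-- The operators `fockF` appear here because they represent the `e_α` on `N_λ`. In this order of
brackets the factor is `[m_k + 1] - q⁻¹ [m_k] = q^{m_k}`. -/
theorem rootVecE_fock (hd : (q : ℂ) - (q : ℂ)⁻¹ ≠ 0) {k : ℕ} (hk : k < n) :
    rootVecE q (fun i : Fin n => fockF q i) k =
      shift (Pi.single k 1) fun m => (q : ℂ) ^ partialSum k m := by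
  induction k with
  | zero =>
    rw [rootVecE, extZero_of_lt _ hk, fockF]
    refine shift_ext ?_ fun m => by simp [fockCoeffF, partialSum]
    funext j
    simp [rootSeq, Pi.single_apply]
  | succ k ih =>
    rw [rootVecE, ih (by omega), extZero_of_lt _ hk, fockF, shift_qComm, add_comm]
    refine shift_ext (single_add_rootSeq k) fun m => ?_
    have h := qInt_succ_sub hd (m k)
    rw [partialSum_add_rootSeq]
    simp only [fockCoeffF, Pi.add_apply, Pi.single_eq_same, Units.val_inv_eq_inv_val]
    have e : (q : ℂ) ^ (partialSum (k + 1) m) = (q : ℂ) ^ (partialSum k m) * (q : ℂ) ^ m k := by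
      rw [← zpow_add₀ q.ne_zero, partialSum, Finset.sum_range_succ]
      rfl
    rw [e]
    linear_combination ((q : ℂ) ^ (partialSum k m)) * h

/-- A multi-index, viewed as a sequence supported in `[r, r + n)`. -/
def embedFrom (r : ℕ) (m : Fin n → ℕ) : ℕ → ℤ := ∑ i : Fin n, Pi.single (r + i) (m i : ℤ)

theorem embedFrom_of_lt {r j : ℕ} (m : Fin n → ℕ) (h : j < r) : embedFrom r m j = 0 := by
  rw [embedFrom, Finset.sum_apply]
  refine Finset.sum_eq_zero fun i _ => ?_
  rw [Pi.single_apply, if_neg (by omega)]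

theorem shift_pow_single {r : ℕ} {c : (ℕ → ℤ) → ℂ} {b : ℂ} {v : ℕ → ℤ}
    (hc : ∀ k : ℕ, c (v + Pi.single r (k : ℤ)) = b) (k : ℕ) (a : ℂ) :
    (shift (Pi.single r 1) c ^ k) (Finsupp.single v a) =
      Finsupp.single (v + Pi.single r (k : ℤ)) (a * b ^ k) := by
  induction k with
  | zero => simp
  | succ k ih =>
    rw [pow_succ', Module.End.mul_apply, ih, shift_single, hc, add_assoc, ← Pi.single_add,
      pow_succ, mul_assoc]
    simp

/-- The rightmost factors act first, so when `x i` acts the exponents below `r + i` are still zero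
and its coefficient is the constant `b i`. The offset `r` serves the induction, which strips the
leftmost variable. -/
theorem monomial_shift (r : ℕ) (x : ℕ → Module.End ℂ Fock) (c : ℕ → (ℕ → ℤ) → ℂ) (b : ℕ → ℂ)
    (hx : ∀ i < n, x i = shift (Pi.single (r + i) 1) (c i))
    (hc : ∀ i m, (∀ j < r + i, m j = 0) → c i m = b i) (m : Fin n → ℕ) :
    monomial x m (Finsupp.single 0 1) =
      Finsupp.single (embedFrom r m) (∏ i : Fin n, b i ^ m i) := by
  induction n generalizing r x c b with
  | zero => simp [monomial, embedFrom]
  | succ n ih =>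
    have h := ih (r + 1) (fun i => x (i + 1)) (fun i => c (i + 1)) (fun i => b (i + 1))
      (fun i hi => by rw [hx _ (by omega), add_assoc, add_comm 1]) (fun i m hm => hc _ _
      (fun j hj => hm j (by omega))) (fun i => m i.succ)
    rw [monomial_succ, Module.End.mul_apply, h, hx 0 (by omega), add_zero,
      shift_pow_single (b := b 0)]
    · rw [Fin.prod_univ_succ, mul_comm]
      congr 1
      rw [embedFrom, embedFrom, Fin.sum_univ_succ, add_comm]
      congr 1
      refine Finset.sum_congr rfl fun i _ => ?_
      rw [Fin.val_succ]
      congr 1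
      omega
    · intro k
      refine hc 0 _ fun j hj => ?_
      rw [Pi.add_apply, embedFrom_of_lt _ (by omega), Pi.single_apply, if_neg (by omega), add_zero]

/-- A multi-index, viewed as a sequence of integers. -/
def embed (m : Fin n → ℕ) : ℕ → ℤ := embedFrom 0 m

theorem embed_apply (m : Fin n → ℕ) (i : Fin n) : embed m i = m i := by
  rw [embed, embedFrom, Finset.sum_apply, Finset.sum_eq_single i]
  · simp
  · intro j _ hj
    rw [Pi.single_apply, if_neg]
    intro h
    exact hj (Fin.ext (by omega))
  · simp

theorem embed_apply_of_lt (m : Fin n → ℕ) {i : ℕ} (hi : i < n) : embed m i = m ⟨i, hi⟩ :=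
  embed_apply m ⟨i, hi⟩

theorem embed_injective : Function.Injective (embed : (Fin n → ℕ) → ℕ → ℤ) := by
  intro m m' h
  funext i
  have := congrFun h i
  rw [embed_apply, embed_apply] at this
  exact_mod_cast this

theorem embed_zero : embed (0 : Fin n → ℕ) = 0 := by simp [embed, embedFrom]

theorem monomial_rootVecF_fock (hd : (q : ℂ) - (q : ℂ)⁻¹ ≠ 0) (m : Fin n → ℕ) :
    monomial (rootVecF q fun i : Fin n => fockF q i) m (Finsupp.single 0 1) =
      Finsupp.single (embed m) (∏ i : Fin n, ((-(q : ℂ)⁻¹) ^ (i : ℕ)) ^ m i) := by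
  refine monomial_shift 0 _ (fun k m => (-(q : ℂ)⁻¹) ^ k * (q : ℂ) ^ (-partialSum k m)) _
    (fun i hi => by rw [rootVecF_fock hd hi, zero_add]) (fun i m hm => ?_) m
  rw [partialSum, Finset.sum_eq_zero fun j hj => hm j (by simpa using hj)]
  simp

theorem monomial_rootVecE_fock (hd : (q : ℂ) - (q : ℂ)⁻¹ ≠ 0) (m : Fin n → ℕ) :
    monomial (rootVecE q fun i : Fin n => fockF q i) m (Finsupp.single 0 1) =
      Finsupp.single (embed m) 1 := by
  refine (monomial_shift 0 _ (fun k m => (q : ℂ) ^ partialSum k m) (fun _ => 1)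
    (fun i hi => by rw [rootVecE_fock hd hi, zero_add]) (fun i m hm => ?_) m).trans (by simp [embed])
  rw [partialSum, Finset.sum_eq_zero fun j hj => hm j (by simpa using hj)]
  simp

end FockRoots

/-! ### Induction on the quantum group -/

section Induction

variable {n : ℕ} {q : ℂˣ}

theorem Uq.induction {P : Uq n q → Prop} (hc : ∀ c : ℂ, P (algebraMap ℂ _ c))
    (he : ∀ i, P (E q i)) (hf : ∀ i, P (F q i)) (hk : ∀ i, P (K q i)) (hk' : ∀ i, P (KInv q i))
    (hmul : ∀ x y, P x → P y → P (x * y)) (hadd : ∀ x y, P x → P y → P (x + y)) (x : Uq n q) :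
    P x := by
  obtain ⟨x, rfl⟩ : ∃ y, Uq.mk n q y = x := RingQuot.mkAlgHom_surjective ℂ (Rel n q) x
  induction x using FreeAlgebra.induction with
  | grade0 c => rw [AlgHom.commutes]; exact hc c
  | grade1 g =>
    cases g with
    | e i => exact he i
    | f i => exact hf i
    | k i => exact hk i
    | kInv i => exact hk' i
  | mul x y hx hy => rw [map_mul]; exact hmul _ _ hx hy
  | add x y hx hy => rw [map_add]; exact hadd _ _ hx hy

theorem Uq.smul_mem {W : Type*} [AddCommGroup W] [Module ℂ W] [Module (Uq n q) W]
    [IsScalarTower ℂ (Uq n q) W] {Q : Submodule ℂ W} (he : ∀ i : Fin n, ∀ w ∈ Q, E q i • w ∈ Q)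
    (hf : ∀ i : Fin n, ∀ w ∈ Q, F q i • w ∈ Q) (hk : ∀ i : Fin n, ∀ w ∈ Q, K q i • w ∈ Q)
    (hk' : ∀ i : Fin n, ∀ w ∈ Q, KInv q i • w ∈ Q) (x : Uq n q) : ∀ w ∈ Q, x • w ∈ Q := by
  induction x using Uq.induction with
  | hc c => intro w hw; rw [algebraMap_smul]; exact Q.smul_mem c hw
  | he i => exact he i
  | hf i => exact hf i
  | hk i => exact hk i
  | hk' i => exact hk' i
  | hmul x y hx hy => intro w hw; rw [mul_smul]; exact hx _ (hy _ hw)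
  | hadd x y hx hy => intro w hw; rw [add_smul]; exact Q.add_mem (hx _ hw) (hy _ hw)

/-- The universal property of the twofold quotient defining `M_λ` and `N_λ`, for a target given by a
representation `ρ` instead of a module instance. -/
theorem exists_linearMap_of_quotient {R : Type*} [Ring R] [Algebra ℂ R] {V : Type*}
    [AddCommGroup V] [Module ℂ V] (S : Set R) (d : R) (ρ : R →ₐ[ℂ] Module.End ℂ V) (v₀ : V)
    (hS : ∀ x ∈ S, ρ x v₀ = 0) (hd : ρ d v₀ = 0) :
    ∃ Φ : ((R ⧸ Submodule.span R S) ⧸ Submodule.span R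
        {d • (Submodule.Quotient.mk 1 : R ⧸ Submodule.span R S)}) →ₗ[ℂ] V,
      (∀ x w, Φ (x • w) = ρ x (Φ w)) ∧
        Φ (Submodule.Quotient.mk (Submodule.Quotient.mk 1)) = v₀ := by
  let _ : Module R V := Module.compHom V ρ.toRingHom
  have hsmul (x : R) (v : V) : x • v = ρ x v := rfl
  have h1 : Submodule.span R S ≤ LinearMap.ker (LinearMap.toSpanSingleton R V v₀) :=
    Submodule.span_le.mpr fun x hx => hS x hx
  have h2 : Submodule.span R {d • (Submodule.Quotient.mk 1 : R ⧸ Submodule.span R S)} ≤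
      LinearMap.ker (Submodule.liftQ _ (LinearMap.toSpanSingleton R V v₀) h1) := by
    rw [Submodule.span_le, Set.singleton_subset_iff, SetLike.mem_coe, LinearMap.mem_ker, map_smul,
      Submodule.liftQ_apply, LinearMap.toSpanSingleton_apply, one_smul, hsmul, hd]
  let Ψ := Submodule.liftQ _ (Submodule.liftQ _ (LinearMap.toSpanSingleton R V v₀) h1) h2
  refine ⟨{ toFun := Ψ, map_add' := map_add Ψ, map_smul' := fun c w => ?_ }, fun x w => ?_, ?_⟩
  · rw [← algebraMap_smul R c w, map_smul, hsmul, AlgHom.commutes]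
    rfl
  · exact map_smul Ψ x w
  · exact one_smul R v₀

end Induction

/-! ### Modules isomorphic to the Fock representation -/

section Model

variable {n : ℕ} {q s : ℂˣ} {κ : ℂ} {W : Type*} [AddCommGroup W] [Module ℂ W] [Module (Uq n q) W]
  [IsScalarTower ℂ (Uq n q) W]

/-- A cyclic module over the quantum group satisfying the defining relations of `M_λ`, for the
generators `e`, `f`, `k`, `k'`, together with an equivariant map to the Fock representation. -/
structure IsFockModel (κ : ℂ) (s : ℂˣ) (e f k k' : Fin n → Uq n q)
    (ρ : Uq n q →ₐ[ℂ] Module.End ℂ Fock) (w₀ : W) (Φ : W →ₗ[ℂ] Fock) : Prop where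
  satisfies : Satisfies n q e f k k'
  closure : ∀ Q : Submodule ℂ W, (∀ i, ∀ w ∈ Q, e i • w ∈ Q) → (∀ i, ∀ w ∈ Q, f i • w ∈ Q) →
    (∀ i, ∀ w ∈ Q, k i • w ∈ Q) → (∀ i, ∀ w ∈ Q, k' i • w ∈ Q) →
    ∀ x : Uq n q, ∀ w ∈ Q, x • w ∈ Q
  map_e : ∀ i, ρ (e i) = fockE q κ i
  map_f : ∀ i, ρ (f i) = fockF q i
  map_k : ∀ i, ρ (k i) = fockK q s i
  map_kInv : ∀ i, ρ (k' i) = fockKInv q s i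
  generates : ∀ w, ∃ x : Uq n q, x • w₀ = w
  e_smul : ∀ i, e i • w₀ = 0
  f_smul : ∀ i : Fin n, 0 < (i : ℕ) → f i • w₀ = 0
  k_smul : ∀ i, ∃ c : ℂ, k i • w₀ = c • w₀
  kInv_smul : ∀ i, ∃ c : ℂ, k' i • w₀ = c • w₀
  delta_smul : deltaVec q f • w₀ = 0
  map_smul : ∀ (x : Uq n q) w, Φ (x • w) = ρ x (Φ w)
  map_gen : Φ w₀ = Finsupp.single 0 1

theorem map_rootVecF {A B : Type*} [Ring A] [Algebra ℂ A] [Ring B] [Algebra ℂ B] (φ : A →ₐ[ℂ] B)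
    (f : Fin n → A) (i : ℕ) : φ (rootVecF q f i) = rootVecF q (fun i => φ (f i)) i := by
  induction i with
  | zero => exact map_extZero φ f 0
  | succ i ih => rw [rootVecF, rootVecF, map_qComm, ih, map_extZero]

theorem map_rootVecE {A B : Type*} [Ring A] [Algebra ℂ A] [Ring B] [Algebra ℂ B] (φ : A →ₐ[ℂ] B)
    (f : Fin n → A) (i : ℕ) : φ (rootVecE q f i) = rootVecE q (fun i => φ (f i)) i := by
  induction i with
  | zero => exact map_extZero φ f 0
  | succ i ih => rw [rootVecE, rootVecE, map_qComm, ih, map_extZero]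

theorem map_monomial {A B : Type*} [Ring A] [Algebra ℂ A] [Ring B] [Algebra ℂ B] (φ : A →ₐ[ℂ] B)
    (x : ℕ → A) (m : Fin n → ℕ) : φ (monomial x m) = monomial (fun i => φ (x i)) m := by
  rw [monomial, monomial, map_list_prod, List.map_ofFn]
  congr 2
  funext i
  simp

/-- The coefficient of `f_{ε_1}^{m_1} ⋯ f_{ε_n}^{m_n} x^0` in the Fock representation. -/
def rootCoeff (q : ℂˣ) (m : Fin n → ℕ) : ℂ := ∏ i : Fin n, ((-(q : ℂ)⁻¹) ^ (i : ℕ)) ^ m i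

theorem rootCoeff_ne_zero (q : ℂˣ) (m : Fin n → ℕ) : rootCoeff q m ≠ 0 :=
  Finset.prod_ne_zero_iff.mpr fun _ _ =>
    pow_ne_zero _ (pow_ne_zero _ (neg_ne_zero.mpr (inv_ne_zero q.ne_zero)))

theorem sq_add_one_ne_zero (hq : ∀ k : ℕ, 0 < k → q ^ k ≠ 1) : (q : ℂ) ^ 2 + 1 ≠ 0 := by
  intro h
  refine hq 4 (by omega) (Units.ext ?_)
  push_cast
  linear_combination ((q : ℂ) ^ 2 - 1) * h

theorem four_sq_add_one_ne_zero (hq : ∀ k : ℕ, 0 < k → q ^ k ≠ 1) :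
    (q : ℂ) ^ 4 + (q : ℂ) ^ 2 + 1 ≠ 0 := by
  intro h
  refine hq 6 (by omega) (Units.ext ?_)
  push_cast
  linear_combination ((q : ℂ) ^ 2 - 1) * h

namespace IsFockModel

variable {e f k k' : Fin n → Uq n q} {ρ : Uq n q →ₐ[ℂ] Module.End ℂ Fock} {w₀ : W}
  {Φ : W →ₗ[ℂ] Fock}

/-- The line through `w₀` is stable under the `e i`, `k i`, `k' i`, so a subspace containing `w₀`
and stable under the `f i` is everything. -/
theorem span_root (H : IsFockModel κ s e f k k' ρ w₀ Φ) (hq : ∀ k : ℕ, 0 < k → q ^ k ≠ 1) :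
    Submodule.span ℂ (Set.range fun m : Fin n → ℕ => monomial (rootVecF q f) m • w₀) = ⊤ := by
  refine H.satisfies.span_monomial (sq_add_one_ne_zero hq) (four_sq_add_one_ne_zero hq)
    (fun p hp hpf => ?_) H.f_smul H.delta_smul
  have hk {x : Uq n q} (h : ∃ c : ℂ, x • w₀ = c • w₀) :
      ∀ w ∈ Submodule.span ℂ {w₀}, x • w ∈ Submodule.span ℂ {w₀} := by
    intro w hw
    obtain ⟨b, rfl⟩ := Submodule.mem_span_singleton.mp hw
    obtain ⟨c, hc⟩ := h
    rw [smul_comm, hc]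
    exact Submodule.smul_mem _ _ (Submodule.smul_mem _ _ (Submodule.mem_span_singleton_self _))
  refine H.satisfies.eq_top_of_stable (C := Submodule.span ℂ {w₀})
    (fun i => hk ⟨0, by rw [H.e_smul, zero_smul]⟩) (fun i => hk (H.k_smul i))
    (fun i => hk (H.kInv_smul i)) (fun Q hQ h1 h2 h3 h4 => ?_)
    ((Submodule.span_singleton_le_iff_mem _ _).mpr hp) hpf
  rw [eq_top_iff]
  intro w _
  obtain ⟨x, rfl⟩ := H.generates w
  exact H.closure Q h1 h2 h3 h4 x w₀ (hQ (Submodule.mem_span_singleton_self _))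

theorem map_root (H : IsFockModel κ s e f k k' ρ w₀ Φ) (hq : ∀ k : ℕ, 0 < k → q ^ k ≠ 1)
    (m : Fin n → ℕ) :
    Φ (monomial (rootVecF q f) m • w₀) = Finsupp.single (embed m) (rootCoeff q m) := by
  have e := map_monomial (B := Module.End ℂ Fock) ρ (rootVecF q f) m
  rw [H.map_smul, H.map_gen, e, funext (map_rootVecF (B := Module.End ℂ Fock) ρ f), funext H.map_f]
  exact monomial_rootVecF_fock (sub_inv_ne_zero hq) m

/-- Monomials span, and their images are non-zero multiples of distinct `x^m`. Rescaling makes the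
basis match the Fock monomials exactly. -/
theorem exists_basis (H : IsFockModel κ s e f k k' ρ w₀ Φ) (hq : ∀ k : ℕ, 0 < k → q ^ k ≠ 1) :
    ∃ u : Module.Basis (Fin n → ℕ) ℂ W, ∀ m, Φ (u m) = Finsupp.single (embed m) 1 := by
  let u : (Fin n → ℕ) → W := fun m => (rootCoeff q m)⁻¹ • monomial (rootVecF q f) m • w₀
  have hu (m) : Φ (u m) = Finsupp.single (embed m) 1 := by
    rw [_root_.map_smul, H.map_root hq, Finsupp.smul_single, smul_eq_mul,
      inv_mul_cancel₀ (rootCoeff_ne_zero q m)]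
  have hli : LinearIndependent ℂ u := by
    refine LinearIndependent.of_comp Φ ?_
    have : Φ ∘ u = (fun v : ℕ → ℤ => Finsupp.single v (1 : ℂ)) ∘ embed := funext hu
    rw [this]
    exact (Finsupp.linearIndependent_single_one ℂ (ℕ → ℤ)).comp _ embed_injective
  refine ⟨Module.Basis.mk hli ?_, fun m => by rw [Module.Basis.mk_apply, hu]⟩
  rw [← H.span_root hq, Submodule.span_le]
  rintro _ ⟨m, rfl⟩
  have : monomial (rootVecF q f) m • w₀ = rootCoeff q m • u m :=
    (smul_inv_smul₀ (rootCoeff_ne_zero q m) _).symm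
  change monomial (rootVecF q f) m • w₀ ∈ _
  rw [this]
  exact Submodule.smul_mem _ _ (Submodule.subset_span ⟨m, rfl⟩)

end IsFockModel

section Basis

variable {Φ : W →ₗ[ℂ] Fock} {u : Module.Basis (Fin n → ℕ) ℂ W}

theorem fock_apply_embed (hu : ∀ m, Φ (u m) = Finsupp.single (embed m) 1) (w : W)
    (m : Fin n → ℕ) : Φ w (embed m) = u.repr w m := by
  classical
  have : (Finsupp.lapply (embed m)).comp Φ = u.coord m := by
    refine u.ext fun k => ?_
    simp [hu, Finsupp.single_apply, embed_injective.eq_iff]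
  exact LinearMap.congr_fun this w

theorem fock_apply_of_notMem (hu : ∀ m, Φ (u m) = Finsupp.single (embed m) 1) (w : W)
    {v : ℕ → ℤ} (hv : ∀ m : Fin n → ℕ, embed m ≠ v) : Φ w v = 0 := by
  classical
  have : (Finsupp.lapply v).comp Φ = 0 := by
    refine u.ext fun k => ?_
    simp [hu, hv]
  exact LinearMap.congr_fun this w

theorem fock_injective (hu : ∀ m, Φ (u m) = Finsupp.single (embed m) 1) :
    Function.Injective Φ := by
  refine (injective_iff_map_eq_zero Φ).mpr fun w hw => ?_
  refine (map_eq_zero_iff u.repr u.repr.injective).mp (Finsupp.ext fun m => ?_)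
  rw [← fock_apply_embed hu, hw]
  rfl

end Basis

/-- The height of a weight. -/
def height (n : ℕ) (v : ℕ → ℤ) : ℤ := ∑ i ∈ Finset.range n, ((i : ℤ) + 1) * v i

/-- The weights `i + 1` are chosen so that every simple root has height one. -/
theorem height_add_rootSeq {i : ℕ} (hi : i < n) (v : ℕ → ℤ) :
    height n (v + rootSeq i) = height n v + 1 := by
  have h : ∑ j ∈ Finset.range n, ((j : ℤ) + 1) * rootSeq i j = 1 := by
    have e : ∀ j ∈ Finset.range n, ((j : ℤ) + 1) * rootSeq i j =
        (if j = i then (i : ℤ) + 1 else 0) - (if j + 1 = i then (i : ℤ) else 0) := by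
      intro j _
      unfold rootSeq
      split_ifs <;> omega
    rw [Finset.sum_congr rfl e, Finset.sum_sub_distrib, Finset.sum_ite_eq']
    rw [if_pos (Finset.mem_range.mpr hi)]
    cases i with
    | zero => simp
    | succ i =>
      simp only [Nat.succ_inj]
      rw [Finset.sum_ite_eq', if_pos (Finset.mem_range.mpr (by omega))]
      push_cast
      ring
  simp only [height, Pi.add_apply, mul_add, Finset.sum_add_distrib, h]

theorem height_embed_nonneg (m : Fin n → ℕ) : 0 ≤ height n (embed m) := by
  refine Finset.sum_nonneg fun i hi => ?_
  rw [embed_apply_of_lt m (Finset.mem_range.mp hi)]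
  positivity

/-- Applying some `e i` with non-zero result lowers the height, so a non-zero submodule contains a
non-zero vector killed by all `e i`; such a vector is a multiple of the cyclic vector `w₀`. -/
theorem IsFockModel.isSimpleModule {e f k k' : Fin n → Uq n q}
    {ρ : Uq n q →ₐ[ℂ] Module.End ℂ Fock} {w₀ : W} {Φ : W →ₗ[ℂ] Fock}
    (H : IsFockModel κ s e f k k' ρ w₀ Φ) (hq : ∀ k : ℕ, 0 < k → q ^ k ≠ 1) (hκ : κ ≠ 0) :
    IsSimpleModule (Uq n q) W := by
  obtain ⟨u, hu⟩ := H.exists_basis hq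
  have hinj := fock_injective hu
  have hw₀ : w₀ ≠ 0 := by
    intro h
    have := H.map_gen
    rw [h, map_zero] at this
    simpa using DFunLike.congr_fun this 0
  have hE (i : Fin n) (w : W) (v : ℕ → ℤ) :
      Φ (e i • w) v = Φ w (v + rootSeq i) * fockCoeffE q κ i (v + rootSeq i) := by
    rw [H.map_smul, H.map_e, fockE, ← shift_apply_add, add_neg_cancel_right]
  have key (p : Submodule (Uq n q) W) (d : ℕ) : ∀ w ∈ p, w ≠ 0 →
      (∀ v, Φ w v ≠ 0 → height n v < d) → w₀ ∈ p := by
    induction d with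
    | zero =>
      intro w _ hw h
      refine absurd ?_ hw
      refine hinj (Finsupp.ext fun v => ?_)
      rw [map_zero, Finsupp.zero_apply]
      by_contra hv
      have hv' : ∃ m : Fin n → ℕ, embed m = v := by
        by_contra! h
        exact hv (fock_apply_of_notMem hu w h)
      obtain ⟨m, rfl⟩ := hv'
      have := h _ hv
      have := height_embed_nonneg m
      omega
    | succ d ih =>
      intro w hwp hw h
      by_cases hall : ∀ i, e i • w = 0
      -- For `w` killed by all `e i`, an exponent `m` in its support satisfies `[m_i] = 0`, hence
      -- `m_i = 0`, for every `i`.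
      · have hsupp : Φ w = (Φ w 0) • Φ w₀ := by
          refine Finsupp.ext fun v => ?_
          rw [H.map_gen]
          by_cases hv : v = 0
          · simp [hv]
          · rw [Finsupp.smul_apply, Finsupp.single_eq_of_ne hv, smul_zero]
            by_contra hne
            have hv' : ∃ m : Fin n → ℕ, embed m = v := by
              by_contra! h
              exact hne (fock_apply_of_notMem hu w h)
            obtain ⟨m, rfl⟩ := hv'
            refine hv ?_
            have : m = 0 := by
              funext i
              have h0 := hE i w (embed m - rootSeq i)
              rw [hall i, map_zero, Finsupp.zero_apply, sub_add_cancel] at h0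
              have h1 := (mul_eq_zero.mp h0.symm).resolve_left hne
              have h2 := (mul_eq_zero.mp h1).resolve_left
                (by unfold fockScale; split_ifs <;> simp [hκ])
              by_contra hm
              refine qInt_ne_zero hq ?_ h2
              rw [embed_apply]
              exact_mod_cast hm
            rw [this, embed_zero]
        rw [← _root_.map_smul] at hsupp
        have hsupp := hinj hsupp
        have hc : Φ w 0 ≠ 0 := by
          intro h0
          rw [h0, zero_smul] at hsupp
          exact hw hsupp
        have : w₀ = (Φ w 0)⁻¹ • w := by
          conv_rhs => enter [2]; rw [hsupp]
          rw [smul_smul, inv_mul_cancel₀ hc, one_smul]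
        rw [this]
        exact p.smul_of_tower_mem _ hwp
      · push Not at hall
        obtain ⟨i, hi⟩ := hall
        refine ih _ (p.smul_mem _ hwp) hi fun v hv => ?_
        rw [hE] at hv
        have := h _ (left_ne_zero_of_mul hv)
        rw [height_add_rootSeq i.2] at this
        push_cast at this
        omega
  rw [isSimpleModule_iff]
  have : Nontrivial W := ⟨w₀, 0, hw₀⟩
  refine { eq_bot_or_eq_top := fun p => ?_ }
  rw [or_iff_not_imp_left]
  intro hp
  obtain ⟨w, hwp, hw⟩ := p.ne_bot_iff.mp hp
  have hmem : w₀ ∈ p := by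
    obtain ⟨d, hd⟩ : ∃ d : ℕ, ∀ v ∈ (Φ w).support, height n v < d := by
      refine ⟨(Φ w).support.sup (fun v => (height n v).toNat + 1), fun v hv => ?_⟩
      have := Finset.le_sup (f := fun v => (height n v).toNat + 1) hv
      omega
    exact key p d w hwp hw fun v hv => hd v (Finsupp.mem_support_iff.mpr hv)
  rw [eq_top_iff]
  intro v _
  obtain ⟨x, rfl⟩ := H.generates v
  exact p.smul_mem x hmem

end Model

/-! ### `M_λ` and `N_λ` as Fock modules -/

section Instances

variable {n : ℕ} {q s : ℂˣ} {κ : ℂ}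

theorem Satisfies.exists_algHom {A : Type*} [Ring A] [Algebra ℂ A] {e f k k' : Fin n → A}
    (H : Satisfies n q e f k k') : ∃ ρ : Uq n q →ₐ[ℂ] A, (∀ i, ρ (E q i) = e i) ∧
      (∀ i, ρ (F q i) = f i) ∧ (∀ i, ρ (K q i) = k i) ∧ ∀ i, ρ (KInv q i) = k' i := by
  refine ⟨Uq.lift (genImage e f k k') H.lift_eq, fun i => ?_, fun i => ?_, fun i => ?_,
    fun i => ?_⟩ <;>
  · refine (Uq.lift_mk _ _ _).trans ?_
    rw [FreeAlgebra.lift_ι_apply]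
    rfl

theorem fockE_single_zero (i : ℕ) : fockE q κ i (Finsupp.single 0 1) = 0 := by
  simp [fockE, shift_single, fockCoeffE, qInt_zero]

theorem fockF_single_zero {i : ℕ} (hi : 0 < i) : fockF q i (Finsupp.single 0 1) = 0 := by
  obtain ⟨i, rfl⟩ := Nat.exists_eq_succ_of_ne_zero hi.ne'
  simp [fockF, shift_single, fockCoeffF, qInt_zero]

theorem rootInner_zero (i : ℕ) : rootInner i 0 = 0 := by cases i <;> simp [rootInner]

theorem fockWeight_zero (i : Fin n) : fockWeight q s i 0 = weightVal s i := by
  simp [fockWeight, rootInner_zero, weightVal]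

theorem fockK_single (i : ℕ) (v : ℕ → ℤ) :
    fockK q s i (Finsupp.single v 1) = (fockWeight q s i v : ℂ) • Finsupp.single v 1 := by
  simp [fockK, shift_single]

theorem fockKInv_single (i : ℕ) (v : ℕ → ℤ) :
    fockKInv q s i (Finsupp.single v 1) =
      (((fockWeight q s i v)⁻¹ : ℂˣ) : ℂ) • Finsupp.single v 1 := by
  simp [fockKInv, shift_single]

theorem inv_smul_of_smul {A W : Type*} [Ring A] [Algebra ℂ A] [AddCommGroup W] [Module ℂ W]
    [Module A W] [IsScalarTower ℂ A W] {k k' : A} (h : k' * k = 1) {w : W} {c : ℂˣ}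
    (hc : k • w = (c : ℂ) • w) : k' • w = ((c⁻¹ : ℂˣ) : ℂ) • w := by
  have h1 : w = (c : ℂ) • k' • w := by
    rw [smul_comm, ← hc, ← mul_smul, h, one_smul]
  conv_rhs => rw [h1]
  rw [smul_smul, Units.inv_mul, one_smul]

theorem quotient_smul_eq_zero {R : Type*} [Ring R] {S : Set R} {d x : R} (hx : x ∈ S) :
    x • (Submodule.Quotient.mk (Submodule.Quotient.mk 1) : (R ⧸ Submodule.span R S) ⧸
      Submodule.span R {d • (Submodule.Quotient.mk 1 : R ⧸ Submodule.span R S)}) = 0 := by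
  have h : x • (Submodule.Quotient.mk 1 : R ⧸ Submodule.span R S) = 0 := by
    rw [← Submodule.Quotient.mk_smul, smul_eq_mul, mul_one, Submodule.Quotient.mk_eq_zero]
    exact Submodule.subset_span hx
  exact (congrArg Submodule.Quotient.mk h).trans (Submodule.Quotient.mk_zero _)

theorem quotient_generates {R : Type*} [Ring R] {S : Set R} {d : R}
    (w : (R ⧸ Submodule.span R S) ⧸
      Submodule.span R {d • (Submodule.Quotient.mk 1 : R ⧸ Submodule.span R S)}) :
    ∃ x : R, x • (Submodule.Quotient.mk (Submodule.Quotient.mk 1) : (R ⧸ Submodule.span R S) ⧸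
      Submodule.span R {d • (Submodule.Quotient.mk 1 : R ⧸ Submodule.span R S)}) = w := by
  obtain ⟨w, rfl⟩ := Submodule.Quotient.mk_surjective _ w
  obtain ⟨w, rfl⟩ := Submodule.Quotient.mk_surjective _ w
  have h : w • (Submodule.Quotient.mk 1 : R ⧸ Submodule.span R S) = Submodule.Quotient.mk w := by
    rw [← Submodule.Quotient.mk_smul, smul_eq_mul, mul_one]
  exact ⟨w, congrArg Submodule.Quotient.mk h⟩

theorem quotient_delta_smul {R : Type*} [Ring R] {S : Set R} {d : R} :
    d • (Submodule.Quotient.mk (Submodule.Quotient.mk 1) : (R ⧸ Submodule.span R S) ⧸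
      Submodule.span R {d • (Submodule.Quotient.mk 1 : R ⧸ Submodule.span R S)}) = 0 := by
  exact (Submodule.Quotient.mk_eq_zero _).mpr (Submodule.mem_span_singleton_self _)

theorem exists_fockModel_M (ρ : Uq n q →ₐ[ℂ] Module.End ℂ Fock)
    (hE : ∀ i, ρ (E q i) = fockE q κ i) (hF : ∀ i, ρ (F q i) = fockF q i)
    (hK : ∀ i, ρ (K q i) = fockK q s i) (hK' : ∀ i, ρ (KInv q i) = fockKInv q s i) :
    ∃ Φ : M n q s →ₗ[ℂ] Fock, IsFockModel κ s (E q) (F q) (K q) (KInv q) ρ (mGen n q s) Φ := by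
  have hd : ρ (deltaVec q (F q)) = 0 := by
    have e := map_deltaVec (B := Module.End ℂ Fock) ρ q (F (n := n) q)
    rw [e, funext hF]
    exact deltaVec_eq_zero _ (fockF_serre_up 0)
  obtain ⟨Φ, h1, h2⟩ := exists_linearMap_of_quotient (parabolicPlus n q s) (deltaVec q (F q)) ρ
    (Finsupp.single 0 1) (by
      rintro x (⟨i, rfl⟩ | ⟨i, rfl⟩ | ⟨i, hi, rfl⟩)
      · rw [map_sub, AlgHom.commutes, hK, LinearMap.sub_apply, fockK_single, fockWeight_zero]
        exact sub_self _
      · rw [hE, fockE_single_zero]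
      · rw [hF, fockF_single_zero hi]) (by rw [hd, LinearMap.zero_apply])
  have hk (i : Fin n) : K q i • mGen n q s = (weightVal s i : ℂ) • mGen n q s := by
    have h : (K q i - algebraMap ℂ _ (weightVal s i : ℂ)) • mGen n q s = 0 :=
      quotient_smul_eq_zero (Or.inl ⟨i, rfl⟩)
    rwa [sub_smul, algebraMap_smul, sub_eq_zero] at h
  exact ⟨Φ, {
    satisfies := satisfies_Uq n q
    closure := fun Q => Uq.smul_mem
    map_e := hE
    map_f := hF
    map_k := hK
    map_kInv := hK'
    generates := quotient_generates
    e_smul := fun i => quotient_smul_eq_zero (Or.inr (Or.inl ⟨i, rfl⟩))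
    f_smul := fun i hi => quotient_smul_eq_zero (Or.inr (Or.inr ⟨i, hi, rfl⟩))
    k_smul := fun i => ⟨_, hk i⟩
    kInv_smul := fun i => ⟨_, inv_smul_of_smul ((satisfies_Uq n q).kInv_k i) (hk i)⟩
    delta_smul := quotient_delta_smul
    map_smul := h1
    map_gen := h2 }⟩

/-- The elements `e_α` act by `fockF` and the `q^{h_α}` by `fockKInv`, so the lowest weight vector
of `N_λ` again corresponds to `x^0`. -/
theorem exists_fockModel_N (ρ : Uq n q →ₐ[ℂ] Module.End ℂ Fock)
    (hE : ∀ i, ρ (E q i) = fockF q i) (hF : ∀ i, ρ (F q i) = fockE q κ i)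
    (hK : ∀ i, ρ (K q i) = fockKInv q s i) (hK' : ∀ i, ρ (KInv q i) = fockK q s i) :
    ∃ Φ : N n q s →ₗ[ℂ] Fock, IsFockModel κ s (F q) (E q) (KInv q) (K q) ρ (nGen n q s) Φ := by
  have hd : ρ (deltaVec q (E q)) = 0 := by
    have e := map_deltaVec (B := Module.End ℂ Fock) ρ q (E (n := n) q)
    rw [e, funext hE]
    exact deltaVec_eq_zero _ (fockF_serre_up 0)
  obtain ⟨Φ, h1, h2⟩ := exists_linearMap_of_quotient (parabolicMinus n q s) (deltaVec q (E q)) ρ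
    (Finsupp.single 0 1) (by
      rintro x (⟨i, rfl⟩ | ⟨i, rfl⟩ | ⟨i, hi, rfl⟩)
      · rw [map_sub, AlgHom.commutes, hK, LinearMap.sub_apply, fockKInv_single, fockWeight_zero]
        exact sub_self _
      · rw [hF, fockE_single_zero]
      · rw [hE, fockF_single_zero hi]) (by rw [hd, LinearMap.zero_apply])
  have hk (i : Fin n) : K q i • nGen n q s = (((weightVal s i)⁻¹ : ℂˣ) : ℂ) • nGen n q s := by
    have h : (K q i - algebraMap ℂ _ (((weightVal s i)⁻¹ : ℂˣ) : ℂ)) • nGen n q s = 0 :=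
      quotient_smul_eq_zero (Or.inl ⟨i, rfl⟩)
    rwa [sub_smul, algebraMap_smul, sub_eq_zero] at h
  exact ⟨Φ, {
    satisfies := (satisfies_Uq n q).swap
    closure := fun Q h1 h2 h3 h4 => Uq.smul_mem h2 h1 h4 h3
    map_e := hF
    map_f := hE
    map_k := hK'
    map_kInv := hK
    generates := quotient_generates
    e_smul := fun i => quotient_smul_eq_zero (Or.inr (Or.inl ⟨i, rfl⟩))
    f_smul := fun i hi => quotient_smul_eq_zero (Or.inr (Or.inr ⟨i, hi, rfl⟩))
    k_smul := fun i => ⟨_, inv_smul_of_smul ((satisfies_Uq n q).kInv_k i) (hk i)⟩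
    kInv_smul := fun i => ⟨_, hk i⟩
    delta_smul := quotient_delta_smul
    map_smul := h1
    map_gen := h2 }⟩

end Instances

/-! ### Vacuum expectation -/

section Vacuum

variable {n : ℕ} {q s : ℂˣ} {κ : ℂ}

theorem IsVacuumExpectation.kInv {ψ : Uq n q →ₗ[ℂ] ℂ} (h : IsVacuumExpectation s ψ) (i : Fin n) :
    ψ (KInv q i) = (((weightVal s i)⁻¹ : ℂˣ) : ℂ) := by
  have h1 := h.mul (K q i) (Algebra.subset_adjoin (Or.inl ⟨i, rfl⟩)) (KInv q i)
    (Algebra.subset_adjoin (Or.inr ⟨i, rfl⟩))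
  rw [(satisfies_Uq n q).k_kInv, h.one, h.k] at h1
  rw [Units.val_inv_eq_inv_val]
  exact eq_inv_of_mul_eq_one_right h1.symm

theorem IsVacuumExpectation.eq_on_cartan {ψ φ : Uq n q →ₗ[ℂ] ℂ} (hψ : IsVacuumExpectation s ψ)
    (hφ : IsVacuumExpectation s φ) {x : Uq n q} (hx : x ∈ cartan n q) : ψ x = φ x := by
  induction hx using Algebra.adjoin_induction with
  | mem x hx =>
    rcases hx with ⟨i, rfl⟩ | ⟨i, rfl⟩
    · rw [hψ.k, hφ.k]
    · rw [hψ.kInv, hφ.kInv]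
  | algebraMap c => rw [Algebra.algebraMap_eq_smul_one, map_smul, map_smul, hψ.one, hφ.one]
  | add x y _ _ hx hy => rw [map_add, map_add, hx, hy]
  | mul x y h1 h2 hx hy => rw [hψ.mul x h1 y h2, hφ.mul x h1 y h2, hx, hy]

theorem E_mul_cartan (i : Fin n) {x : Uq n q} (hx : x ∈ cartan n q) :
    ∃ y, E q i * x = y * E q i := by
  have H := satisfies_Uq n q
  induction hx using Algebra.adjoin_induction with
  | mem x hx =>
    rcases hx with ⟨j, rfl⟩ | ⟨j, rfl⟩
    · have h := H.swap.kInv_mul_f j i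
      refine ⟨((q ^ (-pairing j i) : ℂˣ) : ℂ) • K q j, ?_⟩
      rw [smul_mul_assoc, h, smul_smul, ← Units.val_mul, ← zpow_add, neg_add_cancel, zpow_zero,
        Units.val_one, one_smul]
    · exact ⟨((q ^ pairing i j : ℂˣ) : ℂ) • KInv q j, by rw [E_mul_KInv, smul_mul_assoc]⟩
  | algebraMap c => exact ⟨algebraMap ℂ _ c, (Algebra.commutes c _).symm⟩
  | add x y _ _ hx hy =>
    obtain ⟨x', hx⟩ := hx
    obtain ⟨y', hy⟩ := hy
    exact ⟨x' + y', by rw [mul_add, hx, hy, add_mul]⟩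
  | mul x y _ _ hx hy =>
    obtain ⟨x', hx⟩ := hx
    obtain ⟨y', hy⟩ := hy
    exact ⟨x' * y', by rw [← mul_assoc, hx, mul_assoc, hy, mul_assoc]⟩

/-- The subspace `C = U_q(h) + U g_+` is stable under left multiplication by the `e_α` and
`q^{±h_α}`. The whole algebra is thus generated from `C` by left multiplication with the `f_α`; both
functionals agree on `C` and vanish on `f_α U`. -/
theorem IsVacuumExpectation.unique {ψ φ : Uq n q →ₗ[ℂ] ℂ} (hψ : IsVacuumExpectation s ψ)
    (hφ : IsVacuumExpectation s φ) : ψ = φ := by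
  let I : Submodule ℂ (Uq n q) :=
    (Submodule.span (Uq n q) (Set.range (E q))).restrictScalars ℂ
  let C : Submodule ℂ (Uq n q) := Subalgebra.toSubmodule (cartan n q) ⊔ I
  have hI (x : Uq n q) {y : Uq n q} (hy : y ∈ I) : x * y ∈ I :=
    (Submodule.span (Uq n q) (Set.range (E q))).smul_mem x hy
  have hEI (i : Fin n) : E q i ∈ I := Submodule.subset_span ⟨i, rfl⟩
  have hcart {x : Uq n q} (hx : ∀ y ∈ cartan n q, x * y ∈ C) : ∀ w ∈ C, x • w ∈ C := by
    intro w hw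
    obtain ⟨a, ha, b, hb, rfl⟩ := Submodule.mem_sup.mp hw
    rw [smul_add, smul_eq_mul, smul_eq_mul]
    exact C.add_mem (hx a ha) (Submodule.mem_sup_right (hI x hb))
  have hzero {ψ : Uq n q →ₗ[ℂ] ℂ} (hψ : IsVacuumExpectation s ψ) {x : Uq n q} (hx : x ∈ I) :
      ψ x = 0 := by
    obtain ⟨c, rfl⟩ := (Submodule.mem_span_range_iff_exists_fun (Uq n q)).mp hx
    rw [map_sum]
    exact Finset.sum_eq_zero fun i _ => hψ.mul_e i _
  have htop : LinearMap.ker (ψ - φ) = ⊤ := by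
    refine (satisfies_Uq n q).eq_top_of_stable (C := C) (fun i => hcart fun y hy => ?_)
      (fun i => hcart fun y hy => ?_) (fun i => hcart fun y hy => ?_)
      (fun Q hCQ h1 h2 h3 h4 => ?_) ?_ fun i w _ => ?_
    · obtain ⟨z, hz⟩ := E_mul_cartan i hy
      rw [hz]
      exact Submodule.mem_sup_right (hI z (hEI i))
    · exact Submodule.mem_sup_left
        ((cartan n q).mul_mem (Algebra.subset_adjoin (Or.inl ⟨i, rfl⟩)) hy)
    · exact Submodule.mem_sup_left
        ((cartan n q).mul_mem (Algebra.subset_adjoin (Or.inr ⟨i, rfl⟩)) hy)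
    · rw [eq_top_iff]
      intro x _
      have h := Uq.smul_mem (W := Uq n q) h1 h2 h3 h4 x 1 (hCQ (Submodule.mem_sup_left (cartan n q).one_mem))
      rwa [smul_eq_mul, mul_one] at h
    · refine sup_le (fun x hx => ?_) fun x hx => ?_
      · rw [LinearMap.mem_ker, LinearMap.sub_apply, hψ.eq_on_cartan hφ hx, sub_self]
      · rw [LinearMap.mem_ker, LinearMap.sub_apply, hzero hψ hx, hzero hφ hx, sub_self]
    · rw [LinearMap.mem_ker, LinearMap.sub_apply, smul_eq_mul, hψ.f_mul, hφ.f_mul, sub_self]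
  exact sub_eq_zero.mp (LinearMap.ker_eq_top.mp htop)

/-- The coefficient of `x^0` in the vector `x · x^0`. -/
def vacuumExpectation (ρ : Uq n q →ₐ[ℂ] Module.End ℂ Fock) : Uq n q →ₗ[ℂ] ℂ :=
  (Finsupp.lapply 0).comp
    ((LinearMap.applyₗ (Finsupp.single (0 : ℕ → ℤ) (1 : ℂ))).comp ρ.toLinearMap)

theorem vacuumExpectation_apply (ρ : Uq n q →ₐ[ℂ] Module.End ℂ Fock) (x : Uq n q) :
    vacuumExpectation ρ x = ρ x (Finsupp.single 0 1) 0 := rfl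

theorem neg_rootSeq_notMem (i : Fin n) (m : Fin n → ℕ) : embed m ≠ -rootSeq i := by
  intro h
  have h := congrFun h i
  rw [embed_apply, Pi.neg_apply, rootSeq, if_pos rfl, if_neg (by omega)] at h
  omega

/-- Since `x^0` is a common eigenvector of `U_q(h)` killed by the `e_α`, only vanishing on `f_α U`
needs an argument. -/
theorem isVacuumExpectation_vacuumExpectation {ρ : Uq n q →ₐ[ℂ] Module.End ℂ Fock}
    {Φ : M n q s →ₗ[ℂ] Fock}
    (H : IsFockModel κ s (E q) (F q) (K q) (KInv q) ρ (mGen n q s) Φ)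
    (hq : ∀ k : ℕ, 0 < k → q ^ k ≠ 1) : IsVacuumExpectation s (vacuumExpectation ρ) := by
  obtain ⟨u, hu⟩ := H.exists_basis hq
  have hK (i : Fin n) : ρ (K q i) (Finsupp.single 0 1) =
      (weightVal s i : ℂ) • Finsupp.single 0 1 := by
    rw [H.map_k, fockK_single, fockWeight_zero]
  have hKInv (i : Fin n) : ρ (KInv q i) (Finsupp.single 0 1) =
      (((weightVal s i)⁻¹ : ℂˣ) : ℂ) • Finsupp.single 0 1 := by
    rw [H.map_kInv, fockKInv_single, fockWeight_zero]
  have hcartan {x : Uq n q} (hx : x ∈ cartan n q) : ρ x (Finsupp.single 0 1) =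
      vacuumExpectation ρ x • Finsupp.single 0 1 := by
    have : ∃ c : ℂ, ρ x (Finsupp.single 0 1) = c • Finsupp.single 0 1 := by
      induction hx using Algebra.adjoin_induction with
      | mem x hx =>
        rcases hx with ⟨i, rfl⟩ | ⟨i, rfl⟩
        · exact ⟨_, hK i⟩
        · exact ⟨_, hKInv i⟩
      | algebraMap c => exact ⟨c, by rw [AlgHom.commutes]; rfl⟩
      | add x y _ _ hx hy =>
        obtain ⟨a, ha⟩ := hx
        obtain ⟨b, hb⟩ := hy
        exact ⟨a + b, by rw [map_add, LinearMap.add_apply, ha, hb, add_smul]⟩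
      | mul x y _ _ hx hy =>
        obtain ⟨a, ha⟩ := hx
        obtain ⟨b, hb⟩ := hy
        exact ⟨b * a, by rw [map_mul, Module.End.mul_apply, hb, map_smul, ha, smul_smul]⟩
    obtain ⟨c, hc⟩ := this
    rw [vacuumExpectation_apply, hc]
    simp
  refine ⟨fun i x => ?_, fun i x => ?_, ?_, fun x hx y hy => ?_, fun i => ?_⟩
  -- The constant term of `f_α v` comes from the coefficient of `v` at `-α`. It vanishes because `v`
  -- is in the image of `M_λ`, where all exponents are non-negative; on the full Laurent space it
  -- need not vanish.
  · have h : ρ x (Finsupp.single 0 1) (-rootSeq i) = 0 := by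
      rw [← H.map_gen, ← H.map_smul]
      exact fock_apply_of_notMem hu _ (neg_rootSeq_notMem i)
    have e := shift_apply_add (rootSeq i) (fockCoeffF q i) (ρ x (Finsupp.single 0 1)) (-rootSeq i)
    rw [neg_add_cancel, h, zero_mul] at e
    rw [vacuumExpectation_apply, map_mul, Module.End.mul_apply, H.map_f, fockF, e]
  · rw [vacuumExpectation_apply, map_mul, Module.End.mul_apply, H.map_e, fockE_single_zero,
      LinearMap.map_zero, Finsupp.zero_apply]
  · rw [vacuumExpectation_apply, map_one, Module.End.one_apply, Finsupp.single_eq_same]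
  · rw [vacuumExpectation_apply, map_mul, Module.End.mul_apply, hcartan hy, map_smul, hcartan hx]
    simp [mul_comm]
  · rw [vacuumExpectation_apply, hK]
    simp

end Vacuum

/-! ### Bilinear forms diagonal in a pair of bases -/

section DiagForm

variable {ι V W : Type*} [AddCommGroup V] [Module ℂ V] [AddCommGroup W] [Module ℂ W]

/-- The bilinear form with `(u i, u' j) = c i` for `i = j`, and zero otherwise. -/
def diagForm (u : Module.Basis ι ℂ V) (u' : Module.Basis ι ℂ W) (c : ι → ℂ) :
    V →ₗ[ℂ] W →ₗ[ℂ] ℂ :=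
  u.constr ℂ fun i => c i • u'.coord i

variable (u : Module.Basis ι ℂ V) (u' : Module.Basis ι ℂ W) (c : ι → ℂ)

theorem diagForm_left (i : ι) (w : W) : diagForm u u' c (u i) w = c i * u'.repr w i := by
  simp [diagForm]

theorem diagForm_right (i : ι) (v : V) : diagForm u u' c v (u' i) = c i * u.repr v i := by
  classical
  have h : (diagForm u u' c).flip (u' i) = c i • u.coord i := by
    refine u.ext fun j => ?_
    rw [LinearMap.flip_apply, diagForm_left]
    by_cases hij : i = j
    · subst hij; simp
    · simp [hij, Ne.symm hij]
  exact LinearMap.congr_fun h v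

theorem basis_finsum_repr (v : V) :
    {i | u.repr v i • u i ≠ 0}.Finite ∧ ∑ᶠ i, u.repr v i • u i = v := by
  have hsub : Function.support (fun i => u.repr v i • u i) ⊆ (u.repr v).support := by
    intro i hi
    rw [Finset.mem_coe, Finsupp.mem_support_iff]
    exact left_ne_zero_of_smul hi
  refine ⟨(u.repr v).support.finite_toSet.subset hsub, ?_⟩
  rw [finsum_eq_sum_of_support_subset _ hsub]
  exact u.linearCombination_repr v

/-- Reduces adjointness and invariance of forms to pairs of basis vectors. -/
theorem bilinear_smul_ext {R : Type*} [Ring R] [Algebra ℂ R] [Module R V] [IsScalarTower ℂ R V]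
    [Module R W] [IsScalarTower ℂ R W] {u : Module.Basis ι ℂ V} {u' : Module.Basis ι ℂ W}
    {B B' : V →ₗ[ℂ] W →ₗ[ℂ] ℂ} {a b a' b' : R}
    (h : ∀ i j, B (a • u i) (b • u' j) = B' (a' • u i) (b' • u' j)) (v : V) (w : W) :
    B (a • v) (b • w) = B' (a' • v) (b' • w) := by
  have e : B.compl₁₂ (Module.toModuleEnd ℂ (S := R) V a) (Module.toModuleEnd ℂ (S := R) W b) =
      B'.compl₁₂ (Module.toModuleEnd ℂ (S := R) V a') (Module.toModuleEnd ℂ (S := R) W b') :=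
    LinearMap.ext_basis u u' h
  exact LinearMap.congr_fun₂ e v w

end DiagForm

/-! ### Diagonal coefficients of the two forms and of `𝓕`. -/

section Coefficients

variable {n : ℕ} {q p s : ℂˣ}

theorem exists_prod_eq_one (g : Fin n → ℕ → ℂ) {m k : Fin n → ℕ} {a : Fin n}
    (h : ∀ j, j ≠ a → k j = m j) : ∃ R, ∏ j, g j (m j) = g a (m a) * R ∧
      ∏ j, g j (k j) = g a (k a) * R := by
  refine ⟨∏ j ∈ Finset.univ.erase a, g j (m j), ?_, ?_⟩
  · rw [Finset.mul_prod_erase _ (fun j => g j (m j)) (Finset.mem_univ a)]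
  · rw [← Finset.mul_prod_erase _ (fun j => g j (k j)) (Finset.mem_univ a)]
    congr 1
    exact Finset.prod_congr rfl fun j hj => by rw [h j (Finset.ne_of_mem_erase hj)]

theorem exists_prod_eq_two (g : Fin n → ℕ → ℂ) {m k : Fin n → ℕ} {a b : Fin n} (hab : a ≠ b)
    (h : ∀ j, j ≠ a → j ≠ b → k j = m j) : ∃ R, ∏ j, g j (m j) = g a (m a) * (g b (m b) * R) ∧
      ∏ j, g j (k j) = g a (k a) * (g b (k b) * R) := by
  have hb : b ∈ Finset.univ.erase a := Finset.mem_erase.mpr ⟨hab.symm, Finset.mem_univ b⟩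
  refine ⟨∏ j ∈ (Finset.univ.erase a).erase b, g j (m j), ?_, ?_⟩
  · rw [Finset.mul_prod_erase _ (fun j => g j (m j)) hb,
      Finset.mul_prod_erase _ (fun j => g j (m j)) (Finset.mem_univ a)]
  · rw [← Finset.mul_prod_erase _ (fun j => g j (k j)) (Finset.mem_univ a),
      ← Finset.mul_prod_erase _ (fun j => g j (k j)) hb]
    congr 2
    refine Finset.prod_congr rfl fun j hj => ?_
    rw [h j (Finset.ne_of_mem_erase (Finset.mem_of_mem_erase hj)) (Finset.ne_of_mem_erase hj)]

theorem qFactorial_succ (q : ℂˣ) (m : ℕ) :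
    qFactorial q (m + 1) = qFactorial q m * qNumber q (m + 1) := Finset.prod_range_succ _ _

theorem qFactorial_ne_zero (hq : ∀ k : ℕ, 0 < k → q ^ k ≠ 1) (m : ℕ) : qFactorial q m ≠ 0 := by
  refine Finset.prod_ne_zero_iff.mpr fun k _ => ?_
  rw [← qInt_natCast]
  exact qInt_ne_zero hq (by positivity)

/-- Neighbouring multi-indices which differ by a simple root. -/
theorem embed_add_rootSeq_eq {m k : Fin n → ℕ} {i : Fin n} (h : embed m + rootSeq i = embed k) :
    ((i : ℕ) = 0 ∧ k i = m i + 1 ∧ ∀ j, j ≠ i → k j = m j) ∨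
    ∃ a : Fin n, (i : ℕ) = a + 1 ∧ k i = m i + 1 ∧ m a = k a + 1 ∧
      ∀ j, j ≠ i → j ≠ a → k j = m j := by
  have hj (j : Fin n) : (m j : ℤ) + rootSeq i j = k j := by
    rw [← embed_apply, ← embed_apply, ← h, Pi.add_apply]
  have hi := hj i
  rw [rootSeq, if_pos rfl, if_neg (by omega)] at hi
  by_cases h0 : (i : ℕ) = 0
  · refine Or.inl ⟨h0, by omega, fun j hji => ?_⟩
    have := hj j
    rw [rootSeq, if_neg (fun h => hji (Fin.ext h)), if_neg (by omega)] at this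
    omega
  · have ha : (i : ℕ) - 1 < n := by omega
    refine Or.inr ⟨⟨(i : ℕ) - 1, ha⟩, (by simp only; omega), by omega, ?_, fun j hji hja => ?_⟩
    · have := hj ⟨(i : ℕ) - 1, ha⟩
      simp only [rootSeq] at this
      rw [if_neg (by omega), if_pos (by omega)] at this
      omega
    · have := hj j
      have hja' : (j : ℕ) ≠ i - 1 := fun h => hja (Fin.ext h)
      rw [rootSeq, if_neg (fun h => hji (Fin.ext h)), if_neg (by omega)] at this
      omega

/-- The Shapovalov norm of `x^m`. -/
def shapovalovCoeff (q : ℂˣ) (κ : ℂ) (m : Fin n → ℕ) : ℂ := ∏ i, κ ^ m i * qFactorial q (m i)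

theorem shapovalovCoeff_ne_zero (hq : ∀ k : ℕ, 0 < k → q ^ k ≠ 1) {κ : ℂ} (hκ : κ ≠ 0)
    (m : Fin n → ℕ) : shapovalovCoeff q κ m ≠ 0 :=
  Finset.prod_ne_zero_iff.mpr fun _ _ => mul_ne_zero (pow_ne_zero _ hκ) (qFactorial_ne_zero hq _)

theorem shapovalovCoeff_zero (q : ℂˣ) (κ : ℂ) : shapovalovCoeff q κ (0 : Fin n → ℕ) = 1 := by
  simp [shapovalovCoeff, qFactorial]

theorem qInt_succ_natCast (q : ℂˣ) (m : ℕ) : qInt q ((m + 1 : ℕ) : ℤ) = qNumber q (m + 1) :=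
  qInt_natCast q (m + 1)

/-- Passing from `m` to `m + α_i` changes one factorial, or two in opposite directions; the ratio of
the norms is the ratio of the coefficients of `e_α` and `f_α`. -/
theorem shapovalovCoeff_contravariant {κ : ℂ} {m k : Fin n → ℕ} {i : Fin n}
    (h : embed m + rootSeq i = embed k) :
    shapovalovCoeff q κ k * fockCoeffF q i (embed m) =
      shapovalovCoeff q κ m * fockCoeffE q κ i (embed k) := by
  unfold shapovalovCoeff
  rcases embed_add_rootSeq_eq h with ⟨h0, hi, hj⟩ | ⟨a, h0, hi, ha, hj⟩
  · obtain ⟨R, h1, h2⟩ := exists_prod_eq_one (fun _ x => κ ^ x * qFactorial q x) hj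
    rw [h1, h2, fockCoeffE, embed_apply, hi, qInt_succ_natCast, qFactorial_succ, h0, fockScale,
      if_pos rfl, fockCoeffF, pow_succ]
    ring
  · have hia : i ≠ a := fun h => by rw [h] at h0; omega
    obtain ⟨R, h1, h2⟩ := exists_prod_eq_two (fun _ x => κ ^ x * qFactorial q x) hia hj
    rw [h1, h2, fockCoeffE, embed_apply, hi, ha, h0, fockScale, if_neg (by omega), fockCoeffF,
      embed_apply, ha, qInt_succ_natCast, qInt_succ_natCast, qFactorial_succ, qFactorial_succ,
      pow_succ, pow_succ]
    ring

/-- The factors of the value of the invariant pairing on `x^m`. -/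
def pairingFactor (p q : ℂˣ) (i x : ℕ) : ℂ :=
  qFactorial q x * ((-((p : ℂ) - (p : ℂ)⁻¹))⁻¹ * (-(q : ℂ)⁻¹) ^ i) ^ x * (p : ℂ) ^ x ^ 2

/-- The value of the invariant pairing on `x^m`. -/
def pairingCoeff (p q : ℂˣ) (m : Fin n → ℕ) : ℂ := ∏ i : Fin n, pairingFactor p q i (m i)

theorem pairingCoeff_zero (p q : ℂˣ) : pairingCoeff p q (0 : Fin n → ℕ) = 1 := by
  simp [pairingCoeff, pairingFactor, qFactorial]

/-- The odd powers `p^{2x+1}` add up to `p^{x²}`, the origin of the Gaussian factor in `𝓕`. -/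
theorem pairingFactor_succ (p q : ℂˣ) (i x : ℕ) : pairingFactor p q i (x + 1) =
    pairingFactor p q i x * (qNumber q (x + 1) *
      ((-((p : ℂ) - (p : ℂ)⁻¹))⁻¹ * (-(q : ℂ)⁻¹) ^ i) * (p : ℂ) ^ (2 * x + 1)) := by
  rw [pairingFactor, pairingFactor, qFactorial_succ, pow_succ _ x,
    show (x + 1) ^ 2 = x ^ 2 + (2 * x + 1) by ring, pow_add]
  ring

/-- One identity expresses invariance under both `e_α` and `f_α`. At the short root, `κ s⁻¹ q^{m}`
produces `θ⁻¹ p^{2m+1}`; at a long root, moving a unit from one coordinate to the next costs `-q⁻¹`,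
whence the factor `(-q⁻¹)^i`. -/
theorem pairingCoeff_invariant (hp : p ^ 2 = q) {m k : Fin n → ℕ} {i : Fin n}
    (h : embed m + rootSeq i = embed k) :
    pairingCoeff p q m * fockCoeffE q (fockConst p s) i (embed k) *
        (((fockWeight q s i (embed m))⁻¹ : ℂˣ) : ℂ) +
      pairingCoeff p q k * fockCoeffF q i (embed m) = 0 := by
  have hpq : (q : ℂ) = (p : ℂ) ^ 2 := by rw [← hp]; rfl
  have hp0 : (p : ℂ) ≠ 0 := p.ne_zero
  have hs0 : (s : ℂ) ≠ 0 := s.ne_zero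
  unfold pairingCoeff
  rcases embed_add_rootSeq_eq h with ⟨h0, hi, hj⟩ | ⟨a, h0, hi, ha, hj⟩
  · obtain ⟨R, h1, h2⟩ := exists_prod_eq_one (fun i => pairingFactor p q i) hj
    have hw : (((fockWeight q s i (embed m))⁻¹ : ℂˣ) : ℂ) = (s : ℂ)⁻¹ * (p : ℂ) ^ (2 * m i) := by
      have e : embed m 0 = m i := by rw [← h0, embed_apply]
      rw [h0, fockWeight, if_pos rfl, rootInner, e, zpow_neg, mul_inv, inv_inv, zpow_natCast]
      push_cast
      rw [hpq, ← pow_mul]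
    rw [h1, h2, hw, fockCoeffE, embed_apply, hi, qInt_succ_natCast, pairingFactor_succ, h0,
      fockScale, if_pos rfl, fockCoeffF, fockConst, inv_neg, pow_succ]
    field_simp
    ring
  · have hia : i ≠ a := fun h => by rw [h] at h0; omega
    obtain ⟨R, h1, h2⟩ := exists_prod_eq_two (fun i => pairingFactor p q i) hia hj
    have hw : (((fockWeight q s i (embed m))⁻¹ : ℂˣ) : ℂ) =
        (p : ℂ) ^ (2 * m i) * ((p : ℂ) ^ (2 * (k a + 1)))⁻¹ := by
      have e : embed m (a + 1) = m i := by rw [← h0, embed_apply]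
      rw [h0, fockWeight, if_neg (by omega), one_mul, rootInner, e, embed_apply, ha, zpow_neg,
        inv_inv, zpow_sub, zpow_natCast, zpow_natCast]
      push_cast
      rw [hpq, ← pow_mul, ← pow_mul]
    rw [h1, h2, hw, fockCoeffE, embed_apply, hi, ha, h0, fockScale, if_neg (by omega), fockCoeffF,
      embed_apply, ha, qInt_succ_natCast, qInt_succ_natCast, pairingFactor_succ,
      pairingFactor_succ, hpq]
    have e1 : (p : ℂ) ^ (2 * (k a + 1)) = p ^ (2 * k a) * p ^ 2 := by ring
    have e2 (x : ℕ) : (p : ℂ) ^ (2 * x + 1) = p ^ (2 * x) * p := by ring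
    rw [e1, e2, e2, pow_succ _ (a : ℕ)]
    have e3 : (p : ℂ) ^ (2 * k a) ≠ 0 := pow_ne_zero _ hp0
    field_simp
    ring

/-- Of the two factors `(-q⁻¹)^{i m_i}`, one comes from the pairing and one from normalizing the
`f_ε`-monomials. Their product `q^{-2 i m_i}` is cancelled by `q^{2 m_i i}` in `𝓕`. -/
theorem coeffF_mul_pairingCoeff (hq : ∀ k : ℕ, 0 < k → q ^ k ≠ 1) (hp : p ^ 2 = q)
    (m : Fin n → ℕ) : coeffF p q m * rootCoeff q m * pairingCoeff p q m = 1 := by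
  have hθ : (p : ℂ) - (p : ℂ)⁻¹ ≠ 0 := sub_inv_ne_zero (not_root_of_unity_sqrt hq hp)
  rw [coeffF, rootCoeff, pairingCoeff, ← Finset.prod_pow_eq_pow_sum, ← Finset.prod_div_distrib,
    ← Finset.prod_mul_distrib, ← Finset.prod_mul_distrib, ← Finset.prod_mul_distrib]
  refine Finset.prod_eq_one fun i _ => ?_
  have hf := qFactorial_ne_zero hq (m i)
  have e1 : ((p ^ (-(m i : ℤ) ^ 2) : ℂˣ) : ℂ) = ((p : ℂ) ^ m i ^ 2)⁻¹ := by
    rw [show -(m i : ℤ) ^ 2 = -((m i ^ 2 : ℕ) : ℤ) by push_cast; ring, zpow_neg, zpow_natCast]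
    push_cast
    rfl
  have e2 : ((q ^ (2 * (m i : ℤ) * (i : ℕ)) : ℂˣ) : ℂ) = ((q : ℂ) ^ 2) ^ ((i : ℕ) * m i) := by
    rw [show (2 * (m i : ℤ) * (i : ℕ)) = ((2 * ((i : ℕ) * m i) : ℕ) : ℤ) by push_cast; ring,
      zpow_natCast, pow_mul]
    push_cast
    rfl
  have e3 : ((-(q : ℂ)⁻¹) ^ ((i : ℕ) * m i)) * ((-(q : ℂ)⁻¹) ^ ((i : ℕ) * m i)) *
      ((q : ℂ) ^ 2) ^ ((i : ℕ) * m i) = 1 := by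
    rw [← mul_pow, ← mul_pow]
    have hq0 : (q : ℂ) ≠ 0 := q.ne_zero
    field_simp
    simp
  have e4 : (-((p : ℂ) - (p : ℂ)⁻¹)) ^ m i * ((-((p : ℂ) - (p : ℂ)⁻¹))⁻¹) ^ m i = 1 := by
    rw [← mul_pow, mul_inv_cancel₀ (neg_ne_zero.mpr hθ), one_pow]
  have e5 : (p : ℂ) ^ m i ^ 2 ≠ 0 := pow_ne_zero _ p.ne_zero
  rw [pairingFactor, Units.val_mul, e1, e2, mul_pow, ← pow_mul, ← pow_mul, Units.val_inv_eq_inv_val]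
  generalize (-((p : ℂ) - (p : ℂ)⁻¹)) ^ m i = t at *
  generalize (-((p : ℂ) - (p : ℂ)⁻¹))⁻¹ ^ m i = t' at *
  generalize (-(q : ℂ)⁻¹) ^ ((i : ℕ) * m i) = y at *
  have e6 : ((q : ℂ) ^ 2) ^ ((i : ℕ) * m i) = (q : ℂ) ^ (2 * ((i : ℕ) * m i)) := (pow_mul _ _ _).symm
  generalize (q : ℂ) ^ (2 * ((i : ℕ) * m i)) = z at *
  generalize ((q : ℂ) ^ 2) ^ ((i : ℕ) * m i) = z' at *
  subst e6
  field_simp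
  linear_combination (t * t') * e3 + e4

end Coefficients

/-! ### The Shapovalov form and the invariant pairing -/

section Actions

variable {n : ℕ} {q s : ℂˣ} {κ : ℂ} {W : Type*} [AddCommGroup W] [Module ℂ W] [Module (Uq n q) W]
  [IsScalarTower ℂ (Uq n q) W] {e f k k' : Fin n → Uq n q}
  {ρ : Uq n q →ₐ[ℂ] Module.End ℂ Fock} {w₀ : W} {Φ : W →ₗ[ℂ] Fock}
  {u : Module.Basis (Fin n → ℕ) ℂ W}

namespace IsFockModel

theorem basis_zero (H : IsFockModel κ s e f k k' ρ w₀ Φ)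
    (hu : ∀ m, Φ (u m) = Finsupp.single (embed m) 1) : u 0 = w₀ :=
  fock_injective hu (by rw [hu, H.map_gen, embed_zero])

theorem repr_f_smul (H : IsFockModel κ s e f k k' ρ w₀ Φ)
    (hu : ∀ m, Φ (u m) = Finsupp.single (embed m) 1) (i : Fin n) (m r : Fin n → ℕ)
    [Decidable (embed m + rootSeq i = embed r)] :
    u.repr (f i • u m) r = if embed m + rootSeq i = embed r then fockCoeffF q i (embed m) else 0 := by
  classical
  rw [← fock_apply_embed hu, H.map_smul, hu, H.map_f, fockF, shift_single, one_mul,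
    Finsupp.single_apply]

theorem repr_e_smul (H : IsFockModel κ s e f k k' ρ w₀ Φ)
    (hu : ∀ m, Φ (u m) = Finsupp.single (embed m) 1) (i : Fin n) (m r : Fin n → ℕ)
    [Decidable (embed m + rootSeq i = embed r)] :
    u.repr (e i • u r) m =
      if embed m + rootSeq i = embed r then fockCoeffE q κ i (embed r) else 0 := by
  classical
  rw [← fock_apply_embed hu, H.map_smul, hu, H.map_e, fockE, shift_single, one_mul,
    Finsupp.single_apply]
  refine if_congr ?_ rfl rfl
  rw [← sub_eq_add_neg, sub_eq_iff_eq_add, eq_comm]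

theorem k_smul_basis (H : IsFockModel κ s e f k k' ρ w₀ Φ)
    (hu : ∀ m, Φ (u m) = Finsupp.single (embed m) 1) (i : Fin n) (m : Fin n → ℕ) :
    k i • u m = (fockWeight q s i (embed m) : ℂ) • u m :=
  fock_injective hu (by rw [H.map_smul, _root_.map_smul, hu, H.map_k, fockK_single])

theorem kInv_smul_basis (H : IsFockModel κ s e f k k' ρ w₀ Φ)
    (hu : ∀ m, Φ (u m) = Finsupp.single (embed m) 1) (i : Fin n) (m : Fin n → ℕ) :
    k' i • u m = (((fockWeight q s i (embed m))⁻¹ : ℂˣ) : ℂ) • u m :=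
  fock_injective hu (by rw [H.map_smul, _root_.map_smul, hu, H.map_kInv, fockKInv_single])

theorem repr_gen (H : IsFockModel κ s e f k k' ρ w₀ Φ)
    (hu : ∀ m, Φ (u m) = Finsupp.single (embed m) 1) (x : Uq n q) :
    u.repr (x • w₀) 0 = vacuumExpectation ρ x := by
  rw [← fock_apply_embed hu, H.map_smul, H.map_gen, embed_zero, vacuumExpectation_apply]

/-- Matrix elements of the Shapovalov form. -/
theorem shapovalov_f_e (H : IsFockModel κ s e f k k' ρ w₀ Φ)
    (hu : ∀ m, Φ (u m) = Finsupp.single (embed m) 1) (i : Fin n) (v w : W) :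
    diagForm u u (shapovalovCoeff q κ) (f i • v) w =
      diagForm u u (shapovalovCoeff q κ) v (e i • w) := by
  classical
  have h := bilinear_smul_ext (R := Uq n q) (u := u) (u' := u)
    (B := diagForm u u (shapovalovCoeff q κ)) (B' := diagForm u u (shapovalovCoeff q κ))
    (a := f i) (b := 1) (a' := 1) (b' := e i) (fun m r => ?_) v w
  · rwa [one_smul, one_smul] at h
  · rw [one_smul, one_smul, diagForm_right, diagForm_left, H.repr_f_smul hu, H.repr_e_smul hu]
    split_ifs with h
    · exact shapovalovCoeff_contravariant h
    · rw [mul_zero, mul_zero]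

theorem shapovalov_e_f (H : IsFockModel κ s e f k k' ρ w₀ Φ)
    (hu : ∀ m, Φ (u m) = Finsupp.single (embed m) 1) (i : Fin n) (v w : W) :
    diagForm u u (shapovalovCoeff q κ) (e i • v) w =
      diagForm u u (shapovalovCoeff q κ) v (f i • w) := by
  classical
  have h := bilinear_smul_ext (R := Uq n q) (u := u) (u' := u)
    (B := diagForm u u (shapovalovCoeff q κ)) (B' := diagForm u u (shapovalovCoeff q κ))
    (a := e i) (b := 1) (a' := 1) (b' := f i) (fun m r => ?_) v w
  · rwa [one_smul, one_smul] at h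
  · rw [one_smul, one_smul, diagForm_right, diagForm_left, H.repr_f_smul hu, H.repr_e_smul hu]
    split_ifs with h
    · exact (shapovalovCoeff_contravariant h).symm
    · rw [mul_zero, mul_zero]

theorem diagForm_smul_of_eigen {x : Uq n q} (c : (Fin n → ℕ) → ℂ) {b : (Fin n → ℕ) → ℂ}
    (hx : ∀ m, x • u m = b m • u m) (v w : W) :
    diagForm u u c (x • v) w = diagForm u u c v (x • w) := by
  classical
  have h := bilinear_smul_ext (R := Uq n q) (u := u) (u' := u) (B := diagForm u u c)
    (B' := diagForm u u c) (a := x) (b := 1) (a' := 1) (b' := x) (fun m r => ?_) v w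
  · rwa [one_smul, one_smul] at h
  · rw [one_smul, one_smul, hx, hx, diagForm_right, diagForm_left, _root_.map_smul, _root_.map_smul]
    by_cases hmr : m = r
    · subst hmr; rfl
    · simp [hmr, Ne.symm hmr]

end IsFockModel

end Actions

/-! ### Adjoints with respect to the Chevalley involution and the inverse antipode. -/

section Involutions

variable {n : ℕ} {q : ℂˣ}

theorem lift_generator {A : Type*} [Ring A] [Algebra ℂ A] (g : Gen n → A)
    (h : ∀ ⦃x y⦄, Rel n q x y → FreeAlgebra.lift ℂ g x = FreeAlgebra.lift ℂ g y) (z : Gen n) :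
    Uq.lift g h (Uq.mk n q (FreeAlgebra.ι ℂ z)) = g z := by
  rw [Uq.lift_mk, FreeAlgebra.lift_ι_apply]

theorem chevalley_E (i : Fin n) : chevalley n q (E q i) = MulOpposite.op (F q i) :=
  lift_generator _ _ _

theorem chevalley_F (i : Fin n) : chevalley n q (F q i) = MulOpposite.op (E q i) :=
  lift_generator _ _ _

theorem chevalley_K (i : Fin n) : chevalley n q (K q i) = MulOpposite.op (K q i) :=
  lift_generator _ _ _

theorem chevalley_KInv (i : Fin n) : chevalley n q (KInv q i) = MulOpposite.op (KInv q i) :=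
  lift_generator _ _ _

theorem antipodeInv_E (i : Fin n) :
    antipodeInv n q (E q i) = MulOpposite.op (-(KInv q i * E q i)) := lift_generator _ _ _

theorem antipodeInv_F (i : Fin n) :
    antipodeInv n q (F q i) = MulOpposite.op (-(F q i * K q i)) := lift_generator _ _ _

theorem antipodeInv_K (i : Fin n) : antipodeInv n q (K q i) = MulOpposite.op (KInv q i) :=
  lift_generator _ _ _

theorem antipodeInv_KInv (i : Fin n) : antipodeInv n q (KInv q i) = MulOpposite.op (K q i) :=
  lift_generator _ _ _

variable {V W : Type*} [AddCommGroup V] [Module ℂ V] [Module (Uq n q) V]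
  [IsScalarTower ℂ (Uq n q) V] [AddCommGroup W] [Module ℂ W] [Module (Uq n q) W]
  [IsScalarTower ℂ (Uq n q) W]

theorem adjoint_chevalley {S : V →ₗ[ℂ] V →ₗ[ℂ] ℂ}
    (hE : ∀ (i : Fin n) v w, S (E q i • v) w = S v (F q i • w))
    (hF : ∀ (i : Fin n) v w, S (F q i • v) w = S v (E q i • w))
    (hK : ∀ (i : Fin n) v w, S (K q i • v) w = S v (K q i • w))
    (hK' : ∀ (i : Fin n) v w, S (KInv q i • v) w = S v (KInv q i • w)) (x : Uq n q) :
    ∀ v w, S (x • v) w = S v ((chevalley n q x).unop • w) := by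
  induction x using Uq.induction with
  | hc c =>
    intro v w
    rw [AlgHom.commutes, algebraMap_smul, MulOpposite.algebraMap_apply, MulOpposite.unop_op,
      algebraMap_smul, map_smul, map_smul, LinearMap.smul_apply]
  | he i => intro v w; rw [hE, chevalley_E, MulOpposite.unop_op]
  | hf i => intro v w; rw [hF, chevalley_F, MulOpposite.unop_op]
  | hk i => intro v w; rw [hK, chevalley_K, MulOpposite.unop_op]
  | hk' i => intro v w; rw [hK', chevalley_KInv, MulOpposite.unop_op]
  | hmul x y hx hy =>
    intro v w
    rw [mul_smul, hx, hy, map_mul, MulOpposite.unop_mul, mul_smul]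
  | hadd x y hx hy =>
    intro v w
    rw [add_smul, map_add, LinearMap.add_apply, hx, hy, map_add, MulOpposite.unop_add, add_smul,
      map_add]

/-- On generators this rearranges the invariance identities after moving `q^{±h_α}` across the form.
Both sides then extend over products, as `γ⁻¹` is an anti-homomorphism. -/
theorem IsInvariantForm.adjoint_antipodeInv {B : V →ₗ[ℂ] W →ₗ[ℂ] ℂ} (h : IsInvariantForm n q B)
    (y : Uq n q) : ∀ v w, B v (y • w) = B ((antipodeInv n q y).unop • v) w := by
  have H := satisfies_Uq n q
  have hK (i : Fin n) (v : V) (w : W) : B v (K q i • w) = B (KInv q i • v) w := by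
    rw [← h.k i (KInv q i • v), ← mul_smul, H.k_kInv, one_smul]
  have hK' (i : Fin n) (v : V) (w : W) : B v (KInv q i • w) = B (K q i • v) w := by
    rw [← h.k i v, ← mul_smul, H.k_kInv, one_smul]
  induction y using Uq.induction with
  | hc c =>
    intro v w
    rw [AlgHom.commutes, algebraMap_smul, MulOpposite.algebraMap_apply, MulOpposite.unop_op,
      algebraMap_smul, map_smul, map_smul, LinearMap.smul_apply]
  | he i =>
    intro v w
    rw [antipodeInv_E, MulOpposite.unop_op, neg_smul, mul_smul, map_neg, LinearMap.neg_apply, ← hK,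
      eq_neg_iff_add_eq_zero, add_comm, h.e]
  | hf i =>
    intro v w
    have := h.f i (K q i • v) w
    rw [← mul_smul (KInv q i), H.kInv_k, one_smul] at this
    rw [antipodeInv_F, MulOpposite.unop_op, neg_smul, mul_smul, map_neg, LinearMap.neg_apply,
      eq_neg_iff_add_eq_zero, add_comm, this]
  | hk i => intro v w; rw [antipodeInv_K, MulOpposite.unop_op, hK]
  | hk' i => intro v w; rw [antipodeInv_KInv, MulOpposite.unop_op, hK']
  | hmul x y hx hy =>
    intro v w
    rw [mul_smul, hx, hy, map_mul, MulOpposite.unop_mul, mul_smul]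
  | hadd x y hx hy =>
    intro v w
    rw [add_smul, map_add, hx, hy, map_add, MulOpposite.unop_add, add_smul, map_add,
      LinearMap.add_apply]

end Involutions

/-! ### Invariance of the diagonal pairing. -/

section Pairing

variable {n : ℕ} {q p s : ℂˣ} {ρ ρ' : Uq n q →ₐ[ℂ] Module.End ℂ Fock}
  {V W : Type*} [AddCommGroup V] [Module ℂ V] [Module (Uq n q) V]
  [IsScalarTower ℂ (Uq n q) V] [AddCommGroup W] [Module ℂ W] [Module (Uq n q) W]
  [IsScalarTower ℂ (Uq n q) W] {v₀ : V} {w₀ : W} {Φ : V →ₗ[ℂ] Fock} {Φ' : W →ₗ[ℂ] Fock}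
  {u : Module.Basis (Fin n → ℕ) ℂ V} {u' : Module.Basis (Fin n → ℕ) ℂ W}

theorem isInvariantForm_diagForm (hp : p ^ 2 = q)
    (H : IsFockModel (fockConst p s) s (E q) (F q) (K q) (KInv q) ρ v₀ Φ)
    (H' : IsFockModel (fockConst p s) s (F q) (E q) (KInv q) (K q) ρ' w₀ Φ')
    (hu : ∀ m, Φ (u m) = Finsupp.single (embed m) 1)
    (hu' : ∀ m, Φ' (u' m) = Finsupp.single (embed m) 1) :
    IsInvariantForm n q (diagForm u u' (pairingCoeff p q)) := by
  classical
  set B := diagForm u u' (pairingCoeff p q) with hB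
  refine ⟨fun i v w => ?_, fun i v w => ?_, fun i v w => ?_⟩
  · have h := bilinear_smul_ext (R := Uq n q) (u := u) (u' := u') (B := B) (B' := -B)
      (a := E q i) (b := K q i) (a' := 1) (b' := E q i) (fun m r => ?_) v w
    · rw [h, one_smul, LinearMap.neg_apply, LinearMap.neg_apply, neg_add_cancel]
    · rw [one_smul, LinearMap.neg_apply, LinearMap.neg_apply, eq_neg_iff_add_eq_zero,
        H'.kInv_smul_basis hu', map_smul, hB, diagForm_right, diagForm_left, H.repr_e_smul hu,
        H'.repr_f_smul hu']
      split_ifs with h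
      · rw [smul_eq_mul, mul_comm]
        exact pairingCoeff_invariant hp h
      · simp
  · have h := bilinear_smul_ext (R := Uq n q) (u := u) (u' := u') (B := B) (B' := -B)
      (a := F q i) (b := 1) (a' := KInv q i) (b' := F q i) (fun m r => ?_) v w
    · rw [one_smul] at h
      rw [h, LinearMap.neg_apply, LinearMap.neg_apply, neg_add_cancel]
    · rw [one_smul, LinearMap.neg_apply, LinearMap.neg_apply, eq_neg_iff_add_eq_zero,
        H.kInv_smul_basis hu, LinearMap.map_smul B, LinearMap.smul_apply, hB, diagForm_right, diagForm_left,
        H.repr_f_smul hu, H'.repr_e_smul hu']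
      split_ifs with h
      · rw [smul_eq_mul, add_comm, mul_comm _ (_ * _)]
        exact pairingCoeff_invariant hp h
      · simp
  · have h := bilinear_smul_ext (R := Uq n q) (u := u) (u' := u') (B := B) (B' := B)
      (a := K q i) (b := K q i) (a' := 1) (b' := 1) (fun m r => ?_) v w
    · rwa [one_smul, one_smul] at h
    · rw [one_smul, one_smul, H.k_smul_basis hu, H'.kInv_smul_basis hu', map_smul, map_smul,
        LinearMap.smul_apply, hB, diagForm_left]
      by_cases hmr : m = r
      · subst hmr
        rw [smul_smul, Units.inv_mul, one_smul]
      · simp [Ne.symm hmr]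

end Pairing

/-! ### The image of `𝓕` in `N_λ ⊗ M_λ`. -/

section Tensor

variable {n : ℕ} {q p s : ℂˣ}

theorem act_tensorF (m : Fin n → ℕ) : act n q s (tensorF n p q m) =
    coeffF p q m • ((monomial (rootVecE q (E (n := n) q)) m • nGen n q s) ⊗ₜ[ℂ]
      basisVec n q s m) := by
  have hE : (nPlus n q).val (monomial (rootVecE q (ePlus (n := n) q)) m) =
      monomial (rootVecE q (E (n := n) q)) m := by
    rw [map_monomial, funext (map_rootVecE (nPlus n q).val (ePlus (n := n) q))]
    rfl
  have hF : (nMinus n q).val (monomial (rootVecF q (fMinus (n := n) q)) m) =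
      monomial (rootVecF q (F (n := n) q)) m := by
    rw [map_monomial, funext (map_rootVecF (nMinus n q).val (fMinus (n := n) q))]
    rfl
  rw [tensorF, map_smul, act, TensorProduct.map_tmul]
  simp only [LinearMap.comp_apply, AlgHom.toLinearMap_apply, hE, hF]
  rfl

end Tensor

end

end QSphere

theorem mainTheorem3 (n : ℕ) (hn : 1 ≤ n) (q p s : ℂˣ)
    (hq : ∀ k : ℕ, 0 < k → q ^ k ≠ 1) (hp : p ^ 2 = q) (hs : s ^ 2 = -q⁻¹) :
    ∃ φ : Uq n q →ₗ[ℂ] ℂ,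
      (IsVacuumExpectation s φ ∧ ∀ ψ : Uq n q →ₗ[ℂ] ℂ, IsVacuumExpectation s ψ → ψ = φ) ∧
      (∃ S : M n q s →ₗ[ℂ] M n q s →ₗ[ℂ] ℂ,
        (∀ x y : Uq n q, S (x • mGen n q s) (y • mGen n q s) =
          φ ((chevalley n q x).unop * y)) ∧
        LinearIndependent ℂ (basisVec n q s) ∧
        Submodule.span ℂ (Set.range (basisVec n q s)) = ⊤ ∧
        (∀ k m : Fin n → ℕ, k ≠ m → S (basisVec n q s k) (basisVec n q s m) = 0) ∧
        (∀ m : Fin n → ℕ, S (basisVec n q s m) (basisVec n q s m) ≠ 0)) ∧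
      IsSimpleModule (Uq n q) (M n q s) ∧
      IsSimpleModule (Uq n q) (N n q s) ∧
      ∃ B : M n q s →ₗ[ℂ] N n q s →ₗ[ℂ] ℂ,
        (∀ x y : Uq n q, B (x • mGen n q s) (y • nGen n q s) =
          φ ((antipodeInv n q y).unop * x)) ∧
        IsInvariantForm n q B ∧
        B (mGen n q s) (nGen n q s) = 1 ∧
        IsInverseForm B (fun m : Fin n → ℕ => act n q s (tensorF n p q m)) := by
  have hκ : fockConst p s ≠ 0 := fockConst_ne_zero hq hp
  obtain ⟨ρ, hρE, hρF, hρK, hρK'⟩ := (fock_satisfies (n := n) hq hp hs).exists_algHom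
  obtain ⟨ρ', hρE', hρF', hρKi, hρKi'⟩ := (fock_satisfies (n := n) hq hp hs).swap.exists_algHom
  obtain ⟨Φ, H⟩ := exists_fockModel_M ρ hρE hρF hρK hρK'
  obtain ⟨Φ', H'⟩ := exists_fockModel_N ρ' hρE' hρF' hρKi hρKi'
  obtain ⟨u, hu⟩ := H.exists_basis hq
  obtain ⟨u', hu'⟩ := H'.exists_basis hq
  have hvac := isVacuumExpectation_vacuumExpectation H hq
  have hbasis (m : Fin n → ℕ) : basisVec n q s m = rootCoeff q m • u m := by
    refine fock_injective hu ?_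
    rw [basisVec, H.map_root hq, map_smul, hu, Finsupp.smul_single, smul_eq_mul, mul_one]
  -- With the bracket order of `ẽ_{ε_i}` no scalar appears, unlike for the `f_{ε_i}`.
  have hbasis' (m : Fin n → ℕ) : monomial (rootVecE q (E (n := n) q)) m • nGen n q s = u' m := by
    refine fock_injective hu' ?_
    have e := map_monomial (B := Module.End ℂ Fock) ρ' (rootVecE q (E (n := n) q)) m
    rw [H'.map_smul, H'.map_gen, hu', e,
      funext (map_rootVecE (B := Module.End ℂ Fock) ρ' (E (n := n) q)), funext H'.map_f]
    exact monomial_rootVecE_fock (sub_inv_ne_zero hq) m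
  let b := u.isUnitSMul fun m => (rootCoeff_ne_zero q m).isUnit
  have hb : ⇑b = basisVec n q s := by
    funext m
    rw [Module.Basis.isUnitSMul_apply, hbasis]
  have hS := adjoint_chevalley (H.shapovalov_e_f hu) (H.shapovalov_f_e hu)
    (fun i => IsFockModel.diagForm_smul_of_eigen _ (H.k_smul_basis hu i))
    (fun i => IsFockModel.diagForm_smul_of_eigen _ (H.kInv_smul_basis hu i))
  have hB := isInvariantForm_diagForm hp H H' hu hu'
  have hone (m : Fin n → ℕ) := coeffF_mul_pairingCoeff hq hp m
  refine ⟨vacuumExpectation ρ, ⟨hvac, fun ψ hψ => hψ.unique hvac⟩,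
    ⟨diagForm u u (shapovalovCoeff q (fockConst p s)), fun x y => ?_, ?_, ?_, fun k m hkm => ?_,
      fun m => ?_⟩, H.isSimpleModule hq hκ, H'.isSimpleModule hq hκ,
    diagForm u u' (pairingCoeff p q), fun x y => ?_, hB, ?_, fun v => ?_, fun w => ?_⟩
  -- Moving `x` to the right argument leaves the form of `1_λ = u 0` with `ω(x) y 1_λ`, which is the
  -- coefficient at `u 0`, the vacuum expectation.
  · rw [hS, ← mul_smul]
    nth_rw 1 [← H.basis_zero hu]
    rw [diagForm_left, H.repr_gen hu, shapovalovCoeff_zero, one_mul]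
  · exact hb ▸ b.linearIndependent
  · exact hb ▸ b.span_eq
  · rw [hbasis, hbasis, map_smul, map_smul, LinearMap.smul_apply, diagForm_left]
    simp [hkm.symm]
  · rw [hbasis, map_smul, map_smul, LinearMap.smul_apply, diagForm_left]
    simp [rootCoeff_ne_zero q m, shapovalovCoeff_ne_zero hq hκ m]
  · rw [hB.adjoint_antipodeInv, ← mul_smul, ← H'.basis_zero hu', diagForm_right, H.repr_gen hu,
      pairingCoeff_zero, one_mul]
  · rw [← H.basis_zero hu, ← H'.basis_zero hu', diagForm_left, pairingCoeff_zero]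
    simp
  -- The three scalars from `𝓕`, from `basisVec` and from the pairing multiply to one, so
  -- contraction with the term `m` is the projection of `v` to the line of `u m`.
  · have h (m : Fin n → ℕ) : contractV (diagForm u u' (pairingCoeff p q)) v
        (act n q s (tensorF n p q m)) = u.repr v m • u m := by
      rw [act_tensorF, hbasis', hbasis, contractV]
      simp only [map_smul, LinearMap.comp_apply, TensorProduct.map_tmul, LinearMap.id_apply,
        LinearEquiv.coe_coe, TensorProduct.lid_tmul, diagForm_right, smul_smul]
      congr 1
      linear_combination (u.repr v m) * hone m
    simp only [h]
    exact basis_finsum_repr u v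
  · have h (m : Fin n → ℕ) : contractW (diagForm u u' (pairingCoeff p q)) w
        (act n q s (tensorF n p q m)) = u'.repr w m • u' m := by
      rw [act_tensorF, hbasis', hbasis, contractW]
      simp only [map_smul, LinearMap.comp_apply, TensorProduct.map_tmul, LinearMap.id_apply,
        LinearEquiv.coe_coe, TensorProduct.rid_tmul, LinearMap.flip_apply, diagForm_left, smul_smul,
        smul_eq_mul]
      congr 1
      linear_combination (u'.repr w m) * hone m
    simp only [h]
    exact basis_finsum_repr u' w
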